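/- Let $k\ge 1$ be a fixed integer and, for every $N$, let $M_N=(M_N(i_1,\dots,i_{2k}))_{i_1,\dots,i_{2k}\in[N]}\in(\mathbb C^N)^{\otimes 2k}$ be a random tensor with i.i.d. entries distributed as a centered complex random variable $m_N$ having finite moments of all orders. Assume that, as $N\to\infty$, $$N^k\,\mathbb E[|m_N|^2]\to c>0,\qquad N^k\,\mathbb E[m_N^2]\to c'\in\mathbb C,\qquad N^k\,\mathbb E[m_N^{\ell_1}\overline{m_N}^{\,\ell_2}]\to 0$$ for all non-negative integers $\ell_1,\ell_2$ with $\ell_1+\ell_2>2$. For $\sigma$ in the symmetric group $\mathfrak S_{2k}$, let $M_{N,\sigma}$ be the flattening of $M_N$, i.e. the $N^k\times N^k$ matrix whose entry at row $(i_1,\dots,i_k)$ and column $(i_{k+1},\dots,i_{2k})$ is $M_N(i_{\sigma^{-1}(1)},\dots,i_{\sigma^{-1}(2k)})$. Put $$S_{1,N}=\frac{1}{\sqrt{(2k)!\,k!\,c}}\sum_{\sigma\in\mathfrak S_{2k}}M_{N,\sigma},\qquad S_{2,N}=\frac{1}{\sqrt{(2k)!\,k!\,c}}\sum_{\sigma\in\mathfrak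 S_{2k}}\mathrm{sg}(\sigma)M_{N,\sigma},$$ where $\mathrm{sg}(\sigma)$ is the signature of $\sigma$, and, when $c+\Re c'>0$, $$S_{3,N}=\frac{1}{\sqrt{2\,(2k)!\,k!\,(c+\Re c')}}\sum_{\sigma\in\mathfrak S_{2k}}\big(M_{N,\sigma}+M_{N,\sigma}^*\big).$$ The averaged empirical eigenvalue distribution of a random Hermitian $n\times n$ matrix with eigenvalues $\lambda_1,\dots,\lambda_n$ is the measure $\mathbb E\big[\frac1n\sum_{i=1}^n\delta_{\lambda_i}\big]$. Let $\mathrm{MP}$ be the Marchenko–Pastur distribution with density $\frac{\sqrt{(4-x)x}}{2\pi x}$ on $(0,4)$, and $\mathrm{SC}$ the standard semicircular distribution, with density $\frac{\sqrt{4-x^2}}{2\pi}$ on $(-2,2)$. Then, as $N\to\infty$: 1. the averaged empirical eigenvalue distributions of $S_{1,N}S_{1,N}^*$ and of $S_{2,N}S_{2,N}^*$ converge weakly to $\big(1-\frac1{k!}\big)\delta_0+\frac1{k!}\mathrm{MP}$; 2. if $c+\Re c'>0$, the averaged empirical eigenvalue distribution of $S_{3,N}$ converges weakly to $\big(1-\frac1{k!}\big)\delta_0+\frac1{k!}\mathrm{SC}$;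 3. if $k\ge2$, the family of flattenings $(M_{N,\sigma})_{\sigma\in\mathfrak S_{2k}}$ is not asymptotically free. Here asymptotic freeness, with respect to $\Phi_N=\mathbb E[N^{-k}\,\mathrm{Tr}\,\cdot\,]$, means that all joint $*$-moments of the family converge and that $$\Phi_N\big(p_1(M_{N,\sigma_1},M_{N,\sigma_1}^*)\cdots p_L(M_{N,\sigma_L},M_{N,\sigma_L}^*)\big)\to0$$ for all $L\ge1$, all $\sigma_1\ne\sigma_2\ne\dots\ne\sigma_L$ (consecutive indices distinct) and all noncommutative polynomials $p_\ell$ with $\Phi_N(p_\ell(M_{N,\sigma_\ell},M_{N,\sigma_\ell}^*))\to0$ for every $\ell$. -/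

import Mathlib

open MeasureTheory ProbabilityTheory Filter Topology
open scoped BoundedContinuousFunction

noncomputable section

namespace Flattenings

/-! ### Tensors and their flattenings -/

/-- Complex tensors of order `2k = k + k` on `ℂ^N`, as multi-indexed arrays. -/
abbrev Tensor (k N : ℕ) : Type := (Fin (k + k) → Fin N) → ℂ

/-- Square matrices of size `N^k`, with rows and columns indexed by `[N]^k`. -/
abbrev Mat (k N : ℕ) : Type := Matrix (Fin k → Fin N) (Fin k → Fin N) ℂ

/-- The flattening `M_σ` of `M` for a permutation `σ` of the `2k` legs: its entry at the row
`(i_1, …, i_k)` and the column `(i_{k+1}, …, i_{2k})` is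
`M (i_{σ⁻¹(1)}, …, i_{σ⁻¹(2k)})`. -/
def flattening {k N : ℕ} (M : Tensor k N) (σ : Equiv.Perm (Fin (k + k))) : Mat k N :=
  Matrix.of fun i j => M fun p => Fin.append i j (σ⁻¹ p)

/-- The assumption on the sequence of random tensors `(M_N)`, with parameter `(c, c')`; `μ N` is
the common law of the entries of `M_N`. The tensors of different sizes need not be defined on the
same probability space. -/
structure IsTensorModel (k : ℕ) {Ω : ℕ → Type*} [∀ N, MeasurableSpace (Ω N)]
    (P : ∀ N, Measure (Ω N)) (M : ∀ N, Ω N → Tensor k N) (μ : ℕ → Measure ℂ)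
    (c : ℝ) (c' : ℂ) : Prop where
  measurable_entry : ∀ N i, Measurable fun ω => M N ω i
  indep : ∀ N, iIndepFun (fun i ω => M N ω i) (P N)
  law : ∀ N i, (P N).map (fun ω => M N ω i) = μ N
  finite_moments : ∀ (N ℓ : ℕ), Integrable (fun z : ℂ => ‖z‖ ^ ℓ) (μ N)
  centered : ∀ N, ∫ z, z ∂(μ N) = 0
  c_pos : 0 < c
  tendsto_c : Tendsto (fun N : ℕ => (N : ℝ) ^ k * ∫ z, ‖z‖ ^ 2 ∂(μ N)) atTop (𝓝 c)
  tendsto_c' : Tendsto (fun N : ℕ => (N : ℂ) ^ k * ∫ z, z ^ 2 ∂(μ N)) atTop (𝓝 c')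
  tendsto_zero : ∀ ℓ₁ ℓ₂ : ℕ, 2 < ℓ₁ + ℓ₂ →
    Tendsto (fun N : ℕ => (N : ℂ) ^ k * ∫ z, z ^ ℓ₁ * (starRingEnd ℂ z) ^ ℓ₂ ∂(μ N))
      atTop (𝓝 0)

/-- `S₁ = ((2k)! k! c)^{-1/2} ∑_σ M_σ`. -/
def S₁ {k N : ℕ} (c : ℝ) (M : Tensor k N) : Mat k N :=
  (1 / √((2 * k).factorial * k.factorial * c) : ℝ) •
    ∑ σ : Equiv.Perm (Fin (k + k)), flattening M σ

/-- `S₂ = ((2k)! k! c)^{-1/2} ∑_σ sg(σ) M_σ`. -/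
def S₂ {k N : ℕ} (c : ℝ) (M : Tensor k N) : Mat k N :=
  (1 / √((2 * k).factorial * k.factorial * c) : ℝ) •
    ∑ σ : Equiv.Perm (Fin (k + k)), ((Equiv.Perm.sign σ : ℤ) : ℂ) • flattening M σ

/-- `S₃ = (2 (2k)! k! (c + Re c'))^{-1/2} ∑_σ (M_σ + M_σ^*)`. -/
def S₃ {k N : ℕ} (c : ℝ) (c' : ℂ) (M : Tensor k N) : Mat k N :=
  (1 / √((2 * k).factorial * k.factorial * (2 * (c + c'.re))) : ℝ) •
    ∑ σ : Equiv.Perm (Fin (k + k)), (flattening M σ + (flattening M σ).conjTranspose)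

theorem isHermitian_S₃ {k N : ℕ} (c : ℝ) (c' : ℂ) (M : Tensor k N) : (S₃ c c' M).IsHermitian := by
  unfold S₃ Matrix.IsHermitian
  simp [Matrix.conjTranspose_smul, Matrix.conjTranspose_sum, add_comm]

/-! ### Empirical eigenvalue distributions and the limit laws -/

section Spectral

variable {n : Type*} [Fintype n] [DecidableEq n]

/-- The empirical eigenvalue distribution `(1/n) ∑ δ_{λ_i}` of a Hermitian matrix. -/
def esd (A : Matrix n n ℂ) (hA : A.IsHermitian) : Measure ℝ :=
  (Fintype.card n : ENNReal)⁻¹ • ∑ i, Measure.dirac (hA.eigenvalues i)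

/-- The averaged empirical eigenvalue distribution `𝔼[(1/n) ∑ δ_{λ_i}]` of a random Hermitian
matrix. -/
def averagedESD {Ω : Type*} [MeasurableSpace Ω] (P : Measure Ω) (A : Ω → Matrix n n ℂ)
    (hA : ∀ ω, (A ω).IsHermitian) : Measure ℝ :=
  P.bind fun ω => esd (A ω) (hA ω)

end Spectral

/-- Weak convergence of measures on the real line. -/
def ConvergesWeakly (ν : ℕ → Measure ℝ) (ν' : Measure ℝ) : Prop :=
  ∀ f : ℝ →ᵇ ℝ, Tendsto (fun N => ∫ x, f x ∂(ν N)) atTop (𝓝 (∫ x, f x ∂ν'))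

/-- The Marchenko-Pastur law of shape parameter `1` and variance `1`. -/
def marchenkoPastur : Measure ℝ :=
  volume.withDensity fun x =>
    ENNReal.ofReal ((Set.Ioo 0 4).indicator (fun x => √((4 - x) * x) / (2 * Real.pi * x)) x)

/-- The standard semicircular law (centered, of variance `1`). -/
def semicircle : Measure ℝ :=
  volume.withDensity fun x =>
    ENNReal.ofReal ((Set.Ioo (-2) 2).indicator (fun x => √(4 - x ^ 2) / (2 * Real.pi)) x)

/-- The mixture `(1 - p) δ_0 + p ν`. -/
def dilution (p : ℝ) (ν : Measure ℝ) : Measure ℝ :=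
  ENNReal.ofReal (1 - p) • Measure.dirac 0 + ENNReal.ofReal p • ν

/-! ### Asymptotic freeness -/

/-- The normalized expected trace `𝔼[(1/n) Tr A]`. -/
def meanTrace {n : Type*} [Fintype n] {Ω : Type*} [MeasurableSpace Ω] (P : Measure Ω)
    (A : Ω → Matrix n n ℂ) : ℂ :=
  ∫ ω, (Fintype.card n : ℂ)⁻¹ * (A ω).trace ∂P

/-- Evaluation at `(A, A^*)` of a noncommutative polynomial in two variables: `false` stands for
the variable and `true` for its adjoint. -/
def starEval {n : Type*} [Fintype n] [DecidableEq n] (A : Matrix n n ℂ) :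
    FreeAlgebra ℂ Bool →ₐ[ℂ] Matrix n n ℂ :=
  FreeAlgebra.lift ℂ fun b => if b then A.conjTranspose else A

/-- Asymptotic freeness of a family `(A_{N,j})_j` of random matrices: the family converges in
`*`-distribution, and the limit is a free family, that is, an alternating product of polynomials in
the individual matrices and their adjoints whose limit expectations vanish has a vanishing
limit expectation. -/
def AsymptoticallyFree {J : Type*} {n : ℕ → Type*} [∀ N, Fintype (n N)] [∀ N, DecidableEq (n N)]
    {Ω : ℕ → Type*} [∀ N, MeasurableSpace (Ω N)] (P : ∀ N, Measure (Ω N))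
    (A : ∀ N, J → Ω N → Matrix (n N) (n N) ℂ) : Prop :=
  (∀ w : List (J × Bool), ∃ l : ℂ, Tendsto (fun N => meanTrace (P N) fun ω =>
      (w.map fun p => if p.2 then (A N p.1 ω).conjTranspose else A N p.1 ω).prod) atTop (𝓝 l)) ∧
  ∀ w : List (J × FreeAlgebra ℂ Bool), w ≠ [] → w.IsChain (fun p q => p.1 ≠ q.1) →
    (∀ p ∈ w, Tendsto (fun N => meanTrace (P N) fun ω => starEval (A N p.1 ω) p.2)
      atTop (𝓝 0)) →
    Tendsto (fun N => meanTrace (P N) fun ω => (w.map fun p => starEval (A N p.1 ω) p.2).prod)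
      atTop (𝓝 0)

end Flattenings

end

/-! A sum of flattenings weighted by a character χ of the leg permutations with values ±1 is the
flattening of a single tensor T with T(x ∘ τ) = χ(τ) T(x). Rows that are rearrangements of one
another therefore agree up to sign, and so do columns: the matrix is F H F^* with F an isometry and
H indexed by monotone k-tuples (`symMat_eq`). There are about N^k / k! such tuples, so every moment
of order at least 1 carries a factor 1/k!, and the missing mass is the atom at 0. S₁ is the case of
the trivial character, S₂ that of the signature, and S₃ that of the trivial character applied to the
tensor 2 Re M, whose second moment is asymptotic to 2(c + Re c') / N^k.

The matrix H is of Wigner type (`LabelledModel`). Its entry at (a, b) is a deterministic coefficient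
times a variable attached to the multiset union of a and b, and distinct multisets carry independent
variables. The multiset and a determine b, and each multiset meets boundedly many rows. The
normalization makes the row variances tend to 1 on average. In an alternating word H H^* H ⋯, a
backtrack a → b → a pairs a letter with an adjoint and yields |H a b|², so E[m²] plays no role for
S₁ and S₂.

The limit moments are found by a recursion instead of a count of pairings. Let `pathSum s r` be the
sum over closed walks of length s + r whose first s labels are distinct. After s + 1 distinct
labels, the next edge has a new label, or repeats the last one and backtracks, or repeats an older
one, which is negligible. Hence, after division by N^k, `pathSum (s+1) (r+1)` is asymptotically
`pathSum (s+2) r + pathSum s r` (`norm_pathSum_step_le`). The integrals of x^r S_s(x) against the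
semicircular law, with S_s the rescaled Chebyshev polynomials, obey the same recursion because x
S_{s+1} = S_{s+2} + S_s, and the same boundary values by orthogonality (`chebMoment`). The
Marchenko-Pastur law is the law of the square of a semicircular variable, so its moments are the
even ones. The method of moments (`convergesWeakly_of_moments`) concludes.

Freeness fails because permuting the column legs multiplies M on the right by a permutation matrix
and leaves M M^* unchanged. For p = x x^* - c, freeness of two such flattenings would force the
normalized trace of (M M^* - c)² to tend to 0, while the off-diagonal entries of M M^* alone
contribute c². -/

noncomputable section

set_option linter.unusedSectionVars false

namespace Flattenings

/-! ### Sums over paths -/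

section Paths

variable {V L E : Type*} [Fintype V]

/-- The sum of `f` over all lists of length `r`. -/
def sumPaths [AddCommMonoid E] : ℕ → (List V → E) → E
  | 0, f => f []
  | r + 1, f => ∑ b, sumPaths r fun t => f (b :: t)

theorem sumPaths_congr [AddCommMonoid E] {r : ℕ} {f g : List V → E}
    (h : ∀ t, t.length = r → f t = g t) : sumPaths r f = sumPaths r g := by
  induction r generalizing f g with
  | zero => exact h [] rfl
  | succ r ih => exact Finset.sum_congr rfl fun b _ => ih fun t ht => h _ (by simp [ht])

theorem sumPaths_zero_fun [AddCommMonoid E] (r : ℕ) :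
    sumPaths r (fun _ : List V => (0 : E)) = 0 := by
  induction r with
  | zero => rfl
  | succ r ih => exact Finset.sum_eq_zero fun b _ => ih

theorem sumPaths_sub [AddCommGroup E] (r : ℕ) (f g : List V → E) :
    sumPaths r (fun t => f t - g t) = sumPaths r f - sumPaths r g := by
  induction r generalizing f g with
  | zero => rfl
  | succ r ih => simp only [sumPaths, ih, Finset.sum_sub_distrib]

theorem sumPaths_mul_left [Semiring E] (r : ℕ) (c : E) (f : List V → E) :
    sumPaths r (fun t => c * f t) = c * sumPaths r f := by
  induction r generalizing f with
  | zero => rfl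
  | succ r ih => simp only [sumPaths, ih, Finset.mul_sum]

theorem sumPaths_sum [AddCommMonoid E] {ι : Type*} (r : ℕ) (s : Finset ι)
    (f : ι → List V → E) :
    sumPaths r (fun t => ∑ i ∈ s, f i t) = ∑ i ∈ s, sumPaths r (f i) := by
  induction r generalizing f with
  | zero => rfl
  | succ r ih => simp only [sumPaths, ih]; exact Finset.sum_comm

theorem sumPaths_succ_last [AddCommMonoid E] (r : ℕ) (f : List V → E) :
    sumPaths (r + 1) f = sumPaths r fun t => ∑ b, f (t ++ [b]) := by
  induction r generalizing f with
  | zero => rfl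
  | succ r ih =>
    rw [sumPaths]
    exact Finset.sum_congr rfl fun b _ => ih _

theorem norm_sumPaths_le {r : ℕ} {f : List V → ℂ} {g : List V → ℝ}
    (h : ∀ t, t.length = r → ‖f t‖ ≤ g t) : ‖sumPaths r f‖ ≤ sumPaths r g := by
  induction r generalizing f g with
  | zero => exact h [] rfl
  | succ r ih => exact norm_sum_le_of_le _ fun b _ => ih fun t ht => h _ (by simp [ht])

end Paths

/-! ### Walks and the labels of their edges -/

section Labels

variable {V L : Type*}

/-- The endpoint of the path starting at `a` with successive vertices `t`. -/
def endpoint : V → List V → V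
  | a, [] => a
  | _, b :: t => endpoint b t

@[simp] theorem endpoint_append (a : V) (t t' : List V) :
    endpoint a (t ++ t') = endpoint (endpoint a t) t' := by
  induction t generalizing a with
  | nil => rfl
  | cons b t ih => exact ih b

/-- The labels of the successive edges of a path. -/
def labs (u : V → V → L) : V → List V → List L
  | _, [] => []
  | a, b :: t => u a b :: labs u b t

theorem labs_append (u : V → V → L) (a : V) (t t' : List V) :
    labs u a (t ++ t') = labs u a t ++ labs u (endpoint a t) t' := by
  induction t generalizing a with
  | nil => rfl
  | cons b t ih => simp [labs, ih, endpoint]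

@[simp] theorem length_labs (u : V → V → L) (a : V) (t : List V) :
    (labs u a t).length = t.length := by
  induction t generalizing a with
  | nil => rfl
  | cons b t ih => simp [labs, ih]

end Labels

/-! ### Weighted counts of walks -/

section PathBounds

variable {V L : Type*} [Fintype V]

/-- All steps are allowed, so every vertex is the endpoint of exactly |V|^s walks. An error attached
to the endpoint thus need only be small on average over the vertices. -/
theorem sum_sumPaths_endpoint (s : ℕ) (f : V → ℝ) :
    ∑ a, sumPaths s (fun t => f (endpoint a t)) = (Fintype.card V : ℝ) ^ s * ∑ a, f a := by
  induction s with
  | zero => simp [sumPaths, endpoint]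
  | succ s ih =>
    simp only [sumPaths, endpoint, ih]
    simp [pow_succ]
    ring

theorem card_filter_mem_le [DecidableEq L] {u : V → V → L}
    (hu : ∀ a b c, u a b = u a c → b = c) (a : V) (F : Finset L) :
    (Finset.univ.filter fun b => u a b ∈ F).card ≤ F.card :=
  Finset.card_le_card_of_injOn (u a) (fun b hb => by simpa using hb)
    fun b _ c _ h => hu a b c h

/-- A step to a fresh label costs a factor q and has at most |V| choices, hence at most C in total.
A step to a label already seen costs nothing, but injectivity along rows leaves at most one choice
per label seen. The set F of labels seen varies in the induction. -/
theorem sumPaths_weight_le [DecidableEq L] {u : V → V → L}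
    (hu : ∀ a b c, u a b = u a c → b = c) {q C : ℝ} (hq : 0 ≤ q)
    (hC : (Fintype.card V : ℝ) * q ≤ C) (r : ℕ) (a : V) (F : Finset L) :
    sumPaths r (fun t => q ^ (F ∪ (labs u a t).toFinset).card)
      ≤ q ^ F.card * (C + F.card + r) ^ r := by
  have hC0 : 0 ≤ C := le_trans (by positivity) hC
  induction r generalizing a F with
  | zero => simp [sumPaths, labs]
  | succ r ih =>
    have h1 : ∀ b, sumPaths r (fun t => q ^ (F ∪ (labs u a (b :: t)).toFinset).card)
        ≤ q ^ F.card * (q + if u a b ∈ F then 1 else 0) * (C + F.card + (r + 1 : ℕ)) ^ r := by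
      intro b
      have h2 : ∀ t, F ∪ (labs u a (b :: t)).toFinset = insert (u a b) F ∪ (labs u b t).toFinset := by
        intro t; ext x; simp [labs]
      simp only [h2]
      refine (ih b _).trans ?_
      have h3 : ((insert (u a b) F).card : ℝ) ≤ F.card + 1 := by
        exact_mod_cast Finset.card_insert_le _ _
      have h4 : q ^ (insert (u a b) F).card ≤ q ^ F.card * (q + if u a b ∈ F then 1 else 0) := by
        split_ifs with h
        · rw [Finset.insert_eq_of_mem h]
          nlinarith [pow_nonneg hq F.card]
        · rw [Finset.card_insert_of_notMem h, add_zero, pow_succ]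
      push_cast
      refine mul_le_mul h4 ?_ (by positivity) (by split_ifs <;> positivity)
      gcongr ?_ ^ r
      linarith
    rw [sumPaths]
    refine (Finset.sum_le_sum fun b _ => h1 b).trans ?_
    rw [← Finset.sum_mul, ← Finset.mul_sum, pow_succ (C + _ + _), mul_assoc]
    have h5 : ∑ b, (q + if u a b ∈ F then (1 : ℝ) else 0) ≤ C + F.card + (r + 1 : ℕ) := by
      rw [Finset.sum_add_distrib]
      have h6 : ((Finset.univ.filter fun b => u a b ∈ F).card : ℝ) ≤ F.card := by
        exact_mod_cast card_filter_mem_le hu a F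
      simp only [Finset.sum_const, Finset.card_univ, nsmul_eq_mul, Finset.sum_boole]
      have : (0 : ℝ) ≤ (r + 1 : ℕ) := by positivity
      linarith
    rw [mul_comm ((C + _ + _) ^ r)]
    gcongr

end PathBounds

/-! ### Random variables with finite moments of all orders -/

section Moments

variable {Ω : Type*} [MeasurableSpace Ω] {P : Measure Ω}

/-- Measurable complex random variables with finite moments of all orders. -/
structure AllMoments (P : Measure Ω) (X : Ω → ℂ) : Prop where
  measurable : Measurable X
  integrable_pow : ∀ n : ℕ, Integrable (fun ω => ‖X ω‖ ^ n) P

namespace AllMoments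

variable {X Y : Ω → ℂ}

theorem integrable (hX : AllMoments P X) : Integrable X P :=
  (integrable_norm_iff hX.measurable.aestronglyMeasurable).1 (by simpa using hX.integrable_pow 1)

theorem of_norm_le [IsFiniteMeasure P] (hX : AllMoments P X) (hY : Measurable Y)
    (h : ∀ ω, ‖Y ω‖ ≤ ‖X ω‖) : AllMoments P Y :=
  ⟨hY, fun n => (hX.integrable_pow n).mono' (hY.norm.pow_const n).aestronglyMeasurable
    (Eventually.of_forall fun ω => by
      rw [Real.norm_of_nonneg (by positivity)]
      exact pow_le_pow_left₀ (norm_nonneg _) (h ω) n)⟩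

theorem const [IsFiniteMeasure P] (c : ℂ) : AllMoments P fun _ => c :=
  ⟨measurable_const, fun _ => integrable_const _⟩

theorem mul (hX : AllMoments P X) (hY : AllMoments P Y) : AllMoments P fun ω => X ω * Y ω := by
  refine ⟨hX.measurable.mul hY.measurable, fun n => ?_⟩
  refine ((hX.integrable_pow (2 * n)).add (hY.integrable_pow (2 * n))).mono'
    ((hX.measurable.mul hY.measurable).norm.pow_const n).aestronglyMeasurable
    (Eventually.of_forall fun ω => ?_)
  simp only [norm_pow, norm_norm, norm_mul, Pi.add_apply, pow_mul']
  rw [mul_pow]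
  nlinarith [sq_nonneg (‖X ω‖ ^ n - ‖Y ω‖ ^ n), sq_nonneg (‖X ω‖ ^ n), sq_nonneg (‖Y ω‖ ^ n)]

theorem add (hX : AllMoments P X) (hY : AllMoments P Y) : AllMoments P fun ω => X ω + Y ω := by
  refine ⟨hX.measurable.add hY.measurable, fun n => ?_⟩
  refine (((hX.integrable_pow n).add (hY.integrable_pow n)).const_mul (2 ^ (n - 1))).mono'
    ((hX.measurable.add hY.measurable).norm.pow_const n).aestronglyMeasurable
    (Eventually.of_forall fun ω => ?_)
  simp only [norm_pow, norm_norm, Pi.add_apply]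
  exact (pow_le_pow_left₀ (norm_nonneg _) (norm_add_le _ _) n).trans
    (add_pow_le (norm_nonneg _) (norm_nonneg _) n)

theorem conj (hX : AllMoments P X) : AllMoments P fun ω => starRingEnd ℂ (X ω) :=
  ⟨Complex.continuous_conj.measurable.comp hX.measurable, by simpa using hX.integrable_pow⟩

theorem const_mul [IsFiniteMeasure P] (c : ℂ) (hX : AllMoments P X) :
    AllMoments P fun ω => c * X ω :=
  (const c).mul hX

theorem sum [IsFiniteMeasure P] {ι : Type*} (s : Finset ι) {X : ι → Ω → ℂ}
    (h : ∀ i ∈ s, AllMoments P (X i)) : AllMoments P fun ω => ∑ i ∈ s, X i ω := by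
  classical
  induction s using Finset.induction_on with
  | empty => simpa using const 0
  | insert i s hi ih =>
    simp only [Finset.sum_insert hi]
    exact (h i (by simp)).add (ih fun j hj => h j (by simp [hj]))

theorem list_prod [IsFiniteMeasure P] {ι : Type*} (l : List ι) {X : ι → Ω → ℂ}
    (h : ∀ i, AllMoments P (X i)) : AllMoments P fun ω => (l.map fun i => X i ω).prod := by
  induction l with
  | nil => simpa using const 1
  | cons i l ih => simpa using (h i).mul ih

end AllMoments

end Moments

/-! ### Random matrices with independent labelled entries -/

section Model

variable {V L Ω : Type*}

/-- Random matrices `H a b = g a b * Y (u a b)` whose entries carry labels, with independent centered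
variables attached to the labels. -/
structure LabelledModel [MeasurableSpace Ω] (P : Measure Ω) (u : V → V → L) (g : V → V → ℝ)
    (Y : L → Ω → ℂ) (K : ℕ) : Prop where
  symm : ∀ a b, u a b = u b a
  inj : ∀ a b c, u a b = u a c → b = c
  incident : ∀ ℓ, ∃ S : Finset V, S.card ≤ K ∧ ∀ a b, u a b = ℓ → a ∈ S
  abs_le : ∀ a b, |g a b| ≤ 1
  sq_symm : ∀ a b, g a b ^ 2 = g b a ^ 2
  moments : ∀ ℓ, AllMoments P (Y ℓ)
  indep : iIndepFun Y P
  centered : ∀ ℓ, ∫ ω, Y ℓ ω ∂P = 0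

/-- The entry of the matrix (`true`) or of its adjoint (`false`) at a given position, as a function of
the variable of the label. -/
def factor (g : V → V → ℝ) (e : Bool × V × V) (y : ℂ) : ℂ :=
  if e.1 then g e.2.1 e.2.2 * y else g e.2.2 e.2.1 * starRingEnd ℂ y

/-- The label of a position. -/
def lab (u : V → V → L) (e : Bool × V × V) : L := u e.2.1 e.2.2

/-- The product of the entries at the given positions. -/
def val (u : V → V → L) (g : V → V → ℝ) (Y : L → Ω → ℂ) (I : List (Bool × V × V)) (ω : Ω) : ℂ :=
  (I.map fun e => factor g e (Y (lab u e) ω)).prod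

/-- The expectation of a product of entries all having the label `ℓ`. -/
def labelMoment [MeasurableSpace Ω] (P : Measure Ω) (g : V → V → ℝ) (Y : L → Ω → ℂ) (ℓ : L)
    (J : List (Bool × V × V)) : ℂ :=
  ∫ ω, (J.map fun e => factor g e (Y ℓ ω)).prod ∂P

theorem measurable_factor (g : V → V → ℝ) (e : Bool × V × V) : Measurable (factor g e) := by
  unfold factor
  split_ifs
  · fun_prop
  · exact (Complex.continuous_conj.measurable).const_mul _

namespace LabelledModel

variable [MeasurableSpace Ω] {P : Measure Ω} {u : V → V → L}
  {g : V → V → ℝ} {Y : L → Ω → ℂ} {K : ℕ}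

theorem length_filter_lab [DecidableEq L] (I : List (Bool × V × V)) (ℓ : L) :
    (I.filter fun e => lab u e = ℓ).length = (I.map (lab u)).count ℓ := by
  rw [List.count, List.countP_map, List.countP_eq_length_filter]
  congr 1

theorem norm_factor_le (h : LabelledModel P u g Y K) (e : Bool × V × V) (y : ℂ) :
    ‖factor g e y‖ ≤ ‖y‖ := by
  unfold factor
  split_ifs
  · simpa using mul_le_of_le_one_left (norm_nonneg y) (h.abs_le _ _)
  · simpa using mul_le_of_le_one_left (norm_nonneg y) (h.abs_le _ _)

variable [IsProbabilityMeasure P]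

theorem allMoments_factor (h : LabelledModel P u g Y K) (e : Bool × V × V) (ℓ : L) :
    AllMoments P fun ω => factor g e (Y ℓ ω) :=
  (h.moments ℓ).of_norm_le ((measurable_factor g e).comp (h.moments ℓ).measurable)
    fun _ => h.norm_factor_le _ _

theorem allMoments_val (h : LabelledModel P u g Y K) (I : List (Bool × V × V)) :
    AllMoments P (val u g Y I) :=
  AllMoments.list_prod I fun e => h.allMoments_factor e _

theorem labelMoment_nil (ℓ : L) : labelMoment P g Y ℓ [] = 1 := by simp [labelMoment]

theorem labelMoment_singleton (h : LabelledModel P u g Y K) (ℓ : L) (e : Bool × V × V) :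
    labelMoment P g Y ℓ [e] = 0 := by
  simp only [labelMoment, List.map_cons, List.map_nil, List.prod_singleton, factor]
  split_ifs
  · simp [integral_const_mul, h.centered]
  · simp [integral_const_mul, integral_conj, h.centered]

theorem norm_labelMoment_le (h : LabelledModel P u g Y K) (ℓ : L) (J : List (Bool × V × V)) :
    ‖labelMoment P g Y ℓ J‖ ≤ ∫ ω, ‖Y ℓ ω‖ ^ J.length ∂P := by
  refine norm_integral_le_of_norm_le ((h.moments ℓ).integrable_pow _)
    (Eventually.of_forall fun ω => ?_)
  induction J with
  | nil => simp
  | cons e J ih =>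
    simp only [List.map_cons, List.prod_cons, List.length_cons, pow_succ', norm_mul]
    exact mul_le_mul (h.norm_factor_le _ _) ih (norm_nonneg _) (norm_nonneg _)

variable [Fintype L] [DecidableEq L]

/-- Grouping the factors by label gives a product of functions of independent variables. -/
theorem integral_val (h : LabelledModel P u g Y K) (I : List (Bool × V × V)) :
    ∫ ω, val u g Y I ω ∂P = ∏ ℓ, labelMoment P g Y ℓ (I.filter fun e => lab u e = ℓ) := by
  have h1 : ∀ ω, val u g Y I ω
      = ∏ ℓ, ((I.filter fun e => lab u e = ℓ).map fun e => factor g e (Y ℓ ω)).prod := by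
    intro ω
    induction I with
    | nil => simp [val]
    | cons e I ih =>
      have h2 : ∀ ℓ, (((e :: I).filter fun e => lab u e = ℓ).map
          fun e => factor g e (Y ℓ ω)).prod = (if lab u e = ℓ then factor g e (Y ℓ ω) else 1) *
            ((I.filter fun e => lab u e = ℓ).map fun e => factor g e (Y ℓ ω)).prod := by
        intro ℓ
        by_cases hℓ : lab u e = ℓ <;> simp [hℓ]
      simp only [h2, Finset.prod_mul_distrib, ← ih]
      simp [val]
  simp only [h1]
  exact h.indep.integral_fun_prod_comp
    (f := fun ℓ y => ((I.filter fun e => lab u e = ℓ).map fun e => factor g e y).prod)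
    (fun ℓ => (h.moments ℓ).measurable.aemeasurable) fun ℓ => by
      refine Measurable.aestronglyMeasurable ?_
      generalize (I.filter fun e => lab u e = ℓ) = J
      induction J with
      | nil => simp
      | cons e J ih =>
        simp only [List.map_cons, List.prod_cons]
        exact (measurable_factor g e).mul ih

theorem integral_val_eq_zero (h : LabelledModel P u g Y K) {I : List (Bool × V × V)} {ℓ : L}
    (hℓ : (I.map (lab u)).count ℓ = 1) : ∫ ω, val u g Y I ω ∂P = 0 := by
  rw [h.integral_val]
  refine Finset.prod_eq_zero (Finset.mem_univ ℓ) ?_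
  obtain ⟨e, he⟩ : ∃ e, (I.filter fun e => lab u e = ℓ) = [e] := by
    rw [← List.length_eq_one_iff, ← hℓ, List.count, List.countP_map, List.countP_eq_length_filter]
    congr 1
  rw [he, h.labelMoment_singleton]

/-- The moments of order between `2` and `p` are at most `q`, and those of order at least `3`
at most `β q`. -/
def MomentBounds (P : Measure Ω) (Y : L → Ω → ℂ) (p : ℕ) (q β : ℝ) : Prop :=
  0 ≤ q ∧ 0 ≤ β ∧ ∀ ℓ n, n ≤ p → (2 ≤ n → ∫ ω, ‖Y ℓ ω‖ ^ n ∂P ≤ q) ∧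
    (3 ≤ n → ∫ ω, ‖Y ℓ ω‖ ^ n ∂P ≤ β * q)

/-- An absent label contributes 1, a label met once contributes 0 by centering, and a label met at
least twice contributes at most q. -/
theorem norm_labelMoment_filter_le (h : LabelledModel P u g Y K) {p : ℕ} {q β : ℝ}
    (hb : MomentBounds P Y p q β) {I : List (Bool × V × V)} (hI : I.length ≤ p) (ℓ : L) :
    ‖labelMoment P g Y ℓ (I.filter fun e => lab u e = ℓ)‖
      ≤ if ℓ ∈ (I.map (lab u)).toFinset then q else 1 := by
  have hlen := List.length_filter_le (fun e => decide (lab u e = ℓ)) I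
  have hc := length_filter_lab (u := u) I ℓ
  rcases hJ : (I.filter fun e => lab u e = ℓ) with _ | ⟨e, _ | ⟨e', J⟩⟩
  · rw [hJ] at hc
    have : ℓ ∉ (I.map (lab u)).toFinset := by
      rw [List.mem_toFinset, ← List.count_eq_zero, ← hc]; rfl
    rw [if_neg this, labelMoment_nil]; simp
  · rw [h.labelMoment_singleton, norm_zero]
    split_ifs
    exacts [hb.1, zero_le_one]
  · rw [hJ] at hc hlen
    have : ℓ ∈ (I.map (lab u)).toFinset := by
      rw [List.mem_toFinset, ← List.count_pos_iff, ← hc]; simp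
    rw [if_pos this]
    exact (h.norm_labelMoment_le _ _).trans ((hb.2.2 ℓ _ (hlen.trans hI)).1 (by simp))

theorem norm_integral_val_le (h : LabelledModel P u g Y K) {p : ℕ} {q β : ℝ}
    (hb : MomentBounds P Y p q β) {I : List (Bool × V × V)} (hI : I.length ≤ p) :
    ‖∫ ω, val u g Y I ω ∂P‖ ≤ q ^ (I.map (lab u)).toFinset.card := by
  rw [h.integral_val, norm_prod]
  refine (Finset.prod_le_prod (fun _ _ => norm_nonneg _)
    fun ℓ _ => h.norm_labelMoment_filter_le hb hI ℓ).trans (le_of_eq ?_)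
  rw [Finset.prod_ite_mem, Finset.univ_inter, Finset.prod_const]

/-- The gain β, which tends to 0 in the application, makes walks with a label met three times
negligible. -/
theorem norm_integral_val_le_of_three_le (h : LabelledModel P u g Y K) {p : ℕ} {q β : ℝ}
    (hb : MomentBounds P Y p q β) {I : List (Bool × V × V)} (hI : I.length ≤ p) {ℓ₀ : L}
    (hℓ : 3 ≤ (I.map (lab u)).count ℓ₀) :
    ‖∫ ω, val u g Y I ω ∂P‖ ≤ β * q ^ (I.map (lab u)).toFinset.card := by
  rw [h.integral_val, norm_prod]
  refine (Finset.prod_le_prod (g := fun ℓ => (if ℓ = ℓ₀ then β else 1) *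
    if ℓ ∈ (I.map (lab u)).toFinset then q else 1) (fun _ _ => norm_nonneg _)
    fun ℓ _ => ?_).trans (le_of_eq ?_)
  · by_cases hℓ' : ℓ = ℓ₀
    · subst hℓ'
      have h1 : ℓ ∈ (I.map (lab u)).toFinset := by
        rw [List.mem_toFinset, ← List.count_pos_iff]; omega
      rw [if_pos rfl, if_pos h1]
      refine (h.norm_labelMoment_le _ _).trans ((hb.2.2 ℓ _ ?_).2 ?_)
      · exact (List.length_filter_le _ _).trans hI
      · rw [length_filter_lab]; exact hℓ
    · rw [if_neg hℓ', one_mul]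
      exact h.norm_labelMoment_filter_le hb hI ℓ
  · rw [Finset.prod_mul_distrib, Finset.prod_ite_mem, Finset.univ_inter, Finset.prod_const]
    simp

/-- The second moment of the entry at `(a, b)`. -/
def entryVar (P : Measure Ω) (u : V → V → L) (g : V → V → ℝ) (Y : L → Ω → ℂ) (a b : V) : ℝ :=
  g a b ^ 2 * ∫ ω, ‖Y (u a b) ω‖ ^ 2 ∂P

/-- The label of (a, b) occurs only in the backtrack, where one letter is the adjoint of the other.
Its variable enters as |Y|² and splits off by independence. The squared coefficient is that of (a,
b) or of (b, a) according to ε, which is why `sq_symm` is required. -/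
theorem integral_val_pair (h : LabelledModel P u g Y K) (X Z : List (Bool × V × V)) (ε : Bool)
    (a b : V) (hX : u a b ∉ X.map (lab u)) (hZ : u a b ∉ Z.map (lab u)) :
    ∫ ω, val u g Y (X ++ (ε, a, b) :: (!ε, b, a) :: Z) ω ∂P
      = entryVar P u g Y a b * ∫ ω, val u g Y (X ++ Z) ω ∂P := by
  rw [h.integral_val, h.integral_val]
  have h1 : ∀ ℓ, labelMoment P g Y ℓ
      ((X ++ (ε, a, b) :: (!ε, b, a) :: Z).filter fun e => lab u e = ℓ)
      = (if ℓ = u a b then (entryVar P u g Y a b : ℂ) else 1) *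
        labelMoment P g Y ℓ ((X ++ Z).filter fun e => lab u e = ℓ) := by
    intro ℓ
    by_cases hℓ : ℓ = u a b
    · subst hℓ
      have hX' : X.filter (fun e => lab u e = u a b) = [] := by
        simp only [List.filter_eq_nil_iff, decide_eq_true_eq]
        intro e he hh
        exact hX (hh ▸ List.mem_map_of_mem he)
      have hZ' : Z.filter (fun e => lab u e = u a b) = [] := by
        simp only [List.filter_eq_nil_iff, decide_eq_true_eq]
        intro e he hh
        exact hZ (hh ▸ List.mem_map_of_mem he)
      have l1 : lab u (ε, a, b) = u a b := rfl
      have l2 : lab u (!ε, b, a) = u a b := h.symm b a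
      rw [List.filter_append, List.filter_append, hX', hZ', if_pos rfl]
      simp only [List.filter_cons, l1, l2, hZ', decide_true, if_true, List.nil_append,
        labelMoment_nil, mul_one]
      unfold labelMoment entryVar
      rw [← integral_const_mul, ← integral_complex_ofReal]
      congr 1; ext ω
      have hs : (g b a : ℂ) ^ 2 = (g a b : ℂ) ^ 2 := by exact_mod_cast (h.sq_symm b a)
      have hy := Complex.mul_conj' (Y (u a b) ω)
      cases ε <;> simp [factor] <;> rw [← hy]
      · rw [← hs]; ring
      · ring
    · have l1 : lab u (ε, a, b) ≠ ℓ := fun hh => hℓ hh.symm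
      have l2 : lab u (!ε, b, a) ≠ ℓ := fun hh => hℓ (by rw [← hh]; exact h.symm b a)
      simp [hℓ, l1, l2]
  simp only [h1, Finset.prod_mul_distrib]
  simp

end LabelledModel

end Model

/-! ### The recursion for the expected traces of alternating words -/

section Items

variable {V L Ω : Type*}

/-- The positions met along a path, with alternating letters. -/
def items : Bool → V → List V → List (Bool × V × V)
  | _, _, [] => []
  | ε, a, b :: t => (ε, a, b) :: items (!ε) b t

/-- The letter in use after a path. -/
def letterAfter : Bool → List V → Bool
  | ε, [] => ε
  | ε, _ :: t => letterAfter (!ε) t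

theorem items_append (ε : Bool) (a : V) (t t' : List V) :
    items ε a (t ++ t') = items ε a t ++ items (letterAfter ε t) (endpoint a t) t' := by
  induction t generalizing a ε with
  | nil => rfl
  | cons b t ih => simp [items, ih, letterAfter, endpoint]

@[simp] theorem length_items (ε : Bool) (a : V) (t : List V) :
    (items ε a t).length = t.length := by
  induction t generalizing a ε with
  | nil => rfl
  | cons b t ih => simp [items, ih]

@[simp] theorem map_lab_items (u : V → V → L) (ε : Bool) (a : V) (t : List V) :
    (items ε a t).map (lab u) = labs u a t := by
  induction t generalizing a ε with
  | nil => rfl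
  | cons b t ih => simp [items, ih, labs, lab]

/-- The expectation of the product along a path, if it is closed. -/
def pathExp [DecidableEq V] [MeasurableSpace Ω] (P : Measure Ω) (u : V → V → L) (g : V → V → ℝ)
    (Y : L → Ω → ℂ) (a : V) (t : List V) : ℂ :=
  if endpoint a t = a then ∫ ω, val u g Y (items true a t) ω ∂P else 0

/-- The sum of the expectations over the closed paths of length `s + r` whose first `s` labels are
distinct. -/
def pathSum [DecidableEq V] [DecidableEq L] [Fintype V] [MeasurableSpace Ω] (P : Measure Ω)
    (u : V → V → L) (g : V → V → ℝ) (Y : L → Ω → ℂ) (s r : ℕ) : ℂ :=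
  ∑ a, sumPaths s fun t =>
    if (labs u a t).Nodup then sumPaths r fun t' => pathExp P u g Y a (t ++ t') else 0

end Items

namespace LabelledModel

variable {V L Ω : Type*} [DecidableEq V] [DecidableEq L] [Fintype V] [Fintype L]
  [MeasurableSpace Ω] {P : Measure Ω} [IsProbabilityMeasure P] {u : V → V → L}
  {g : V → V → ℝ} {Y : L → Ω → ℂ} {K : ℕ}

theorem pathSum_zero_zero : pathSum P u g Y 0 0 = Fintype.card V := by
  simp [pathSum, sumPaths, labs, pathExp, items, val, endpoint]

/-- When all labels are distinct, the first one is met exactly once and the expectation vanishes. -/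
theorem pathSum_succ_zero (h : LabelledModel P u g Y K) (s : ℕ) :
    pathSum P u g Y (s + 1) 0 = 0 := by
  refine Finset.sum_eq_zero fun a _ => ?_
  rw [sumPaths_congr (g := fun _ => 0) fun t ht => ?_, sumPaths_zero_fun]
  split_ifs with hn
  · simp only [sumPaths, List.append_nil, pathExp]
    split_ifs with hc
    · rcases t with _ | ⟨b, t⟩
      · simp at ht
      refine h.integral_val_eq_zero (ℓ := u a b) ?_
      rw [map_lab_items]
      exact List.count_eq_one_of_mem hn (by simp [labs])
    · rfl
  · rfl

theorem pathSum_zero_succ (r : ℕ) :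
    pathSum P u g Y 0 (r + 1) = pathSum P u g Y 1 r := by
  simp [pathSum, sumPaths, labs]

theorem norm_pathExp_le (h : LabelledModel P u g Y K) {p : ℕ} {q β : ℝ}
    (hb : MomentBounds P Y p q β) {t : List V} (ht : t.length ≤ p) (a : V) :
    ‖pathExp P u g Y a t‖ ≤ q ^ (labs u a t).toFinset.card := by
  unfold pathExp
  split_ifs
  · simpa using h.norm_integral_val_le hb (I := items true a t) (by simpa)
  · simpa using pow_nonneg hb.1 _

theorem norm_pathExp_le_of_three_le (h : LabelledModel P u g Y K) {p : ℕ} {q β : ℝ}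
    (hb : MomentBounds P Y p q β) {t : List V} (ht : t.length ≤ p) (a : V) {ℓ : L}
    (hℓ : 3 ≤ (labs u a t).count ℓ) :
    ‖pathExp P u g Y a t‖ ≤ β * q ^ (labs u a t).toFinset.card := by
  unfold pathExp
  split_ifs
  · simpa using h.norm_integral_val_le_of_three_le hb (I := items true a t) (by simpa) (by simpa)
  · simpa using mul_nonneg hb.2.1 (pow_nonneg hb.1 _)

/-- Deleting a backtrack removes two letters, so the remaining word still alternates. -/
theorem pathExp_pair (h : LabelledModel P u g Y K) (a₀ b : V) (t t' : List V)
    (ht : u (endpoint a₀ t) b ∉ labs u a₀ t)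
    (ht' : u (endpoint a₀ t) b ∉ labs u (endpoint a₀ t) t') :
    pathExp P u g Y a₀ (t ++ b :: endpoint a₀ t :: t')
      = entryVar P u g Y (endpoint a₀ t) b * pathExp P u g Y a₀ (t ++ t') := by
  unfold pathExp
  have h1 : endpoint a₀ (t ++ b :: endpoint a₀ t :: t') = endpoint a₀ (t ++ t') := by
    simp [endpoint]
  rw [h1]
  split_ifs
  · rw [items_append, items_append]
    simp only [items, Bool.not_not]
    exact h.integral_val_pair _ _ _ _ _ (by simpa) (by simpa)
  · simp

/-- The sum of the second moments in the row `a`. -/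
def rowVar (P : Measure Ω) (u : V → V → L) (g : V → V → ℝ) (Y : L → Ω → ℂ) (a : V) : ℝ :=
  ∑ b, entryVar P u g Y a b

theorem entryVar_le (h : LabelledModel P u g Y K) {p : ℕ} {q β : ℝ}
    (hb : MomentBounds P Y p q β) (hp : 2 ≤ p) (a b : V) : entryVar P u g Y a b ≤ q := by
  have h1 : g a b ^ 2 ≤ 1 := (sq_le_one_iff_abs_le_one _).2 (h.abs_le a b)
  have h2 := (hb.2.2 (u a b) 2 hp).1 le_rfl
  have h3 : 0 ≤ ∫ ω, ‖Y (u a b) ω‖ ^ 2 ∂P := integral_nonneg fun _ => by positivity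
  unfold entryVar
  nlinarith

theorem entryVar_nonneg (a b : V) : 0 ≤ entryVar P u g Y a b :=
  mul_nonneg (sq_nonneg _) (integral_nonneg fun _ => by positivity)

end LabelledModel

/-! ### Error estimates for one step of the recursion -/

namespace LabelledModel

variable {V L Ω : Type*} [DecidableEq V] [DecidableEq L] [Fintype V] [Fintype L]
  [MeasurableSpace Ω] {P : Measure Ω} [IsProbabilityMeasure P] {u : V → V → L}
  {g : V → V → ℝ} {Y : L → Ω → ℂ} {K : ℕ}

theorem norm_sumPaths_pathExp_le (h : LabelledModel P u g Y K) {p : ℕ} {q β C : ℝ}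
    (hb : MomentBounds P Y p q β) (hC : (Fintype.card V : ℝ) * q ≤ C) (a : V) (t : List V) (r : ℕ)
    (hp : t.length + r ≤ p) :
    sumPaths r (fun t' => q ^ (labs u a (t ++ t')).toFinset.card)
      ≤ q ^ (labs u a t).toFinset.card * (C + p) ^ r := by
  have hC0 : 0 ≤ C := le_trans (mul_nonneg (by positivity) hb.1) hC
  simp only [labs_append, List.toFinset_append]
  refine (sumPaths_weight_le h.inj hb.1 hC r _ _).trans ?_
  have h1 : ((labs u a t).toFinset.card : ℝ) + r ≤ p := by
    have := List.toFinset_card_le (labs u a t)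
    rw [length_labs] at this
    exact_mod_cast (by omega : (labs u a t).toFinset.card + r ≤ p)
  refine mul_le_mul_of_nonneg_left ?_ (pow_nonneg hb.1 _)
  exact pow_le_pow_left₀ (by positivity) (by linarith) r

/-- A pair is determined by its label and its first vertex, and each label allows at most K first
vertices. -/
theorem card_incident_pairs_le (h : LabelledModel P u g Y K) (F : Finset L) :
    ((Finset.univ : Finset (V × V)).filter fun e => u e.1 e.2 ∈ F).card ≤ F.card * K := by
  choose S hS hS' using h.incident
  calc _ ≤ (F.sigma S).card := by
        refine Finset.card_le_card_of_injOn (fun e => ⟨u e.1 e.2, e.1⟩) ?_ ?_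
        · rintro ⟨b, c⟩ he
          simp only [Finset.coe_filter, Finset.mem_univ, true_and, Set.mem_ofPred_eq] at he
          simp only [Finset.coe_sigma, Set.mem_sigma_iff, Finset.mem_coe]
          exact ⟨he, hS' _ b c rfl⟩
        · rintro ⟨b, c⟩ _ ⟨b', c'⟩ _ he
          simp only [Sigma.mk.injEq, heq_eq_eq] at he
          obtain ⟨h1, rfl⟩ := he
          rw [h.inj _ _ _ h1]
    _ ≤ F.card * K := by
        rw [Finset.card_sigma]
        exact (Finset.sum_le_sum fun ℓ _ => hS ℓ).trans (by simp)

/-- Closing an edge other than the last open one has a negligible contribution. -/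
theorem norm_crossing_le (h : LabelledModel P u g Y K) {p : ℕ} {q β C : ℝ}
    (hb : MomentBounds P Y p q β) (hC : (Fintype.card V : ℝ) * q ≤ C) (a : V) (t : List V) (r : ℕ)
    (hp : t.length + r + 2 ≤ p) (hn : (labs u a t).Nodup) :
    ‖∑ b, ∑ c, (if u (endpoint a t) b ∉ labs u a t ∧ u b c ∈ labs u a t then
      sumPaths r fun t' => pathExp P u g Y a (t ++ b :: c :: t') else 0)‖
      ≤ p * K * (q ^ (t.length + 1) * (C + p) ^ r) := by
  have hC0 : 0 ≤ C := le_trans (mul_nonneg (by positivity) hb.1) hC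
  have hB : 0 ≤ q ^ (t.length + 1) * (C + p) ^ r := mul_nonneg (pow_nonneg hb.1 _) (by positivity)
  have h1 : ∀ b c, ‖(if u (endpoint a t) b ∉ labs u a t ∧ u b c ∈ labs u a t then
      sumPaths r fun t' => pathExp P u g Y a (t ++ b :: c :: t') else 0)‖
      ≤ (if u b c ∈ (labs u a t).toFinset then 1 else 0) * (q ^ (t.length + 1) * (C + p) ^ r) := by
    intro b c
    split_ifs with h2 h3 h3
    · rw [one_mul]
      refine (norm_sumPaths_le fun t' ht' => h.norm_pathExp_le hb (by simp; omega) a).trans ?_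
      have h4 := h.norm_sumPaths_pathExp_le hb hC a (t ++ [b, c]) r (by simp; omega)
      simp only [List.append_assoc, List.cons_append, List.nil_append] at h4
      refine h4.trans (le_of_eq ?_)
      congr 2
      -- The edge (b, c) repeats an old label, so the two steps add a single label: the exponent of
      -- q is `t.length + 1`, whereas only about p K pairs (b, c) are possible.
      have : (labs u a (t ++ [b, c])).toFinset
          = insert (u (endpoint a t) b) (labs u a t).toFinset := by
        ext x
        simp only [labs_append, labs, List.toFinset_append, List.toFinset_cons, List.toFinset_nil,
          Finset.mem_union, List.mem_toFinset, Finset.mem_insert, Finset.notMem_empty, or_false]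
        constructor
        · rintro (h | h | rfl)
          exacts [Or.inr h, Or.inl h, Or.inr h2.2]
        · tauto
      rw [this, Finset.card_insert_of_notMem (by simpa using h2.1),
        List.toFinset_card_of_nodup hn, length_labs]
    · exact absurd (by simpa using h2.2) h3
    · rw [norm_zero, one_mul]; exact hB
    · simp
  refine (norm_sum_le_of_le _ fun b _ => norm_sum_le_of_le _ fun c _ => h1 b c).trans ?_
  simp only [← Finset.sum_mul]
  refine mul_le_mul_of_nonneg_right ?_ hB
  rw [← Fintype.sum_prod_type' (f := fun b c => if u b c ∈ (labs u a t).toFinset then (1 : ℝ) else 0),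
    Finset.sum_boole]
  have h5 := h.card_incident_pairs_le (labs u a t).toFinset
  rw [List.toFinset_card_of_nodup hn, length_labs] at h5
  exact_mod_cast h5.trans (Nat.mul_le_mul_right K (by omega))

/-- Closing the last open edge amounts to removing it. -/
theorem norm_adjacent_sub_le (h : LabelledModel P u g Y K) {p : ℕ} {q β C : ℝ}
    (hb : MomentBounds P Y p q β) (hC : (Fintype.card V : ℝ) * q ≤ C) (a : V) (t : List V) (r : ℕ)
    (hp : t.length + r + 2 ≤ p) (hn : (labs u a t).Nodup) :
    ‖(∑ b, if u (endpoint a t) b ∉ labs u a t then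
        sumPaths r fun t' => pathExp P u g Y a (t ++ b :: endpoint a t :: t') else 0)
      - sumPaths r fun t' => pathExp P u g Y a (t ++ t')‖
      ≤ (|rowVar P u g Y (endpoint a t) - 1| + p * q + p * β) * (q ^ t.length * (C + p) ^ r) := by
  set e := endpoint a t with he
  have hC0 : 0 ≤ C := le_trans (mul_nonneg (by positivity) hb.1) hC
  have h0 : (∑ b, if u e b ∉ labs u a t then
        sumPaths r fun t' => pathExp P u g Y a (t ++ b :: e :: t') else 0)
      = sumPaths r fun t' => ∑ b, if u e b ∉ labs u a t then
          pathExp P u g Y a (t ++ b :: e :: t') else 0 := by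
    rw [sumPaths_sum]
    refine Finset.sum_congr rfl fun b _ => ?_
    split_ifs
    · rw [sumPaths_zero_fun]
    · rfl
  rw [h0, ← sumPaths_sub]
  have key : ∀ t', t'.length = r → ‖(∑ b, if u e b ∉ labs u a t then
          pathExp P u g Y a (t ++ b :: e :: t') else 0) - pathExp P u g Y a (t ++ t')‖
      ≤ (|rowVar P u g Y e - 1| + p * q + p * β) * q ^ (labs u a (t ++ t')).toFinset.card := by
    intro t' ht'
    set φ := pathExp P u g Y a (t ++ t') with hφ
    set w := q ^ (labs u a (t ++ t')).toFinset.card with hw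
    have hw0 : 0 ≤ w := pow_nonneg hb.1 _
    have hφw : ‖φ‖ ≤ w := h.norm_pathExp_le hb (by simp; omega) a
    have hcard : ((Finset.univ.filter fun b => u e b ∈ (labs u a (t ++ t')).toFinset).card : ℝ)
        ≤ p := by
      have h1 := card_filter_mem_le h.inj e (labs u a (t ++ t')).toFinset
      have h2 := List.toFinset_card_le (labs u a (t ++ t'))
      rw [length_labs, List.length_append] at h2
      exact_mod_cast (by omega : (Finset.univ.filter fun b =>
        u e b ∈ (labs u a (t ++ t')).toFinset).card ≤ p)
    -- The two terms agree exactly unless the label of (e, b) occurs in t or t', which happens for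
    -- at most p values of b. If it occurs in t, the first term is absent. If it occurs in t', the
    -- label is met at least three times, whence the factor β.
    have hsplit : ∀ b, ‖(if u e b ∉ labs u a t then pathExp P u g Y a (t ++ b :: e :: t') else 0)
          - entryVar P u g Y e b * φ‖
        ≤ (if u e b ∈ (labs u a (t ++ t')).toFinset then 1 else 0) * ((q + β) * w) := by
      intro b
      have hv : ‖(entryVar P u g Y e b : ℂ) * φ‖ ≤ q * w := by
        rw [norm_mul, Complex.norm_real, Real.norm_of_nonneg (entryVar_nonneg e b)]
        exact mul_le_mul (h.entryVar_le hb (by omega) _ _) hφw (norm_nonneg _) hb.1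
      by_cases h1 : u e b ∈ labs u a t
      · have h2 : u e b ∈ (labs u a (t ++ t')).toFinset := by simp [labs_append, h1]
        rw [if_neg (not_not.2 h1), if_pos h2, zero_sub, norm_neg, one_mul]
        nlinarith [mul_nonneg hb.2.1 hw0]
      · rw [if_pos h1]
        by_cases h2 : u e b ∈ labs u e t'
        · have h3 : u e b ∈ (labs u a (t ++ t')).toFinset := by
            simp only [labs_append, List.mem_toFinset, List.mem_append]
            exact Or.inr h2
          rw [if_pos h3, one_mul, add_mul]
          refine (norm_sub_le _ _).trans ?_
          rw [add_comm]
          refine add_le_add hv ?_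
          have h4 : (labs u a (t ++ b :: e :: t')).toFinset = (labs u a (t ++ t')).toFinset := by
            ext x
            have := h.symm b e
            simp only [labs_append, labs, List.mem_toFinset, List.mem_append, List.mem_cons, this,
              ← he]
            constructor
            · rintro (h | rfl | rfl | h)
              exacts [Or.inl h, Or.inr h2, Or.inr h2, Or.inr h]
            · tauto
          rw [hw, ← h4]
          refine h.norm_pathExp_le_of_three_le hb (by simp; omega) a (ℓ := u e b) ?_
          have h5 := List.count_pos_iff.2 h2
          simp only [labs_append, labs, List.count_append, ← he, h.symm b e, List.count_cons_self]
          omega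
        · rw [h.pathExp_pair a b t t' h1 h2, sub_self, norm_zero]
          split_ifs
          · have := hb.1
            have := hb.2.1
            positivity
          · simp
    have h6 : (∑ b, if u e b ∉ labs u a t then pathExp P u g Y a (t ++ b :: e :: t') else 0) - φ
        = ∑ b, ((if u e b ∉ labs u a t then pathExp P u g Y a (t ++ b :: e :: t') else 0)
          - entryVar P u g Y e b * φ) + ((rowVar P u g Y e - 1 : ℝ) : ℂ) * φ := by
      rw [Finset.sum_sub_distrib, ← Finset.sum_mul, rowVar]
      push_cast
      ring
    rw [h6]
    refine (norm_add_le _ _).trans ?_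
    have h7 : ‖((rowVar P u g Y e - 1 : ℝ) : ℂ) * φ‖ ≤ |rowVar P u g Y e - 1| * w := by
      rw [norm_mul, Complex.norm_real, Real.norm_eq_abs]
      exact mul_le_mul_of_nonneg_left hφw (abs_nonneg _)
    have h8 := norm_sum_le_of_le Finset.univ fun b _ => hsplit b
    rw [← Finset.sum_mul, Finset.sum_boole] at h8
    have h9 : 0 ≤ (q + β) * w := mul_nonneg (add_nonneg hb.1 hb.2.1) hw0
    have h10 := mul_le_mul_of_nonneg_right hcard h9
    nlinarith
  refine (norm_sumPaths_le key).trans ?_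
  rw [sumPaths_mul_left]
  refine mul_le_mul_of_nonneg_left ?_ ?_
  · have := h.norm_sumPaths_pathExp_le hb hC a t r (by omega)
    rwa [List.toFinset_card_of_nodup hn, length_labs] at this
  · have := hb.1
    have := hb.2.1
    positivity

/-- Three alternatives for the edge (b, c) that follows a fresh edge: a fresh label, the label of
the edge just walked, or a label of t. The first is the subtracted sum, the second is
`norm_adjacent_sub_le`, the third is `norm_crossing_le`. -/
theorem norm_local_step_le (h : LabelledModel P u g Y K) {p : ℕ} {q β C : ℝ}
    (hb : MomentBounds P Y p q β) (hC : (Fintype.card V : ℝ) * q ≤ C) (a : V) (t : List V) (r : ℕ)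
    (hp : t.length + r + 2 ≤ p) :
    ‖(∑ b, if (labs u a (t ++ [b])).Nodup then
          ∑ c, sumPaths r fun t' => pathExp P u g Y a (t ++ b :: c :: t') else 0)
      - (∑ b, ∑ c, if (labs u a (t ++ [b, c])).Nodup then
          sumPaths r fun t' => pathExp P u g Y a (t ++ b :: c :: t') else 0)
      - (if (labs u a t).Nodup then sumPaths r fun t' => pathExp P u g Y a (t ++ t') else 0)‖
      ≤ (|rowVar P u g Y (endpoint a t) - 1| + p * q + p * β + p * K * q)
        * (q ^ t.length * (C + p) ^ r) := by
  have hC0 : 0 ≤ C := le_trans (mul_nonneg (by positivity) hb.1) hC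
  by_cases hn : (labs u a t).Nodup
  · have h1 := h.norm_crossing_le hb hC a t r hp hn
    have h2 := h.norm_adjacent_sub_le hb hC a t r hp hn
    have h3 : ∀ b, (labs u a (t ++ [b])).Nodup ↔ u (endpoint a t) b ∉ labs u a t := by
      intro b
      simp [labs_append, labs, List.nodup_append, hn]
      grind
    have h4 : ∀ b c, (labs u a (t ++ [b, c])).Nodup ↔
        u (endpoint a t) b ∉ labs u a t ∧ u b c ∉ labs u a t ∧ c ≠ endpoint a t := by
      intro b c
      -- By symmetry and injectivity, repeating the last label means turning back.
      have h5 : u (endpoint a t) b = u b c ↔ c = endpoint a t := by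
        rw [h.symm]
        exact ⟨fun hh => (h.inj _ _ _ hh).symm, fun hh => by rw [hh]⟩
      simp [labs_append, labs, List.nodup_append, hn, h5]
      grind
    have h6 : ∀ b, (if (labs u a (t ++ [b])).Nodup then
          ∑ c, sumPaths r fun t' => pathExp P u g Y a (t ++ b :: c :: t') else 0)
        = (∑ c, if (labs u a (t ++ [b, c])).Nodup then
            sumPaths r fun t' => pathExp P u g Y a (t ++ b :: c :: t') else 0)
          + (∑ c, (if u (endpoint a t) b ∉ labs u a t ∧ u b c ∈ labs u a t then
              sumPaths r fun t' => pathExp P u g Y a (t ++ b :: c :: t') else 0))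
          + (if u (endpoint a t) b ∉ labs u a t then
              sumPaths r fun t' => pathExp P u g Y a (t ++ b :: endpoint a t :: t') else 0) := by
      intro b
      simp only [h3, h4]
      by_cases hb' : u (endpoint a t) b ∈ labs u a t
      · simp [hb']
      · simp only [hb', not_false_eq_true, true_and, if_true]
        have h7 : (sumPaths r fun t' => pathExp P u g Y a (t ++ b :: endpoint a t :: t'))
            = ∑ c, if c = endpoint a t then
                sumPaths r fun t' => pathExp P u g Y a (t ++ b :: c :: t') else 0 := by simp
        rw [h7, ← Finset.sum_add_distrib, ← Finset.sum_add_distrib]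
        refine Finset.sum_congr rfl fun c _ => ?_
        by_cases hc : c = endpoint a t
        · have : u b c ∉ labs u a t := by rw [hc, h.symm]; exact hb'
          simp [hc, hc ▸ this]
        · by_cases hc' : u b c ∈ labs u a t <;> simp [hc, hc']
    simp only [h6, Finset.sum_add_distrib, if_pos hn]
    rw [show ∀ x y z w : ℂ, x + y + z - x - w = y + (z - w) by intros; ring]
    refine (norm_add_le _ _).trans ((add_le_add h1 h2).trans (le_of_eq ?_))
    ring
  -- A prefix with a repeated label makes all three terms vanish.
  · have h3 : ∀ b, ¬ (labs u a (t ++ [b])).Nodup := fun b hh => by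
      rw [labs_append] at hh; exact hn (List.Nodup.of_append_left hh)
    have h4 : ∀ b c, ¬ (labs u a (t ++ [b, c])).Nodup := fun b c hh => by
      rw [labs_append] at hh; exact hn (List.Nodup.of_append_left hh)
    simp only [h3, h4, hn, if_false, Finset.sum_const_zero, sub_zero, norm_zero]
    have := hb.1
    have := hb.2.1
    positivity

/-- The |V|^s prefixes balance the weight q^s, and their endpoints are equidistributed. The bound is
o(|V|) as soon as q, β and the average of |`rowVar` - 1| tend to 0, with C fixed. -/
theorem norm_pathSum_step_le (h : LabelledModel P u g Y K) {p : ℕ} {q β C : ℝ}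
    (hb : MomentBounds P Y p q β) (hC : (Fintype.card V : ℝ) * q ≤ C) (s r : ℕ)
    (hp : s + r + 2 ≤ p) :
    ‖pathSum P u g Y (s + 1) (r + 1) - pathSum P u g Y (s + 2) r - pathSum P u g Y s r‖
      ≤ C ^ s * (C + p) ^ r * (∑ a, |rowVar P u g Y a - 1|
        + Fintype.card V * (p * q + p * β + p * K * q)) := by
  have hC0 : 0 ≤ C := le_trans (mul_nonneg (by positivity) hb.1) hC
  have e1 : pathSum P u g Y (s + 1) (r + 1) = ∑ a, sumPaths s fun t =>
      ∑ b, if (labs u a (t ++ [b])).Nodup then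
          ∑ c, sumPaths r fun t' => pathExp P u g Y a (t ++ b :: c :: t') else 0 := by
    refine Finset.sum_congr rfl fun a _ => ?_
    rw [sumPaths_succ_last]
    simp [sumPaths]
  have e2 : pathSum P u g Y (s + 2) r = ∑ a, sumPaths s fun t =>
      ∑ b, ∑ c, if (labs u a (t ++ [b, c])).Nodup then
          sumPaths r fun t' => pathExp P u g Y a (t ++ b :: c :: t') else 0 := by
    refine Finset.sum_congr rfl fun a _ => ?_
    rw [sumPaths_succ_last, sumPaths_succ_last]
    simp
  rw [e1, e2, pathSum, ← Finset.sum_sub_distrib, ← Finset.sum_sub_distrib]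
  simp only [← sumPaths_sub]
  refine (norm_sum_le_of_le Finset.univ fun a _ => norm_sumPaths_le fun t ht =>
    h.norm_local_step_le hb hC a t r (by omega)).trans ?_
  have e3 : ∀ a, (sumPaths s fun t => (|rowVar P u g Y (endpoint a t) - 1| + p * q + p * β
      + p * K * q) * (q ^ t.length * (C + p) ^ r))
      = sumPaths s fun t => (q ^ s * (C + p) ^ r) * (fun x => |rowVar P u g Y x - 1| + p * q + p * β
      + p * K * q) (endpoint a t) := fun a => sumPaths_congr fun t ht => by
        rw [ht]; ring
  simp only [e3, sumPaths_mul_left, ← Finset.mul_sum]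
  have e0 := sum_sumPaths_endpoint s fun x : V => |rowVar P u g Y x - 1| + p * q + p * β + p * K * q
  rw [e0]
  have e4 : (Fintype.card V : ℝ) ^ s * q ^ s ≤ C ^ s := by
    rw [← mul_pow]
    exact pow_le_pow_left₀ (mul_nonneg (by positivity) hb.1) hC s
  have e5 : ∑ x, (|rowVar P u g Y x - 1| + p * q + p * β + p * K * q)
      = ∑ a, |rowVar P u g Y a - 1| + Fintype.card V * (p * q + p * β + p * K * q) := by
    simp only [Finset.sum_add_distrib, Finset.sum_const, Finset.card_univ, nsmul_eq_mul]
    ring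
  rw [e5]
  have e6 : 0 ≤ ∑ a, |rowVar P u g Y a - 1| + Fintype.card V * (p * q + p * β + p * K * q) := by
    have := hb.1
    have := hb.2.1
    positivity
  calc _ = ((Fintype.card V : ℝ) ^ s * q ^ s) * ((C + p) ^ r *
        (∑ a, |rowVar P u g Y a - 1| + Fintype.card V * (p * q + p * β + p * K * q))) := by ring
    _ ≤ C ^ s * ((C + p) ^ r *
        (∑ a, |rowVar P u g Y a - 1| + Fintype.card V * (p * q + p * β + p * K * q))) := by
        gcongr
    _ = _ := by ring

end LabelledModel

/-! ### Expected traces of alternating words -/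

/-- The alternating product of `r` factors `A A^* A ⋯`, starting with `A` (`true`) or `A^*`. -/
def altWord {n : Type*} [Fintype n] [DecidableEq n] (A : Matrix n n ℂ) :
    Bool → ℕ → Matrix n n ℂ
  | _, 0 => 1
  | ε, r + 1 => (if ε then A else A.conjTranspose) * altWord A (!ε) r

theorem altWord_true_two_mul {n : Type*} [Fintype n] [DecidableEq n] (A : Matrix n n ℂ) (p : ℕ) :
    altWord A true (2 * p) = (A * A.conjTranspose) ^ p := by
  induction p with
  | zero => rfl
  | succ p ih =>
    rw [show 2 * (p + 1) = 2 * p + 1 + 1 by ring, altWord, altWord, pow_succ', ← ih]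
    simp [Matrix.mul_assoc]

theorem altWord_of_isHermitian {n : Type*} [Fintype n] [DecidableEq n] {A : Matrix n n ℂ}
    (hA : A.IsHermitian) (ε : Bool) (p : ℕ) : altWord A ε p = A ^ p := by
  induction p generalizing ε with
  | zero => rfl
  | succ p ih => rw [altWord, ih, hA.eq, ite_self, pow_succ']

/-- The random matrix of a labelled model. -/
def labelledMatrix {V L Ω : Type*} (u : V → V → L) (g : V → V → ℝ) (Y : L → Ω → ℂ) (ω : Ω) :
    Matrix V V ℂ :=
  Matrix.of fun a b => g a b * Y (u a b) ω

namespace LabelledModel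

section Fixed

variable {V L Ω : Type*} [DecidableEq V] [DecidableEq L] [Fintype V] [Fintype L]
  [MeasurableSpace Ω] {P : Measure Ω} [IsProbabilityMeasure P] {u : V → V → L}
  {g : V → V → ℝ} {Y : L → Ω → ℂ} {K : ℕ}

theorem altWord_apply (h : LabelledModel P u g Y K) (ω : Ω) (ε : Bool) (r : ℕ) (a b : V) :
    altWord (labelledMatrix u g Y ω) ε r a b
      = sumPaths r fun t => if endpoint a t = b then val u g Y (items ε a t) ω else 0 := by
  induction r generalizing ε a with
  | zero => simp [altWord, sumPaths, endpoint, items, val, Matrix.one_apply]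
  | succ r ih =>
    rw [altWord, Matrix.mul_apply, sumPaths]
    refine Finset.sum_congr rfl fun c _ => ?_
    rw [ih, ← sumPaths_mul_left]
    refine sumPaths_congr fun t _ => ?_
    have h1 : (if ε then labelledMatrix u g Y ω else (labelledMatrix u g Y ω).conjTranspose) a c
        = factor g (ε, a, c) (Y (u a c) ω) := by
      cases ε <;> simp [factor, labelledMatrix, h.symm c a]
    rw [h1]
    by_cases hc : endpoint c t = b
    · simp [hc, endpoint, items, val, lab]
    · simp [hc, endpoint]

theorem allMoments_sumPaths {r : ℕ} {f : List V → Ω → ℂ} (hf : ∀ t, AllMoments P (f t)) :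
    AllMoments P fun ω => sumPaths r fun t => f t ω := by
  induction r generalizing f with
  | zero => exact hf []
  | succ r ih => exact AllMoments.sum _ fun b _ => ih fun t => hf _

theorem integral_sumPaths {r : ℕ} {f : List V → Ω → ℂ} (hf : ∀ t, AllMoments P (f t)) :
    ∫ ω, (sumPaths r fun t => f t ω) ∂P = sumPaths r fun t => ∫ ω, f t ω ∂P := by
  induction r generalizing f with
  | zero => rfl
  | succ r ih =>
    simp only [sumPaths]
    rw [integral_finsetSum _ fun b _ => (allMoments_sumPaths fun t => hf _).integrable]
    exact Finset.sum_congr rfl fun b _ => ih fun t => hf _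

theorem integral_trace_altWord (h : LabelledModel P u g Y K) (r : ℕ) :
    ∫ ω, (altWord (labelledMatrix u g Y ω) true r).trace ∂P = pathSum P u g Y 0 r := by
  have h1 : ∀ a t, AllMoments P fun ω =>
      if endpoint a t = a then val u g Y (items true a t) ω else 0 := by
    intro a t
    split_ifs
    · exact h.allMoments_val _
    · exact AllMoments.const 0
  simp only [Matrix.trace, Matrix.diag, h.altWord_apply]
  rw [integral_finsetSum _ fun a _ => (allMoments_sumPaths (h1 a)).integrable]
  refine Finset.sum_congr rfl fun a _ => ?_
  rw [integral_sumPaths (h1 a)]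
  simp only [sumPaths, labs, List.nodup_nil, if_true, List.nil_append]
  refine sumPaths_congr fun t _ => ?_
  unfold pathExp
  split_ifs <;> simp

end Fixed

/-! ### Limits of the normalized path sums -/

section Limit

variable {V L Ω : ℕ → Type*} [∀ N, DecidableEq (V N)] [∀ N, DecidableEq (L N)]
  [∀ N, Fintype (V N)] [∀ N, Fintype (L N)] [∀ N, MeasurableSpace (Ω N)]
  {P : ∀ N, Measure (Ω N)} [∀ N, IsProbabilityMeasure (P N)] {u : ∀ N, V N → V N → L N}
  {g : ∀ N, V N → V N → ℝ} {Y : ∀ N, L N → Ω N → ℂ} {K : ℕ}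

theorem tendsto_pathSum_step (h : ∀ N, LabelledModel (P N) (u N) (g N) (Y N) K) {D : ℕ → ℝ}
    (hD : Tendsto D atTop atTop) {κ : ℝ}
    (hcard : Tendsto (fun N => Fintype.card (V N) / D N) atTop (𝓝 κ)) {C : ℝ} {b : ℕ → ℕ → ℝ}
    (hb : ∀ n, 2 ≤ n → ∀ N ℓ, D N * ∫ ω, ‖Y N ℓ ω‖ ^ n ∂(P N) ≤ b n N)
    (hb2 : ∀ᶠ N in atTop, b 2 N ≤ C) (hb3 : ∀ n, 3 ≤ n → Tendsto (b n) atTop (𝓝 0))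
    (hrow : Tendsto (fun N => (∑ a, |rowVar (P N) (u N) (g N) (Y N) a - 1|) / D N) atTop (𝓝 0))
    (s r : ℕ) :
    Tendsto (fun N => (D N : ℂ)⁻¹ * (pathSum (P N) (u N) (g N) (Y N) (s + 1) (r + 1)
      - pathSum (P N) (u N) (g N) (Y N) (s + 2) r - pathSum (P N) (u N) (g N) (Y N) s r))
      atTop (𝓝 0) := by
  set p := s + r + 2 with hp
  -- C₁ / D is the bound q on the moments of orders 2 to p: C handles order 2, and the higher orders
  -- follow once β ≤ 1. Taking C₁ ≥ 1 gives b n N ≤ β C₁ for n ≥ 3. C₂ bounds |V| q.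
  set C₁ := max C 1 with hC₁
  have hC₁1 : 1 ≤ C₁ := le_max_right _ _
  set C₂ := C₁ * (κ + 1) with hC₂
  let β : ℕ → ℝ := fun N => ∑ n ∈ Finset.Icc 3 p, |b n N|
  have hβ0 : ∀ N, 0 ≤ β N := fun N => Finset.sum_nonneg fun _ _ => abs_nonneg _
  have hβ : Tendsto β atTop (𝓝 0) := by
    rw [show (0 : ℝ) = ∑ n ∈ Finset.Icc 3 p, |(0 : ℝ)| by simp]
    exact tendsto_finsetSum _ fun n hn => (hb3 n (Finset.mem_Icc.1 hn).1).abs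
  have hq : Tendsto (fun N => C₁ / D N) atTop (𝓝 0) := hD.const_div_atTop C₁
  let err : ℕ → ℝ := fun N => C₂ ^ s * (C₂ + p) ^ r *
    ((∑ a, |rowVar (P N) (u N) (g N) (Y N) a - 1|) / D N
      + Fintype.card (V N) / D N * (p * (C₁ / D N) + p * β N + p * K * (C₁ / D N)))
  have herr : Tendsto err atTop (𝓝 0) := by
    have h1 := (hrow.add (hcard.mul (((hq.const_mul (p : ℝ)).add (hβ.const_mul (p : ℝ))).add
      (hq.const_mul ((p : ℝ) * K))))).const_mul (C₂ ^ s * (C₂ + p) ^ r)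
    simpa using h1
  refine squeeze_zero_norm' ?_ herr
  filter_upwards [hb2, hD.eventually_gt_atTop 0, hcard.eventually_le_const (lt_add_one κ),
    hβ.eventually_le_const one_pos] with N h2 hD0 hκ hβ1
  have hm : MomentBounds (P N) (Y N) p (C₁ / D N) (β N) := by
    refine ⟨by positivity, hβ0 N, fun ℓ n hn => ?_⟩
    have h3 : 3 ≤ n → ∫ ω, ‖Y N ℓ ω‖ ^ n ∂(P N) ≤ β N * (C₁ / D N) := by
      intro h3
      have h4 := hb n (by omega) N ℓ
      have h5 : b n N ≤ β N := (le_abs_self _).trans (Finset.single_le_sum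
        (f := fun n => |b n N|) (fun _ _ => abs_nonneg _) (Finset.mem_Icc.2 ⟨h3, hn⟩))
      rw [← mul_div_assoc, le_div_iff₀ hD0, mul_comm]
      nlinarith [hβ0 N]
    refine ⟨fun h2n => ?_, h3⟩
    rcases h2n.eq_or_lt with rfl | h2n
    · rw [le_div_iff₀ hD0, mul_comm]
      exact (hb 2 le_rfl N ℓ).trans (h2.trans (le_max_left _ _))
    · refine (h3 h2n).trans (mul_le_of_le_one_left (by positivity) hβ1)
  have hC : (Fintype.card (V N) : ℝ) * (C₁ / D N) ≤ C₂ := by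
    rw [hC₂, ← mul_div_assoc, mul_comm, mul_div_assoc]
    gcongr
  have h6 := (h N).norm_pathSum_step_le hm hC s r le_rfl
  rw [norm_mul, norm_inv, Complex.norm_real, Real.norm_of_nonneg hD0.le]
  calc _ ≤ (D N)⁻¹ * (C₂ ^ s * (C₂ + p) ^ r * (∑ a, |rowVar (P N) (u N) (g N) (Y N) a - 1|
        + Fintype.card (V N) * (p * (C₁ / D N) + p * β N + p * K * (C₁ / D N)))) := by gcongr
    _ = err N := by simp only [err]; ring

/-- Induction on r for all s together. The array d is left abstract: its boundary values and its
recursion determine it, and `chebMoment` is the instance used. -/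
theorem tendsto_pathSum (h : ∀ N, LabelledModel (P N) (u N) (g N) (Y N) K) {D : ℕ → ℝ}
    (hD : Tendsto D atTop atTop) {κ : ℝ}
    (hcard : Tendsto (fun N => Fintype.card (V N) / D N) atTop (𝓝 κ)) {C : ℝ} {b : ℕ → ℕ → ℝ}
    (hb : ∀ n, 2 ≤ n → ∀ N ℓ, D N * ∫ ω, ‖Y N ℓ ω‖ ^ n ∂(P N) ≤ b n N)
    (hb2 : ∀ᶠ N in atTop, b 2 N ≤ C) (hb3 : ∀ n, 3 ≤ n → Tendsto (b n) atTop (𝓝 0))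
    (hrow : Tendsto (fun N => (∑ a, |rowVar (P N) (u N) (g N) (Y N) a - 1|) / D N) atTop (𝓝 0))
    {d : ℕ → ℕ → ℝ} (hd00 : d 0 0 = 1) (hds0 : ∀ s, d (s + 1) 0 = 0)
    (hd0 : ∀ r, d 0 (r + 1) = d 1 r)
    (hd : ∀ s r, d (s + 1) (r + 1) = d (s + 2) r + d s r) (r s : ℕ) :
    Tendsto (fun N => (D N : ℂ)⁻¹ * pathSum (P N) (u N) (g N) (Y N) s r) atTop
      (𝓝 ((κ * d s r : ℝ) : ℂ)) := by
  induction r generalizing s with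
  | zero =>
    cases s with
    | zero =>
      simp only [pathSum_zero_zero, hd00, mul_one]
      refine ((Complex.continuous_ofReal.tendsto κ).comp hcard).congr fun N => ?_
      simp [div_eq_inv_mul]
    | succ s => simp [(h _).pathSum_succ_zero, hds0]
  | succ r ih =>
    cases s with
    | zero => simpa only [pathSum_zero_succ, hd0] using ih 1
    | succ s =>
      have h1 := ((tendsto_pathSum_step h hD hcard hb hb2 hb3 hrow s r).add (ih (s + 2))).add (ih s)
      rw [hd, mul_add, Complex.ofReal_add]
      rw [zero_add] at h1
      exact h1.congr fun N => by ring

end Limit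

end LabelledModel

/-! ### Independence of functions of disjoint families -/

/-- Induction on finite sets of indices: the event of a new index and the intersection of the
previous ones depend on disjoint subfamilies of M. -/
theorem iIndepFun_of_disjoint {ι L Ω β γ : Type*} [mΩ : MeasurableSpace Ω] [mβ : MeasurableSpace β]
    [MeasurableSpace γ] {P : Measure Ω} {M : ι → Ω → β} (hM : iIndepFun M P)
    (hmeas : ∀ i, Measurable (M i)) {S : L → Set ι} (hS : Pairwise fun a b => Disjoint (S a) (S b))
    {Y : L → Ω → γ} (hY : ∀ ℓ, Measurable[⨆ i ∈ S ℓ, mβ.comap (M i)] (Y ℓ)) : iIndepFun Y P := by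
  classical
  have := hM.isProbabilityMeasure
  have hle : ∀ i, mβ.comap (M i) ≤ mΩ := fun i => (hmeas i).comap_le
  refine (iIndepFun_iff _ _ _).2 fun s A hA => ?_
  induction s using Finset.induction_on with
  | empty => simp
  | insert ℓ s hℓ ih =>
    have h1 : MeasurableSet[⨆ i ∈ S ℓ, mβ.comap (M i)] (A ℓ) :=
      (hY ℓ).comap_le _ (hA ℓ (by simp))
    have h2 : MeasurableSet[⨆ i ∈ ⋃ ℓ' ∈ s, S ℓ', mβ.comap (M i)] (⋂ ℓ' ∈ s, A ℓ') := by
      refine Finset.measurableSet_biInter s fun ℓ' hℓ' => ?_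
      have h3 : (⨆ i ∈ S ℓ', mβ.comap (M i)) ≤ ⨆ i ∈ ⋃ ℓ' ∈ s, S ℓ', mβ.comap (M i) :=
        biSup_mono fun i hi => Set.mem_biUnion hℓ' hi
      exact h3 _ ((hY ℓ').comap_le _ (hA ℓ' (by simp [hℓ'])))
    have h4 : Disjoint (S ℓ) (⋃ ℓ' ∈ s, S ℓ') := by
      simp only [Set.disjoint_iUnion_right]
      exact fun ℓ' hℓ' => hS (by rintro rfl; exact hℓ hℓ')
    have h5 := (Indep_iff _ _ _).1 (indep_iSup_of_disjoint hle hM.iIndep h4) _ _ h1 h2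
    rw [Finset.set_biInter_insert, h5, Finset.prod_insert hℓ,
      ih fun i hi => hA i (by simp [hi])]

/-! ### Sorted tuples -/

section Sorted

variable {n k N : ℕ}

/-- Monotone tuples. -/
abbrev Sorted (n N : ℕ) : Type := {x : Fin n → Fin N // Monotone x}

/-- The monotone rearrangement of a tuple. -/
def sortT (x : Fin n → Fin N) : Sorted n N := ⟨x ∘ Tuple.sort x, Tuple.monotone_sort x⟩

theorem sortT_comp (x : Fin n → Fin N) (σ : Equiv.Perm (Fin n)) : sortT (x ∘ σ) = sortT x :=
  Subtype.ext Tuple.comp_perm_comp_sort_eq_comp_sort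

theorem sortT_val (a : Sorted n N) : sortT a.1 = a := by
  refine Subtype.ext ?_
  simp [sortT, Tuple.sort_eq_refl_iff_monotone.2 a.2]

theorem sortT_comp_sort_inv (x : Fin n → Fin N) : (sortT x).1 ∘ ⇑(Tuple.sort x)⁻¹ = x := by
  ext p; simp [sortT]

theorem exists_comp_of_sortT_eq {x y : Fin n → Fin N} (h : sortT x = sortT y) :
    ∃ σ : Equiv.Perm (Fin n), y = x ∘ σ := by
  refine ⟨Tuple.sort x * (Tuple.sort y)⁻¹, ?_⟩
  rw [Equiv.Perm.coe_mul, ← Function.comp_assoc]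
  change y = (sortT x).1 ∘ _
  rw [h, sortT_comp_sort_inv]

theorem Sorted.eq_of_perm {a b : Sorted n N} (h : (List.ofFn a.1).Perm (List.ofFn b.1)) : a = b :=
  Subtype.ext <| List.ofFn_injective <|
    h.eq_of_pairwise' a.2.sortedLE_ofFn.pairwise b.2.sortedLE_ofFn.pairwise

theorem append_swap (a b : Fin k → Fin N) :
    Fin.append b a = Fin.append a b ∘ (finAddFlip : Equiv.Perm (Fin (k + k))) := by
  ext p
  refine Fin.addCases (fun i => ?_) (fun i => ?_) p <;> simp [-Fin.natAdd_eq_addNat]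

/-- The label of the entry at `(a, b)`. -/
def tupleLabel (a b : Sorted k N) : Sorted (k + k) N := sortT (Fin.append a.1 b.1)

theorem tupleLabel_symm (a b : Sorted k N) : tupleLabel a b = tupleLabel b a := by
  rw [tupleLabel, tupleLabel, append_swap b.1 a.1, sortT_comp]

/-- The label is a multiset union, from which a can be cancelled, and a monotone tuple is determined
by its multiset of values. -/
theorem tupleLabel_inj (a b c : Sorted k N) (h : tupleLabel a b = tupleLabel a c) : b = c := by
  obtain ⟨σ, hσ⟩ := exists_comp_of_sortT_eq h
  have h1 := Equiv.Perm.ofFn_comp_perm σ (Fin.append a.1 b.1)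
  rw [← hσ, List.ofFn_fin_append, List.ofFn_fin_append, List.perm_append_left_iff] at h1
  exact (Sorted.eq_of_perm h1).symm

/-- The tuple a is the sorted form of k of the 2k values of ℓ. Selecting them through a permutation
of the legs gives the crude bound (2k)!. -/
theorem tupleLabel_incident (ℓ : Sorted (k + k) N) :
    ∃ S : Finset (Sorted k N), S.card ≤ (k + k).factorial ∧
      ∀ a b, tupleLabel a b = ℓ → a ∈ S := by
  classical
  refine ⟨Finset.univ.image fun σ : Equiv.Perm (Fin (k + k)) =>
    sortT fun i => ℓ.1 (σ (Fin.castAdd k i)), ?_, fun a b h => ?_⟩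
  · refine Finset.card_image_le.trans ?_
    rw [Finset.card_univ, Fintype.card_perm, Fintype.card_fin]
  · refine Finset.mem_image.2 ⟨(Tuple.sort (Fin.append a.1 b.1))⁻¹, Finset.mem_univ _, ?_⟩
    rw [← h, ← sortT_val a]
    congr 1
    ext i
    have := congrFun (sortT_comp_sort_inv (Fin.append a.1 b.1)) (Fin.castAdd k i)
    rw [sortT_val]
    simp only [Function.comp_apply, Fin.append_left] at this
    rw [tupleLabel, this]

/-- The permutation of `2k` legs acting separately on the rows and on the columns. -/
def blockPerm (ρ τ : Equiv.Perm (Fin k)) : Equiv.Perm (Fin (k + k)) :=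
  finSumFinEquiv.permCongr (Equiv.sumCongr ρ τ)

theorem append_comp_blockPerm (a b : Fin k → Fin N) (ρ τ : Equiv.Perm (Fin k)) :
    Fin.append a b ∘ blockPerm ρ τ = Fin.append (a ∘ ρ) (b ∘ τ) := by
  ext p
  refine Fin.addCases (fun i => ?_) (fun i => ?_) p <;> simp [blockPerm, -Fin.natAdd_eq_addNat]

theorem blockPerm_mul (ρ τ : Equiv.Perm (Fin k)) : blockPerm ρ τ = blockPerm ρ 1 * blockPerm 1 τ := by
  ext p
  refine Fin.addCases (fun i => ?_) (fun i => ?_) p <;> simp [blockPerm, -Fin.natAdd_eq_addNat]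

theorem blockPerm_one_left (τ : Equiv.Perm (Fin k)) : blockPerm 1 τ
    = (finAddFlip : Equiv.Perm (Fin (k + k))) * blockPerm τ 1
      * (finAddFlip : Equiv.Perm (Fin (k + k)))⁻¹ := by
  have h : ∀ i : Fin k, (finAddFlip : Equiv.Perm (Fin (k + k))).symm (Fin.natAdd k i)
      = Fin.castAdd k i := fun i => by rw [Equiv.symm_apply_eq, finAddFlip_apply_castAdd]
  have h' : ∀ i : Fin k, (finAddFlip : Equiv.Perm (Fin (k + k))).symm (Fin.castAdd k i)
      = Fin.natAdd k i := fun i => by rw [Equiv.symm_apply_eq, finAddFlip_apply_natAdd]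
  ext p
  refine Fin.addCases (fun i => ?_) (fun i => ?_) p <;> simp [blockPerm, h, h', -Fin.natAdd_eq_addNat]

/-- The row block and the column block are conjugate under the exchange of the halves, and a
character into a commutative group ignores conjugation. Rows and columns therefore carry the same
sign function, and one isometry serves both sides. -/
theorem apply_blockPerm (χ : Equiv.Perm (Fin (k + k)) →* ℤˣ) (ρ τ : Equiv.Perm (Fin k)) :
    χ (blockPerm ρ τ) = χ (blockPerm ρ 1) * χ (blockPerm τ 1) := by
  rw [blockPerm_mul, map_mul, blockPerm_one_left, map_mul, map_mul, map_inv]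
  congr 1
  rw [mul_comm (χ finAddFlip), mul_assoc, mul_inv_cancel, mul_one]

/-! #### The number of rearrangements -/

/-- The number of rearrangements of a sorted tuple. -/
def numRearr (a : Sorted n N) : ℕ := (Finset.univ.filter fun x => sortT x = a).card

theorem filter_sortT_eq_image (a : Sorted n N) :
    (Finset.univ.filter fun x => sortT x = a)
      = Finset.univ.image fun σ : Equiv.Perm (Fin n) => a.1 ∘ σ := by
  ext x
  simp only [Finset.mem_filter, Finset.mem_univ, true_and, Finset.mem_image]
  constructor
  · rintro rfl
    exact ⟨_, sortT_comp_sort_inv x⟩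
  · rintro ⟨σ, rfl⟩
    rw [sortT_comp, sortT_val]

theorem numRearr_pos (a : Sorted n N) : 0 < numRearr a :=
  Finset.card_pos.2 ⟨a.1, by simp [sortT_val]⟩

theorem numRearr_le (a : Sorted n N) : numRearr a ≤ n.factorial := by
  rw [numRearr, filter_sortT_eq_image]
  refine Finset.card_image_le.trans ?_
  rw [Finset.card_univ, Fintype.card_perm, Fintype.card_fin]

theorem numRearr_of_injective (a : Sorted n N) (ha : Function.Injective a.1) :
    numRearr a = n.factorial := by
  rw [numRearr, filter_sortT_eq_image, Finset.card_image_of_injective, Finset.card_univ,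
    Fintype.card_perm, Fintype.card_fin]
  intro σ τ h
  exact Equiv.ext fun p => ha (congrFun h p)

theorem sum_eq_sum_numRearr {E : Type*} [Semiring E] (f : Sorted n N → E) :
    ∑ x, f (sortT x) = ∑ a, numRearr a * f a := by
  rw [← Finset.sum_fiberwise_of_maps_to (t := Finset.univ) (g := sortT) fun _ _ => Finset.mem_univ _]
  refine Finset.sum_congr rfl fun a _ => ?_
  rw [Finset.sum_congr rfl (g := fun _ => f a) fun x hx => by rw [(Finset.mem_filter.1 hx).2]]
  rw [Finset.sum_const, nsmul_eq_mul, numRearr]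

theorem card_not_injective_mul_le (n N : ℕ) :
    (Finset.univ.filter fun x : Fin n → Fin N => ¬ Function.Injective x).card * N
      ≤ n ^ 2 * N ^ n := by
  classical
  have h1 : (Finset.univ.filter fun x : Fin n → Fin N => ¬ Function.Injective x)
      ⊆ (Finset.univ.filter fun e : Fin n × Fin n => e.1 ≠ e.2).biUnion fun e =>
        Finset.univ.filter fun x : Fin n → Fin N => x e.1 = x e.2 := by
    intro x hx
    simp only [Function.Injective, not_forall, Finset.mem_filter, Finset.mem_univ, true_and] at hx
    obtain ⟨i, j, h, hij⟩ := hx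
    simp only [Finset.mem_biUnion, Finset.mem_filter, Finset.mem_univ, true_and]
    exact ⟨(i, j), hij, h⟩
  have h2 : ∀ e ∈ (Finset.univ.filter fun e : Fin n × Fin n => e.1 ≠ e.2),
      (Finset.univ.filter fun x : Fin n → Fin N => x e.1 = x e.2).card * N ≤ N ^ n := by
    rintro ⟨i, j⟩ he
    have hij : i ≠ j := by simpa using he
    rw [show N ^ n = Fintype.card (Fin n → Fin N) by simp, ← Finset.card_univ]
    rw [show (Finset.univ.filter fun x : Fin n → Fin N => x i = x j).card * N
      = ((Finset.univ.filter fun x : Fin n → Fin N => x i = x j) ×ˢ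
        (Finset.univ : Finset (Fin N))).card by simp [Finset.card_product]]
    -- Since x i = x j, the value overwritten at i can be recovered at j, while v is read at i.
    refine Finset.card_le_card_of_injOn (fun p => Function.update p.1 i p.2)
      (fun _ _ => Finset.mem_coe.2 (Finset.mem_univ _)) ?_
    rintro ⟨x, v⟩ hx ⟨y, w⟩ hy h
    simp only [Finset.coe_product, Finset.coe_filter, Finset.mem_univ, true_and, Set.mem_prod,
      Set.mem_ofPred_eq] at hx hy
    have hv : v = w := by simpa using congrFun h i
    refine Prod.ext ?_ hv
    funext l
    by_cases hl : l = i
    · subst hl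
      change x l = y l
      rw [hx.1, hy.1]
      simpa [hij.symm] using congrFun h j
    · simpa [hl] using congrFun h l
  calc _ ≤ (∑ e ∈ (Finset.univ.filter fun e : Fin n × Fin n => e.1 ≠ e.2),
        (Finset.univ.filter fun x : Fin n → Fin N => x e.1 = x e.2).card) * N :=
        Nat.mul_le_mul_right _ ((Finset.card_le_card h1).trans Finset.card_biUnion_le)
    _ ≤ ∑ e ∈ (Finset.univ.filter fun e : Fin n × Fin n => e.1 ≠ e.2), N ^ n := by
        rw [Finset.sum_mul]
        exact Finset.sum_le_sum h2
    _ ≤ n ^ 2 * N ^ n := by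
        rw [Finset.sum_const, smul_eq_mul]
        refine Nat.mul_le_mul_right _ ((Finset.card_le_univ _).trans ?_)
        simp [sq]

end Sorted

/-! ### Sums of flattenings weighted by a character -/

section SymTensor

variable {k N : ℕ}

theorem sq_units_int_cast (ε : ℤˣ) : ((ε : ℤ) : ℂ) * ((ε : ℤ) : ℂ) = 1 := by
  rcases Int.units_eq_one_or ε with rfl | rfl <;> simp

/-- The sum of a tensor over the permutations of its legs, weighted by a character. -/
def symT (χ : Equiv.Perm (Fin (k + k)) →* ℤˣ) (M : Tensor k N) (x : Fin (k + k) → Fin N) : ℂ :=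
  ∑ σ : Equiv.Perm (Fin (k + k)), ((χ σ : ℤ) : ℂ) * M (x ∘ ⇑σ⁻¹)

theorem symT_comp (χ : Equiv.Perm (Fin (k + k)) →* ℤˣ) (M : Tensor k N) (x : Fin (k + k) → Fin N)
    (τ : Equiv.Perm (Fin (k + k))) : symT χ M (x ∘ τ) = ((χ τ : ℤ) : ℂ) * symT χ M x := by
  rw [symT, symT, Finset.mul_sum, ← Equiv.sum_comp (Equiv.mulRight τ)]
  refine Finset.sum_congr rfl fun σ _ => ?_
  rw [Equiv.coe_mulRight, map_mul, mul_inv_rev, Function.comp_assoc, ← Equiv.Perm.coe_mul,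
    mul_inv_cancel_left]
  push_cast
  ring

/-- The square matrix with entries `symT χ M`. -/
def symMat (χ : Equiv.Perm (Fin (k + k)) →* ℤˣ) (M : Tensor k N) : Mat k N :=
  Matrix.of fun i j => symT χ M (Fin.append i j)

/-- The sign relating the row `i` to the row of its monotone rearrangement. -/
def rowSign (χ : Equiv.Perm (Fin (k + k)) →* ℤˣ) (i : Fin k → Fin N) : ℤˣ :=
  χ (blockPerm (Tuple.sort i)⁻¹ 1)

theorem symT_append (χ : Equiv.Perm (Fin (k + k)) →* ℤˣ) (M : Tensor k N) (i j : Fin k → Fin N) :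
    symT χ M (Fin.append i j) = ((rowSign χ i : ℤ) : ℂ) * ((rowSign χ j : ℤ) : ℂ) *
      symT χ M (Fin.append (sortT i).1 (sortT j).1) := by
  conv_lhs => rw [← sortT_comp_sort_inv i, ← sortT_comp_sort_inv j, ← append_comp_blockPerm,
    symT_comp, apply_blockPerm]
  simp [rowSign]

/-- The isometry onto the space of tuples with prescribed symmetry. -/
def symIso (χ : Equiv.Perm (Fin (k + k)) →* ℤˣ) : Matrix (Fin k → Fin N) (Sorted k N) ℂ :=
  Matrix.of fun i a => if sortT i = a then ((rowSign χ i : ℤ) : ℂ) / (√(numRearr a) : ℝ) else 0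

/-- The compression of `symMat` to sorted tuples. -/
def redMat (χ : Equiv.Perm (Fin (k + k)) →* ℤˣ) (M : Tensor k N) :
    Matrix (Sorted k N) (Sorted k N) ℂ :=
  Matrix.of fun a b => (√(numRearr a) : ℝ) * (√(numRearr b) : ℝ) * symT χ M (Fin.append a.1 b.1)

theorem sqrt_numRearr_ne_zero {n : ℕ} (a : Sorted n N) : ((√(numRearr a) : ℝ) : ℂ) ≠ 0 := by
  have := numRearr_pos a
  exact_mod_cast (Real.sqrt_pos.2 (by exact_mod_cast this)).ne'

/-- Distinct columns are supported on disjoint orbits, and a column has `numRearr a` entries of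
modulus 1 / √(`numRearr a`). -/
theorem symIso_conjTranspose_mul (χ : Equiv.Perm (Fin (k + k)) →* ℤˣ) :
    (symIso (N := N) χ).conjTranspose * symIso (N := N) χ = 1 := by
  ext a b
  rw [Matrix.mul_apply, Matrix.one_apply]
  simp only [Matrix.conjTranspose_apply, symIso, Matrix.of_apply]
  have h : ∀ i : Fin k → Fin N, star (if sortT i = a then
      ((rowSign χ i : ℤ) : ℂ) / (√(numRearr a) : ℝ) else 0) *
      (if sortT i = b then ((rowSign χ i : ℤ) : ℂ) / (√(numRearr b) : ℝ) else 0)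
      = if sortT i = a then (if a = b then (numRearr a : ℂ)⁻¹ else 0) else 0 := by
    intro i
    by_cases h1 : sortT i = a
    · by_cases h2 : a = b
      · subst h2
        simp only [h1, if_true]
        have h3 : ((√(numRearr a) : ℝ) : ℂ) * ((√(numRearr a) : ℝ) : ℂ) = numRearr a := by
          exact_mod_cast Real.mul_self_sqrt (Nat.cast_nonneg (numRearr a))
        have h4 := sq_units_int_cast (rowSign χ i)
        simp only [RCLike.star_def, map_div₀, Complex.conj_ofReal, map_intCast]
        rw [div_mul_div_comm, h3, h4, one_div]
      · simp [h1, h2]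
    · simp [h1]
  simp only [h]
  rw [Finset.sum_ite, Finset.sum_const_zero, add_zero, Finset.sum_const]
  change numRearr a • _ = _
  have := numRearr_pos a
  split_ifs
  · rw [nsmul_eq_mul, mul_inv_cancel₀ (by exact_mod_cast this.ne')]
  · simp

theorem symMat_eq (χ : Equiv.Perm (Fin (k + k)) →* ℤˣ) (M : Tensor k N) :
    symMat χ M = symIso (N := N) χ * redMat χ M * (symIso (N := N) χ).conjTranspose := by
  ext i j
  simp only [Matrix.mul_apply, Matrix.conjTranspose_apply, symIso, redMat, symMat, Matrix.of_apply]
  rw [Finset.sum_eq_single (sortT j), Finset.sum_eq_single (sortT i), symT_append]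
  · simp only [if_true, RCLike.star_def, map_div₀, Complex.conj_ofReal, map_intCast]
    have h1 := sqrt_numRearr_ne_zero (sortT i)
    have h2 := sqrt_numRearr_ne_zero (sortT j)
    field_simp
  · intro a _ ha
    simp [ha.symm]
  · simp
  · intro b _ hb
    simp [hb.symm]
  · simp

theorem altWord_isometry {m n : Type*} [Fintype m] [DecidableEq m] [Fintype n] [DecidableEq n]
    {F : Matrix m n ℂ} (hF : F.conjTranspose * F = 1) (H : Matrix n n ℂ) (ε : Bool) (r : ℕ) :
    altWord (F * H * F.conjTranspose) ε (r + 1) = F * altWord H ε (r + 1) * F.conjTranspose := by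
  have h1 : ∀ ε : Bool, (if ε then F * H * F.conjTranspose else
      (F * H * F.conjTranspose).conjTranspose)
      = F * (if ε then H else H.conjTranspose) * F.conjTranspose := by
    intro ε
    cases ε <;> simp [Matrix.conjTranspose_mul, Matrix.mul_assoc]
  induction r generalizing ε with
  | zero => simp only [altWord, h1, mul_one]
  | succ r ih =>
    have h2 : altWord H ε (r + 1 + 1)
        = (if ε then H else H.conjTranspose) * altWord H (!ε) (r + 1) := rfl
    rw [altWord, ih, h2, h1]
    simp only [Matrix.mul_assoc]
    rw [← Matrix.mul_assoc F.conjTranspose F, hF, Matrix.one_mul]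

/-- The empty word is excluded: the identities of the two sizes have different traces, and this is
the origin of the atom at 0. -/
theorem trace_altWord_isometry {m n : Type*} [Fintype m] [DecidableEq m] [Fintype n]
    [DecidableEq n] {F : Matrix m n ℂ} (hF : F.conjTranspose * F = 1) (H : Matrix n n ℂ) (r : ℕ) :
    (altWord (F * H * F.conjTranspose) true (r + 1)).trace = (altWord H true (r + 1)).trace := by
  rw [altWord_isometry hF, Matrix.trace_mul_comm, ← Matrix.mul_assoc, hF, Matrix.one_mul]

/-- The deterministic factors of the entries of the compression. -/
def redCoef (χ : Equiv.Perm (Fin (k + k)) →* ℤˣ) (a b : Sorted k N) : ℝ :=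
  √(numRearr a) * √(numRearr b) / k.factorial *
    ((χ (Tuple.sort (Fin.append a.1 b.1)) : ℤ) : ℝ)

/-- The random factors of the entries of the compression. -/
def redVar (χ : Equiv.Perm (Fin (k + k)) →* ℤˣ) (s : ℝ) (ℓ : Sorted (k + k) N) (M : Tensor k N) :
    ℂ :=
  ((k.factorial * s : ℝ) : ℂ) * symT χ M ℓ.1

/-- Orbits have at most k! elements, so dividing by k! bounds the coefficients by 1; the factor k!
is moved to the random part. The sign of the sorting permutation squares to 1. -/
theorem smul_redMat_eq {Ω : Type*} (χ : Equiv.Perm (Fin (k + k)) →* ℤˣ) (s : ℝ)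
    (M : Ω → Tensor k N) (ω : Ω) :
    s • redMat χ (M ω) = labelledMatrix tupleLabel (redCoef χ) (fun ℓ ω => redVar χ s ℓ (M ω)) ω := by
  ext a b
  simp only [Matrix.smul_apply, redMat, labelledMatrix, Matrix.of_apply, redCoef, redVar, tupleLabel]
  have h1 := symT_comp χ (M ω) (Fin.append a.1 b.1) (Tuple.sort (Fin.append a.1 b.1))
  change symT χ (M ω) (sortT (Fin.append a.1 b.1)).1 = _ at h1
  rw [h1]
  have h2 := sq_units_int_cast (χ (Tuple.sort (Fin.append a.1 b.1)))
  have h3 : (k.factorial : ℂ) ≠ 0 := by exact_mod_cast k.factorial_ne_zero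
  rw [Complex.real_smul]
  push_cast
  rw [div_mul_eq_mul_div, div_mul_eq_mul_div, eq_div_iff h3]
  linear_combination (-(s * (√(numRearr a) : ℝ) * (√(numRearr b) : ℝ) *
    symT χ (M ω) (Fin.append a.1 b.1) * k.factorial : ℂ)) * h2

theorem trace_altWord_smul_symMat {Ω : Type*} (χ : Equiv.Perm (Fin (k + k)) →* ℤˣ) (s : ℝ)
    (M : Ω → Tensor k N) (ω : Ω) (r : ℕ) :
    (altWord (s • symMat χ (M ω)) true (r + 1)).trace
      = (altWord (labelledMatrix tupleLabel (redCoef χ) (fun ℓ ω => redVar χ s ℓ (M ω)) ω)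
          true (r + 1)).trace := by
  rw [← smul_redMat_eq, ← trace_altWord_isometry (symIso_conjTranspose_mul χ), symMat_eq,
    Matrix.mul_smul, Matrix.smul_mul]

theorem abs_units_int_cast (ε : ℤˣ) : |((ε : ℤ) : ℝ)| = 1 := by
  rcases Int.units_eq_one_or ε with rfl | rfl <;> simp

theorem norm_units_int_cast (ε : ℤˣ) : ‖((ε : ℤ) : ℂ)‖ = 1 := by
  rcases Int.units_eq_one_or ε with rfl | rfl <;> simp

theorem abs_redCoef (χ : Equiv.Perm (Fin (k + k)) →* ℤˣ) (a b : Sorted k N) :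
    |redCoef χ a b| = √(numRearr a) * √(numRearr b) / k.factorial := by
  rw [redCoef, abs_mul, abs_units_int_cast, mul_one, abs_of_nonneg (by positivity)]

theorem sq_redCoef (χ : Equiv.Perm (Fin (k + k)) →* ℤˣ) (a b : Sorted k N) :
    redCoef χ a b ^ 2 = numRearr a * numRearr b / (k.factorial : ℝ) ^ 2 := by
  rw [← sq_abs, abs_redCoef, div_pow, mul_pow, Real.sq_sqrt (by positivity),
    Real.sq_sqrt (by positivity)]

theorem abs_redCoef_le (χ : Equiv.Perm (Fin (k + k)) →* ℤˣ) (a b : Sorted k N) :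
    |redCoef χ a b| ≤ 1 := by
  rw [← sq_le_one_iff_abs_le_one, sq_redCoef, div_le_one (by positivity), sq]
  have h1 := numRearr_le a
  have h2 := numRearr_le b
  gcongr

end SymTensor

/-! ### Symmetrized tensors with independent entries -/

/-- A random tensor with centered independent entries, whose absolute moments are `m`. -/
structure CenteredTensor {k N : ℕ} {Ω : Type*} [MeasurableSpace Ω] (P : Measure Ω)
    (M : Ω → Tensor k N) (m : ℕ → ℝ) : Prop where
  moments : ∀ x, AllMoments P fun ω => M ω x
  indep : iIndepFun (fun x ω => M ω x) P
  centered : ∀ x, ∫ ω, M ω x ∂P = 0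
  absMoment : ∀ x n, ∫ ω, ‖M ω x‖ ^ n ∂P = m n

namespace CenteredTensor

section Fixed

variable {k N : ℕ} {Ω : Type*} [MeasurableSpace Ω] {P : Measure Ω} [IsProbabilityMeasure P]
  {M : Ω → Tensor k N} {m : ℕ → ℝ} {χ : Equiv.Perm (Fin (k + k)) →* ℤˣ} {s : ℝ}

theorem allMoments_symT (h : CenteredTensor P M m) (x : Fin (k + k) → Fin N) :
    AllMoments P fun ω => symT χ (M ω) x :=
  AllMoments.sum _ fun _ _ => (h.moments _).const_mul _

/-- Independence: the variable of ℓ involves only the entries of M at rearrangements of ℓ, and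
distinct orbits are disjoint. -/
theorem labelledModel (h : CenteredTensor P M m) (χ : Equiv.Perm (Fin (k + k)) →* ℤˣ) (s : ℝ) :
    LabelledModel P (tupleLabel (k := k) (N := N)) (redCoef χ) (fun ℓ ω => redVar χ s ℓ (M ω))
      (k + k).factorial where
  symm := tupleLabel_symm
  inj := tupleLabel_inj
  incident := tupleLabel_incident
  abs_le := abs_redCoef_le χ
  sq_symm a b := by rw [sq_redCoef, sq_redCoef, mul_comm (numRearr a : ℝ)]
  moments ℓ := (h.allMoments_symT _).const_mul _
  indep := by
    refine iIndepFun_of_disjoint h.indep (fun x => (h.moments x).measurable)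
      (S := fun ℓ => {x | sortT x = ℓ}) ?_ fun ℓ => ?_
    · intro a b hab
      refine Set.disjoint_left.2 fun x hx hx' => hab ?_
      rw [← show sortT x = a from hx, ← show sortT x = b from hx']
    · unfold redVar symT
      refine Measurable.const_mul (Finset.measurable_fun_sum _ fun σ _ => Measurable.const_mul ?_ _) _
      have h1 : ℓ.1 ∘ ⇑σ⁻¹ ∈ {x | sortT x = ℓ} := by
        change sortT _ = ℓ
        rw [sortT_comp, sortT_val]
      exact Measurable.mono (comap_measurable _)
        (le_iSup₂ (f := fun x (_ : x ∈ {x | sortT x = ℓ}) =>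
          MeasurableSpace.comap (fun ω => M ω x) Complex.measurableSpace) _ h1) le_rfl
  centered ℓ := by
    unfold redVar symT
    rw [integral_const_mul, integral_finsetSum _ fun σ _ => ((h.moments _).const_mul _).integrable]
    simp [integral_const_mul, h.centered]

/-- Power mean inequality for the (2k)! terms of the sum. -/
theorem integral_norm_symT_pow_le (h : CenteredTensor P M m) (x : Fin (k + k) → Fin N) (n : ℕ) :
    ∫ ω, ‖symT χ (M ω) x‖ ^ (n + 1) ∂P ≤ ((k + k).factorial : ℝ) ^ (n + 1) * m (n + 1) := by
  have h1 : ∀ ω, ‖symT χ (M ω) x‖ ^ (n + 1) ≤ ((k + k).factorial : ℝ) ^ n *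
      ∑ σ : Equiv.Perm (Fin (k + k)), ‖M ω (x ∘ ⇑σ⁻¹)‖ ^ (n + 1) := by
    intro ω
    have h2 : ‖symT χ (M ω) x‖ ≤ ∑ σ : Equiv.Perm (Fin (k + k)), ‖M ω (x ∘ ⇑σ⁻¹)‖ :=
      norm_sum_le_of_le _ fun σ _ => by rw [norm_mul, norm_units_int_cast, one_mul]
    have h3 := pow_sum_div_card_le_sum_pow (s := (Finset.univ : Finset (Equiv.Perm (Fin (k + k)))))
      (f := fun σ => ‖M ω (x ∘ ⇑σ⁻¹)‖) (fun _ _ => norm_nonneg _) n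
    rw [Finset.card_univ, Fintype.card_perm, Fintype.card_fin, div_le_iff₀ (by positivity),
      mul_comm] at h3
    exact (pow_le_pow_left₀ (norm_nonneg _) h2 _).trans h3
  have h4 : Integrable (fun ω => ((k + k).factorial : ℝ) ^ n *
      ∑ σ : Equiv.Perm (Fin (k + k)), ‖M ω (x ∘ ⇑σ⁻¹)‖ ^ (n + 1)) P :=
    (integrable_finsetSum _ fun σ _ => (h.moments _).integrable_pow _).const_mul _
  refine (integral_mono ((h.allMoments_symT x).integrable_pow _) h4 h1).trans (le_of_eq ?_)
  rw [integral_const_mul, integral_finsetSum _ fun σ _ => (h.moments _).integrable_pow _]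
  simp only [h.absMoment, Finset.sum_const, Finset.card_univ, Fintype.card_perm, Fintype.card_fin,
    nsmul_eq_mul]
  ring

theorem integral_mul_conj (h : CenteredTensor P M m) (x y : Fin (k + k) → Fin N) :
    ∫ ω, M ω x * starRingEnd ℂ (M ω y) ∂P = if x = y then (m 2 : ℂ) else 0 := by
  split_ifs with hxy
  · subst hxy
    rw [← h.absMoment x 2, ← integral_complex_ofReal]
    congr 1; ext ω
    rw [Complex.mul_conj']
    simp
  · have h1 : IndepFun (fun ω => M ω x) (fun ω => starRingEnd ℂ (M ω y)) P :=
      (h.indep.indepFun hxy).comp measurable_id Complex.continuous_conj.measurable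
    rw [h1.integral_fun_mul_eq_mul_integral (h.moments x).measurable.aestronglyMeasurable
      (h.moments y).conj.measurable.aestronglyMeasurable, h.centered, zero_mul]

/-- For injective x the entries at x ∘ σ⁻¹ are distinct, hence uncorrelated, and only the terms σ =
τ survive. -/
theorem integral_norm_symT_sq (h : CenteredTensor P M m) {x : Fin (k + k) → Fin N}
    (hx : Function.Injective x) :
    ∫ ω, ‖symT χ (M ω) x‖ ^ 2 ∂P = (k + k).factorial * m 2 := by
  have h1 : ((∫ ω, ‖symT χ (M ω) x‖ ^ 2 ∂P : ℝ) : ℂ) = ((k + k).factorial * m 2 : ℝ) := by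
    rw [← integral_complex_ofReal]
    have h2 : ∀ ω, ((‖symT χ (M ω) x‖ ^ 2 : ℝ) : ℂ) = ∑ σ : Equiv.Perm (Fin (k + k)),
        ∑ τ : Equiv.Perm (Fin (k + k)), ((χ σ : ℤ) : ℂ) * ((χ τ : ℤ) : ℂ) *
          (M ω (x ∘ ⇑σ⁻¹) * starRingEnd ℂ (M ω (x ∘ ⇑τ⁻¹))) := by
      intro ω
      push_cast
      rw [← Complex.mul_conj', symT, map_sum, Finset.sum_mul_sum]
      refine Finset.sum_congr rfl fun σ _ => Finset.sum_congr rfl fun τ _ => ?_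
      simp only [map_mul, map_intCast]
      ring
    have h3 : ∀ σ τ : Equiv.Perm (Fin (k + k)), AllMoments P fun ω =>
        ((χ σ : ℤ) : ℂ) * ((χ τ : ℤ) : ℂ) *
          (M ω (x ∘ ⇑σ⁻¹) * starRingEnd ℂ (M ω (x ∘ ⇑τ⁻¹))) := fun σ τ =>
      ((h.moments _).mul (h.moments _).conj).const_mul _
    simp only [h2]
    rw [integral_finsetSum _ fun σ _ => (AllMoments.sum _ fun τ _ => h3 σ τ).integrable]
    have h4 : ∀ σ : Equiv.Perm (Fin (k + k)), ∫ ω, ∑ τ : Equiv.Perm (Fin (k + k)),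
        ((χ σ : ℤ) : ℂ) * ((χ τ : ℤ) : ℂ) *
          (M ω (x ∘ ⇑σ⁻¹) * starRingEnd ℂ (M ω (x ∘ ⇑τ⁻¹))) ∂P = m 2 := by
      intro σ
      rw [integral_finsetSum _ fun τ _ => (h3 σ τ).integrable]
      simp only [integral_const_mul, h.integral_mul_conj]
      rw [Finset.sum_eq_single σ]
      · rw [if_pos rfl, sq_units_int_cast, one_mul]
      · intro τ _ hτ
        rw [if_neg, mul_zero]
        intro hh
        refine hτ (inv_injective (Equiv.ext fun p => hx (congrFun hh.symm p)))
      · simp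
    simp only [h4, Finset.sum_const, Finset.card_univ, Fintype.card_perm, Fintype.card_fin,
      nsmul_eq_mul]
    push_cast
    rfl
  exact_mod_cast h1

/-- The weights `numRearr b` convert the sum over monotone columns into a sum over all columns, the
signs being invisible in absolute value. -/
theorem rowVar_eq (χ : Equiv.Perm (Fin (k + k)) →* ℤˣ) (s : ℝ) (a : Sorted k N) :
    LabelledModel.rowVar P tupleLabel (redCoef χ) (fun ℓ ω => redVar χ s ℓ (M ω)) a
      = numRearr a * ∑ j, s ^ 2 * ∫ ω, ‖symT χ (M ω) (Fin.append a.1 j)‖ ^ 2 ∂P := by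
  have h1 : ∀ j, s ^ 2 * ∫ ω, ‖symT χ (M ω) (Fin.append a.1 j)‖ ^ 2 ∂P
      = s ^ 2 * ∫ ω, ‖symT χ (M ω) (Fin.append a.1 (sortT j).1)‖ ^ 2 ∂P := by
    intro j
    simp only [symT_append χ _ a.1 j, sortT_val, norm_mul, norm_units_int_cast, one_mul]
  rw [Finset.sum_congr rfl fun j _ => h1 j, sum_eq_sum_numRearr fun b : Sorted k N =>
    s ^ 2 * ∫ ω, ‖symT χ (M ω) (Fin.append a.1 b.1)‖ ^ 2 ∂P, Finset.mul_sum]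
  refine Finset.sum_congr rfl fun b _ => ?_
  have h2 : ∀ ω, ‖redVar χ s (tupleLabel a b) (M ω)‖ ^ 2
      = (k.factorial * s) ^ 2 * ‖symT χ (M ω) (Fin.append a.1 b.1)‖ ^ 2 := by
    intro ω
    have h3 := symT_comp χ (M ω) (Fin.append a.1 b.1) (Tuple.sort (Fin.append a.1 b.1))
    change symT χ (M ω) (tupleLabel a b).1 = _ at h3
    rw [redVar, h3, norm_mul, norm_mul, norm_units_int_cast, one_mul, mul_pow, Complex.norm_real,
      Real.norm_eq_abs, sq_abs]
  unfold LabelledModel.entryVar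
  simp only [h2, integral_const_mul, sq_redCoef]
  have : (k.factorial : ℝ) ≠ 0 := by positivity
  field_simp

/-- The number of tuples with a repetition. -/
def numDegenerate (n N : ℕ) : ℕ :=
  (Finset.univ.filter fun x : Fin n → Fin N => ¬ Function.Injective x).card

theorem sum_abs_numRearr_sub_le (k N : ℕ) :
    ∑ a : Sorted k N, |(numRearr a : ℝ) / k.factorial - 1| ≤ numDegenerate k N := by
  classical
  have h1 : ∀ a : Sorted k N, |(numRearr a : ℝ) / k.factorial - 1|
      ≤ if ¬ Function.Injective a.1 then 1 else 0 := by
    intro a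
    have h0 : (0 : ℝ) < k.factorial := by positivity
    split_ifs with h
    · rw [numRearr_of_injective a h, div_self h0.ne']; simp
    · have h2 : (numRearr a : ℝ) / k.factorial ≤ 1 := by
        rw [div_le_one h0]
        exact_mod_cast numRearr_le a
      have h3 : 0 ≤ (numRearr a : ℝ) / k.factorial := by positivity
      rw [abs_le]
      constructor <;> linarith
  refine (Finset.sum_le_sum fun a _ => h1 a).trans ?_
  rw [Finset.sum_boole]
  exact_mod_cast Finset.card_le_card_of_injOn Subtype.val (fun a ha => by simpa using ha)
    fun a _ b _ => Subtype.ext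

theorem abs_card_sub_le (k N : ℕ) :
    |(Fintype.card (Sorted k N) : ℝ) - (N : ℝ) ^ k / k.factorial| ≤ numDegenerate k N := by
  refine le_trans (le_of_eq ?_) ((Finset.abs_sum_le_sum_abs _ _).trans (sum_abs_numRearr_sub_le k N))
  have h1 := sum_eq_sum_numRearr (n := k) (N := N) (E := ℝ) fun _ => 1
  simp only [Finset.sum_const, Finset.card_univ, Fintype.card_pi, Fintype.card_fin,
    Finset.prod_const, nsmul_eq_mul, mul_one] at h1
  rw [Finset.sum_sub_distrib, ← Finset.sum_div, ← h1, abs_sub_comm]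
  simp

theorem sum_abs_rowVar_sub_le (h : CenteredTensor P M m) (χ : Equiv.Perm (Fin (k + k)) →* ℤˣ)
    {s c : ℝ} (hs : s ^ 2 * ((k + k).factorial * k.factorial * c) = 1) (hc : 0 < c) :
    ∑ a, |LabelledModel.rowVar P tupleLabel (redCoef χ) (fun ℓ ω => redVar χ s ℓ (M ω)) a - 1|
      ≤ k.factorial * (s ^ 2 * (k + k).factorial ^ 2 + (k.factorial * c)⁻¹) * m 2
          * numDegenerate (k + k) N
        + numDegenerate k N * |(N : ℝ) ^ k * m 2 / c|
        + Fintype.card (Sorted k N) * |(N : ℝ) ^ k * m 2 / c - 1| := by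
  classical
  -- The number m 2 is tied to a moment only through an actual entry, so m 2 ≥ 0 needs one. Without
  -- entries there are no rows.
  rcases isEmpty_or_nonempty (Fin (k + k) → Fin N) with he | ⟨⟨x₀⟩⟩
  · have : IsEmpty (Sorted k N) := ⟨fun a => he.elim (Fin.append a.1 a.1)⟩
    simp [numDegenerate, Fintype.card_eq_zero]
    positivity
  have hm0 : 0 ≤ m 2 := by
    rw [← h.absMoment x₀ 2]
    exact integral_nonneg fun _ => by positivity
  have hk0 : (0 : ℝ) < k.factorial := by positivity
  set θ := (N : ℝ) ^ k * m 2 / c with hθ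
  set C' := s ^ 2 * (k + k).factorial ^ 2 + (k.factorial * c)⁻¹ with hC'
  -- By `hs`, the subtracted value is the rescaled second moment at an injective tuple, so e lives
  -- on degenerate tuples.
  let e : (Fin (k + k) → Fin N) → ℝ := fun x =>
    s ^ 2 * ∫ ω, ‖symT χ (M ω) x‖ ^ 2 ∂P - m 2 / (k.factorial * c)
  have he : ∀ x, |e x| ≤ (if ¬ Function.Injective x then 1 else 0) * (C' * m 2) := by
    intro x
    by_cases hx : Function.Injective x
    · have : e x = 0 := by
        simp only [e]
        rw [h.integral_norm_symT_sq hx, sub_eq_zero, eq_div_iff (by positivity)]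
        linear_combination (m 2) * hs
      simp [this, hx]
    · rw [if_pos hx, one_mul]
      have h1 := h.integral_norm_symT_pow_le (χ := χ) x 1
      have h2 : 0 ≤ ∫ ω, ‖symT χ (M ω) x‖ ^ 2 ∂P := integral_nonneg fun _ => by positivity
      refine (abs_sub _ _).trans ?_
      rw [abs_of_nonneg (by positivity), abs_of_nonneg (by positivity), hC', add_mul, mul_assoc]
      refine add_le_add (mul_le_mul_of_nonneg_left h1 (sq_nonneg s)) (le_of_eq ?_)
      rw [div_eq_inv_mul]
  -- Three sources of error: degenerate tuples (a, j), orbits of a smaller than k!, and the gap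
  -- between N^k m 2 and c.
  have hrow : ∀ a : Sorted k N,
      LabelledModel.rowVar P tupleLabel (redCoef χ) (fun ℓ ω => redVar χ s ℓ (M ω)) a - 1
      = numRearr a * ∑ j, e (Fin.append a.1 j) + ((numRearr a : ℝ) / k.factorial - 1) * θ
        + (θ - 1) := by
    intro a
    rw [rowVar_eq]
    simp only [e, Finset.sum_sub_distrib, Finset.sum_const, Finset.card_univ, Fintype.card_pi,
      Fintype.card_fin, Finset.prod_const, nsmul_eq_mul, hθ]
    push_cast
    field_simp
    ring
  have hbd : ∀ a : Sorted k N,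
      |LabelledModel.rowVar P tupleLabel (redCoef χ) (fun ℓ ω => redVar χ s ℓ (M ω)) a - 1|
      ≤ k.factorial * (∑ j : Fin k → Fin N, (if ¬ Function.Injective (Fin.append a.1 j) then 1 else 0) * (C' * m 2))
        + |(numRearr a : ℝ) / k.factorial - 1| * |θ| + |θ - 1| := by
    intro a
    rw [hrow]
    refine (abs_add_le _ _).trans (add_le_add ((abs_add_le _ _).trans (add_le_add ?_ ?_)) le_rfl)
    · rw [abs_mul, Nat.abs_cast]
      refine mul_le_mul (by exact_mod_cast numRearr_le a) ((Finset.abs_sum_le_sum_abs _ _).trans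
        (Finset.sum_le_sum fun j _ => he _)) (abs_nonneg _) (by positivity)
    · rw [abs_mul]
  refine (Finset.sum_le_sum fun a _ => hbd a).trans ?_
  rw [Finset.sum_add_distrib, Finset.sum_add_distrib, ← Finset.mul_sum, ← Finset.sum_mul]
  simp only [← Finset.sum_mul, Finset.sum_const, Finset.card_univ, nsmul_eq_mul]
  refine add_le_add (add_le_add ?_ ?_) le_rfl
  · have h3 : ∑ a : Sorted k N, ∑ j : Fin k → Fin N, (if ¬ Function.Injective (Fin.append a.1 j) then (1 : ℝ) else 0)
        ≤ numDegenerate (k + k) N := by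
      rw [← Fintype.sum_prod_type' (f := fun (a : Sorted k N) (j : Fin k → Fin N) =>
        if ¬ Function.Injective (Fin.append a.1 j) then (1 : ℝ) else 0), Finset.sum_boole]
      have h4 : (Finset.univ.filter fun p : Sorted k N × (Fin k → Fin N) =>
          ¬ Function.Injective (Fin.append p.1.1 p.2)).card ≤ numDegenerate (k + k) N := by
        refine Finset.card_le_card_of_injOn (fun p => Fin.append p.1.1 p.2)
          (fun p hp => by simpa using hp) ?_
        rintro ⟨a, j⟩ _ ⟨b, l⟩ _ hh
        have h5 : a.1 = b.1 := by
          ext i; simpa using congrArg Fin.val (congrFun hh (Fin.castAdd k i))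
        have h6 : j = l := by
          funext i
          have := congrFun hh (Fin.natAdd k i)
          simpa only [Fin.append_right] using this
        rw [Subtype.ext h5, h6]
      exact_mod_cast h4
    have h7 : 0 ≤ C' := by positivity
    calc _ ≤ k.factorial * ((numDegenerate (k + k) N : ℝ) * (C' * m 2)) := by gcongr
      _ = _ := by ring
  · exact mul_le_mul_of_nonneg_right (sum_abs_numRearr_sub_le k N) (abs_nonneg _)

end Fixed

section Limit

theorem tendsto_numDegenerate (n : ℕ) :
    Tendsto (fun N : ℕ => (numDegenerate n N : ℝ) / (N : ℝ) ^ n) atTop (𝓝 0) := by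
  refine squeeze_zero' (Eventually.of_forall fun N => by positivity) ?_
    (tendsto_const_div_atTop_nhds_zero_nat ((n : ℝ) ^ 2))
  filter_upwards [eventually_gt_atTop 0] with N hN
  have hN' : (0 : ℝ) < N := by exact_mod_cast hN
  rw [div_le_div_iff₀ (by positivity) hN']
  exact_mod_cast card_not_injective_mul_le n N

theorem tendsto_card_sorted (k : ℕ) :
    Tendsto (fun N : ℕ => (Fintype.card (Sorted k N) : ℝ) / (N : ℝ) ^ k) atTop
      (𝓝 (1 / k.factorial)) := by
  refine tendsto_iff_norm_sub_tendsto_zero.2 ?_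
  refine squeeze_zero' (Eventually.of_forall fun N => norm_nonneg _) ?_ (tendsto_numDegenerate k)
  filter_upwards [eventually_gt_atTop 0] with N hN
  have hN' : (0 : ℝ) < (N : ℝ) ^ k := by positivity
  rw [Real.norm_eq_abs, le_div_iff₀ hN', ← abs_of_pos hN', ← abs_mul, abs_of_pos hN', sub_mul,
    div_mul_cancel₀ _ hN'.ne', one_div_mul_eq_div]
  exact abs_card_sub_le k N

variable {k : ℕ} {Ω : ℕ → Type*} [∀ N, MeasurableSpace (Ω N)] {P : ∀ N, Measure (Ω N)}
  [∀ N, IsProbabilityMeasure (P N)] {M : ∀ N, Ω N → Tensor k N} {m : ℕ → ℕ → ℝ}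

theorem tendsto_trace_altWord (h : ∀ N, CenteredTensor (P N) (M N) (m N)) (hk : 1 ≤ k)
    (χ : Equiv.Perm (Fin (k + k)) →* ℤˣ) {s c : ℝ} (hc : 0 < c)
    (hs : s ^ 2 * ((k + k).factorial * k.factorial * c) = 1)
    (h2 : Tendsto (fun N : ℕ => (N : ℝ) ^ k * m N 2) atTop (𝓝 c))
    (h3 : ∀ n, 3 ≤ n → Tendsto (fun N : ℕ => (N : ℝ) ^ k * m N n) atTop (𝓝 0))
    {d : ℕ → ℕ → ℝ} (hd00 : d 0 0 = 1) (hds0 : ∀ s, d (s + 1) 0 = 0)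
    (hd0 : ∀ r, d 0 (r + 1) = d 1 r)
    (hd : ∀ s r, d (s + 1) (r + 1) = d (s + 2) r + d s r) (r : ℕ) :
    Tendsto (fun N : ℕ => ((N : ℂ) ^ k)⁻¹ *
        ∫ ω, (altWord (s • symMat χ (M N ω)) true (r + 1)).trace ∂(P N)) atTop
      (𝓝 ((1 / k.factorial * d 0 (r + 1) : ℝ) : ℂ)) := by
  let b : ℕ → ℕ → ℝ := fun n N =>
    |k.factorial * s * (k + k).factorial| ^ n * ((N : ℝ) ^ k * m N n)
  have hb3 : ∀ n, 3 ≤ n → Tendsto (b n) atTop (𝓝 0) := fun n hn => by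
    have := (h3 n hn).const_mul (|k.factorial * s * (k + k).factorial| ^ n)
    rwa [mul_zero] at this
  have hb2 := h2.const_mul (|k.factorial * s * (k + k).factorial| ^ 2)
  have hb : ∀ n, 2 ≤ n → ∀ (N : ℕ) (ℓ : Sorted (k + k) N),
      (N : ℝ) ^ k * ∫ ω, ‖redVar χ s ℓ (M N ω)‖ ^ n ∂(P N) ≤ b n N := by
    intro n hn N ℓ
    obtain ⟨n, rfl⟩ : ∃ n', n = n' + 1 := ⟨n - 1, by omega⟩
    have e1 := (h N).integral_norm_symT_pow_le (χ := χ) ℓ.1 n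
    simp only [b, redVar, norm_mul, mul_pow, integral_const_mul, Complex.norm_real,
      Real.norm_eq_abs, abs_mul, Nat.abs_cast]
    calc _ ≤ (N : ℝ) ^ k * ((k.factorial : ℝ) ^ (n + 1) * |s| ^ (n + 1) *
          (((k + k).factorial : ℝ) ^ (n + 1) * m N (n + 1))) := by gcongr
      _ = _ := by ring
  have hD : Tendsto (fun N : ℕ => (N : ℝ) ^ k) atTop atTop :=
    (tendsto_pow_atTop (by omega)).comp tendsto_natCast_atTop_atTop
  have hθ : Tendsto (fun N : ℕ => (N : ℝ) ^ k * m N 2 / c) atTop (𝓝 1) := by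
    simpa [hc.ne'] using h2.div_const c
  have hrow : Tendsto (fun N : ℕ => (∑ a, |LabelledModel.rowVar (P N) tupleLabel (redCoef χ)
      (fun ℓ ω => redVar χ s ℓ (M N ω)) a - 1|) / (N : ℝ) ^ k) atTop (𝓝 0) := by
    set C' := k.factorial * (s ^ 2 * (k + k).factorial ^ 2 + (k.factorial * c)⁻¹) with hC'
    have e1 := (((h2.const_mul C').mul (tendsto_numDegenerate (k + k))).add
      ((tendsto_numDegenerate k).mul hθ.abs)).add
      ((tendsto_card_sorted k).mul (hθ.sub_const 1).abs)
    simp only [mul_zero, zero_mul, sub_self, abs_zero, add_zero] at e1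
    refine squeeze_zero' (Eventually.of_forall fun N => by positivity) ?_ e1
    filter_upwards [eventually_gt_atTop 0] with N hN
    have hN' : (0 : ℝ) < (N : ℝ) ^ k := by positivity
    rw [div_le_iff₀ hN']
    refine ((h N).sum_abs_rowVar_sub_le χ hs hc).trans (le_of_eq ?_)
    rw [hC', pow_add]
    field_simp
  have key := LabelledModel.tendsto_pathSum (fun N => (h N).labelledModel χ s) hD
    (tendsto_card_sorted k) hb (hb2.eventually_le_const (lt_add_one _)) hb3 hrow hd00 hds0 hd0 hd
    (r + 1) 0
  refine key.congr fun N => ?_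
  rw [← ((h N).labelledModel χ s).integral_trace_altWord]
  simp only [trace_altWord_smul_symMat]
  push_cast
  rfl

end Limit

end CenteredTensor

/-! ### Moments of the semicircular and Marchenko-Pastur laws -/

theorem integral_semicircle_eq_setIntegral (f : ℝ → ℝ) :
    ∫ x, f x ∂semicircle = ∫ x in Set.Ioo (-2 : ℝ) 2, √(4 - x ^ 2) / (2 * Real.pi) * f x := by
  have hm : Measurable fun x : ℝ => ENNReal.ofReal
      ((Set.Ioo (-2 : ℝ) 2).indicator (fun x => √(4 - x ^ 2) / (2 * Real.pi)) x) :=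
    (Measurable.indicator (by fun_prop) measurableSet_Ioo).ennreal_ofReal
  rw [semicircle, integral_withDensity_eq_integral_toReal_smul hm
    (Eventually.of_forall fun _ => ENNReal.ofReal_lt_top), ← integral_indicator measurableSet_Ioo]
  congr 1; ext x
  by_cases hx : x ∈ Set.Ioo (-2 : ℝ) 2
  · rw [Set.indicator_of_mem hx, Set.indicator_of_mem hx,
      ENNReal.toReal_ofReal (by positivity), smul_eq_mul]
  · rw [Set.indicator_of_notMem hx, Set.indicator_of_notMem hx]
    simp

theorem integral_marchenkoPastur_eq_setIntegral (f : ℝ → ℝ) :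
    ∫ x, f x ∂marchenkoPastur
      = ∫ x in Set.Ioo (0 : ℝ) 4, √((4 - x) * x) / (2 * Real.pi * x) * f x := by
  have hm : Measurable fun x : ℝ => ENNReal.ofReal
      ((Set.Ioo (0 : ℝ) 4).indicator (fun x => √((4 - x) * x) / (2 * Real.pi * x)) x) :=
    (Measurable.indicator (by fun_prop) measurableSet_Ioo).ennreal_ofReal
  rw [marchenkoPastur, integral_withDensity_eq_integral_toReal_smul hm
    (Eventually.of_forall fun _ => ENNReal.ofReal_lt_top), ← integral_indicator measurableSet_Ioo]
  congr 1; ext x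
  by_cases hx : x ∈ Set.Ioo (0 : ℝ) 4
  · have hx0 := hx.1
    rw [Set.indicator_of_mem hx, Set.indicator_of_mem hx,
      ENNReal.toReal_ofReal (by positivity), smul_eq_mul]
  · rw [Set.indicator_of_notMem hx, Set.indicator_of_notMem hx]
    simp

theorem integral_semicircle {f : ℝ → ℝ} (hf : Continuous f) :
    ∫ x, f x ∂semicircle
      = 2 / Real.pi * ∫ θ in (0 : ℝ)..Real.pi, f (2 * Real.cos θ) * Real.sin θ ^ 2 := by
  rw [integral_semicircle_eq_setIntegral, ← integral_Ioc_eq_integral_Ioo,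
    ← intervalIntegral.integral_of_le (by norm_num : (-2 : ℝ) ≤ 2)]
  have h1 := intervalIntegral.integral_comp_mul_deriv (a := 0) (b := Real.pi)
    (f := fun θ => 2 * Real.cos θ) (f' := fun θ => 2 * -Real.sin θ)
    (g := fun x => √(4 - x ^ 2) / (2 * Real.pi) * f x)
    (fun θ _ => (Real.hasDerivAt_cos θ).const_mul 2) (by fun_prop) (by fun_prop)
  simp only [Real.cos_zero, Real.cos_pi, mul_one, mul_neg] at h1
  rw [intervalIntegral.integral_symm, ← h1, ← intervalIntegral.integral_neg,
    ← intervalIntegral.integral_const_mul]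
  refine intervalIntegral.integral_congr fun θ hθ => ?_
  rw [Set.uIcc_of_le Real.pi_pos.le] at hθ
  have hs := Real.sin_nonneg_of_nonneg_of_le_pi hθ.1 hθ.2
  have h2 : √(4 - (2 * Real.cos θ) ^ 2) = 2 * Real.sin θ := by
    rw [show 4 - (2 * Real.cos θ) ^ 2 = (2 * Real.sin θ) ^ 2 by
      nlinarith [Real.sin_sq_add_cos_sq θ], Real.sqrt_sq (by positivity)]
  simp only [Function.comp, h2]
  have := Real.pi_ne_zero
  field_simp

/-- Substitute the square on (0, 2), then use that the semicircular density is even. -/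
theorem integral_marchenkoPastur {f : ℝ → ℝ} (hf : Continuous f) :
    ∫ x, f x ∂marchenkoPastur = ∫ x, f (x ^ 2) ∂semicircle := by
  rw [integral_semicircle_eq_setIntegral, integral_marchenkoPastur_eq_setIntegral]
  have himg : (fun x : ℝ => x ^ 2) '' Set.Ioo 0 2 = Set.Ioo 0 4 := by
    ext y
    simp only [Set.mem_image, Set.mem_Ioo]
    constructor
    · rintro ⟨x, ⟨h0, h2⟩, rfl⟩
      constructor <;> nlinarith
    · rintro ⟨h0, h4⟩
      refine ⟨√y, ⟨Real.sqrt_pos.2 h0, ?_⟩, Real.sq_sqrt h0.le⟩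
      rw [Real.sqrt_lt' (by norm_num)]
      linarith
  have hinj : Set.InjOn (fun x : ℝ => x ^ 2) (Set.Ioo 0 2) := fun x hx y hy h =>
    (pow_left_inj₀ hx.1.le hy.1.le two_ne_zero).1 h
  have h1 := integral_image_eq_integral_abs_deriv_smul (s := Set.Ioo (0 : ℝ) 2)
    (f := fun x => x ^ 2) (f' := fun x => 2 * x) measurableSet_Ioo
    (fun x _ => by simpa using (hasDerivAt_pow 2 x).hasDerivWithinAt) hinj
    fun x => √((4 - x) * x) / (2 * Real.pi * x) * f x
  rw [himg] at h1
  rw [h1]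
  have h2 : ∫ x in Set.Ioo (0 : ℝ) 2, |2 * x| •
      (√((4 - x ^ 2) * x ^ 2) / (2 * Real.pi * x ^ 2) * f (x ^ 2))
      = ∫ x in Set.Ioo (0 : ℝ) 2, 2 * (√(4 - x ^ 2) / (2 * Real.pi) * f (x ^ 2)) := by
    refine setIntegral_congr_fun measurableSet_Ioo fun x hx => ?_
    have hx0 := hx.1
    simp only [smul_eq_mul]
    rw [abs_of_pos (by positivity), Real.sqrt_mul' _ (sq_nonneg x), Real.sqrt_sq hx0.le]
    have := Real.pi_ne_zero
    field_simp
  rw [h2, integral_const_mul]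
  set g : ℝ → ℝ := fun x => √(4 - x ^ 2) / (2 * Real.pi) * f (x ^ 2) with hg
  have hgc : Continuous g := by fun_prop
  change 2 * ∫ x in Set.Ioo 0 2, g x = ∫ x in Set.Ioo (-2) 2, g x
  rw [← integral_Ioc_eq_integral_Ioo, ← integral_Ioc_eq_integral_Ioo,
    ← intervalIntegral.integral_of_le (by norm_num : (0 : ℝ) ≤ 2),
    ← intervalIntegral.integral_of_le (by norm_num : (-2 : ℝ) ≤ 2),
    ← intervalIntegral.integral_add_adjacent_intervals (a := -2) (b := 0) (c := 2) (hgc.intervalIntegrable _ _)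
      (hgc.intervalIntegrable _ _)]
  have h3 := intervalIntegral.integral_comp_neg (a := 0) (b := 2) g
  rw [neg_zero] at h3
  rw [← h3, two_mul]
  congr 1
  exact intervalIntegral.integral_congr fun x _ => by simp [hg]

/-- The moments of the semicircular law against the rescaled Chebyshev polynomials. -/
def chebMoment (s r : ℕ) : ℝ :=
  ∫ x, x ^ r * (Polynomial.Chebyshev.S ℝ s).eval x ∂semicircle

/-- With x = 2 cos θ, S_s(x) sin θ = sin((s+1)θ), so the integrand is half the difference of cos(sθ)
and cos((s+2)θ). -/
theorem chebMoment_zero_right (s : ℕ) : chebMoment s 0 = if s = 0 then 1 else 0 := by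
  unfold chebMoment
  simp only [pow_zero, one_mul]
  rw [integral_semicircle (Polynomial.continuous _)]
  have h1 : ∀ θ : ℝ, (Polynomial.Chebyshev.S ℝ s).eval (2 * Real.cos θ) * Real.sin θ ^ 2
      = (Real.cos (s * θ) - Real.cos ((s + 2 : ℕ) * θ)) / 2 := by
    intro θ
    have := Polynomial.Chebyshev.S_two_mul_real_cos θ s
    rw [sq, ← mul_assoc, this, Real.cos_sub_cos]
    rw [show (s * θ + ((s + 2 : ℕ) : ℝ) * θ) / 2 = (s + 1) * θ by push_cast; ring,
      show (s * θ - ((s + 2 : ℕ) : ℝ) * θ) / 2 = -θ by push_cast; ring, Real.sin_neg]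
    push_cast
    ring
  have h2 : ∀ n : ℕ, ∫ θ in (0 : ℝ)..Real.pi, Real.cos (n * θ) = if n = 0 then Real.pi else 0 := by
    intro n
    split_ifs with hn
    · simp [hn]
    · have hn' : (n : ℝ) ≠ 0 := by exact_mod_cast hn
      rw [intervalIntegral.integral_comp_mul_left (fun x => Real.cos x) hn', integral_cos]
      simp [Real.sin_nat_mul_pi]
  simp only [h1]
  rw [intervalIntegral.integral_div, intervalIntegral.integral_sub
    (Continuous.intervalIntegrable (by fun_prop) _ _)
    (Continuous.intervalIntegrable (by fun_prop) _ _), h2, h2]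
  have := Real.pi_ne_zero
  rw [if_neg (by omega : s + 2 ≠ 0)]
  split_ifs
  · field_simp
    ring
  · simp

theorem isProbabilityMeasure_of_integral_one {α : Type*} [MeasurableSpace α] {μ : Measure α}
    (h : ∫ _, (1 : ℝ) ∂μ = 1) : IsProbabilityMeasure μ := by
  rw [integral_const, smul_eq_mul, mul_one] at h
  refine ⟨?_⟩
  rw [← ENNReal.toReal_eq_one_iff]
  exact h

instance isProbabilityMeasure_semicircle : IsProbabilityMeasure semicircle :=
  isProbabilityMeasure_of_integral_one (by
    simpa [chebMoment] using chebMoment_zero_right 0)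

instance isProbabilityMeasure_marchenkoPastur : IsProbabilityMeasure marchenkoPastur :=
  isProbabilityMeasure_of_integral_one (by
    rw [integral_marchenkoPastur continuous_const]; simp)

theorem semicircle_compl : semicircle (Set.Icc (-4) 4)ᶜ = 0 := by
  rw [semicircle, withDensity_apply _ measurableSet_Icc.compl]
  refine setLIntegral_eq_zero measurableSet_Icc.compl fun x hx => ?_
  rw [Set.indicator_of_notMem fun h => hx ⟨by linarith [h.1], by linarith [h.2]⟩]
  simp

theorem marchenkoPastur_compl : marchenkoPastur (Set.Icc (-4) 4)ᶜ = 0 := by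
  rw [marchenkoPastur, withDensity_apply _ measurableSet_Icc.compl]
  refine setLIntegral_eq_zero measurableSet_Icc.compl fun x hx => ?_
  rw [Set.indicator_of_notMem fun h => hx ⟨by linarith [h.1], by linarith [h.2]⟩]
  simp

theorem integrable_of_compl_eq_zero {μ : Measure ℝ} [IsFiniteMeasure μ] {R : ℝ}
    (hμ : μ (Set.Icc (-R) R)ᶜ = 0) {f : ℝ → ℝ} (hf : Continuous f) : Integrable f μ := by
  rw [← Measure.restrict_eq_self_of_ae_mem (s := Set.Icc (-R) R) (μ := μ) hμ]
  exact hf.continuousOn.integrableOn_compact isCompact_Icc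

theorem chebMoment_zero_succ (r : ℕ) : chebMoment 0 (r + 1) = chebMoment 1 r := by
  simp [chebMoment, pow_succ]

theorem chebMoment_succ_succ (s r : ℕ) :
    chebMoment (s + 1) (r + 1) = chebMoment (s + 2) r + chebMoment s r := by
  unfold chebMoment
  rw [← integral_add (integrable_of_compl_eq_zero semicircle_compl (by fun_prop))
    (integrable_of_compl_eq_zero semicircle_compl (by fun_prop))]
  congr 1; ext x
  have h := Polynomial.Chebyshev.S_add_two ℝ (s : ℤ)
  push_cast
  rw [h]
  simp only [Polynomial.eval_sub, Polynomial.eval_mul, Polynomial.eval_X]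
  ring

theorem chebMoment_zero_left (r : ℕ) : chebMoment 0 r = ∫ x, x ^ r ∂semicircle := by
  simp [chebMoment]

/-! ### Dilutions -/

section Dilution

variable {p : ℝ} {ν : Measure ℝ} [IsProbabilityMeasure ν]

instance isFiniteMeasure_dilution : IsFiniteMeasure (dilution p ν) := by
  unfold dilution
  have h1 : IsFiniteMeasure (ENNReal.ofReal (1 - p) • (Measure.dirac (0 : ℝ))) :=
    Measure.smul_finite _ ENNReal.ofReal_ne_top
  have h2 : IsFiniteMeasure (ENNReal.ofReal p • ν) := Measure.smul_finite _ ENNReal.ofReal_ne_top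
  infer_instance

theorem dilution_compl {R : ℝ} (hR : 0 ≤ R) (hν : ν (Set.Icc (-R) R)ᶜ = 0) :
    dilution p ν (Set.Icc (-R) R)ᶜ = 0 := by
  simp [dilution, hν, hR]

theorem integral_pow_dilution {R : ℝ} (hν : ν (Set.Icc (-R) R)ᶜ = 0)
    (h0 : 0 ≤ p) (h1 : p ≤ 1) (r : ℕ) :
    ∫ x, x ^ r ∂(dilution p ν) = if r = 0 then 1 else p * ∫ x, x ^ r ∂ν := by
  have hi : Integrable (fun x : ℝ => x ^ r) ν := integrable_of_compl_eq_zero hν (by fun_prop)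
  rw [dilution, integral_add_measure ((integrable_dirac (by simp)).smul_measure ENNReal.ofReal_ne_top)
    (hi.smul_measure ENNReal.ofReal_ne_top), integral_smul_measure, integral_smul_measure,
    integral_dirac, ENNReal.toReal_ofReal h0, ENNReal.toReal_ofReal (by linarith)]
  split_ifs with h
  · simp [h]
  · simp [h]

end Dilution

/-! ### The method of moments -/

section MethodOfMoments

theorem integrable_polynomial_eval {ν : Measure ℝ} (h : ∀ r : ℕ, Integrable (fun x : ℝ => x ^ r) ν)
    (q : Polynomial ℝ) : Integrable (fun x => q.eval x) ν := by
  simp only [Polynomial.eval_eq_sum_range]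
  exact integrable_finsetSum _ fun i _ => (h i).const_mul _

theorem integral_polynomial_eval {ν : Measure ℝ} (h : ∀ r : ℕ, Integrable (fun x : ℝ => x ^ r) ν)
    (q : Polynomial ℝ) :
    ∫ x, q.eval x ∂ν = ∑ i ∈ Finset.range (q.natDegree + 1), q.coeff i * ∫ x, x ^ i ∂ν := by
  simp only [Polynomial.eval_eq_sum_range]
  rw [integral_finsetSum _ fun i _ => (h i).const_mul _]
  simp only [integral_const_mul]

/-- Weierstrass approximation on [-K, K]. Outside, |x| > K ≥ 1 and f - q grows at most like |x|^d,
which (x/K)^(2m) dominates when d ≤ 2m. The constant A does not depend on m, so m can be chosen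
afterwards. -/
theorem exists_polynomial_bound {f : ℝ → ℝ} (hf : Continuous f) {B : ℝ} (hB : ∀ x, |f x| ≤ B)
    {K ε : ℝ} (hK : 1 ≤ K) (hε : 0 < ε) : ∃ q : Polynomial ℝ, ∃ A : ℝ, 0 ≤ A ∧
      ∀ m, q.natDegree ≤ 2 * m → ∀ x, |f x - q.eval x| ≤ ε + A * (x / K) ^ (2 * m) := by
  obtain ⟨q, hq⟩ := exists_polynomial_near_of_continuousOn (-K) K f hf.continuousOn ε hε
  have hB0 : 0 ≤ B := (abs_nonneg _).trans (hB 0)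
  set d := q.natDegree with hd
  set C := ∑ i ∈ Finset.range (d + 1), |q.coeff i| with hC
  have hC0 : 0 ≤ C := Finset.sum_nonneg fun _ _ => abs_nonneg _
  have hK0 : 0 < K := by linarith
  refine ⟨q, (B + C) * K ^ d, by positivity, fun m hm x => ?_⟩
  have hpow : 0 ≤ (x / K) ^ (2 * m) := by rw [pow_mul]; positivity
  by_cases hx : x ∈ Set.Icc (-K) K
  · rw [abs_sub_comm]
    have h1 : 0 ≤ (B + C) * K ^ d * (x / K) ^ (2 * m) := mul_nonneg (by positivity) hpow
    linarith [(hq x hx).le]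
  · have hx' : K < |x| := by
      by_contra h
      exact hx (abs_le.1 (not_lt.1 h))
    have hx1 : 1 ≤ |x| := by linarith
    have h2 : |q.eval x| ≤ C * |x| ^ d := by
      rw [Polynomial.eval_eq_sum_range, hC, Finset.sum_mul]
      refine (Finset.abs_sum_le_sum_abs _ _).trans (Finset.sum_le_sum fun i hi => ?_)
      rw [abs_mul, abs_pow]
      exact mul_le_mul_of_nonneg_left
        (pow_le_pow_right₀ hx1 (by simpa [Nat.lt_succ_iff] using hi)) (abs_nonneg _)
    have h3 : |f x| ≤ B * |x| ^ d :=
      (hB x).trans (le_mul_of_one_le_right hB0 (one_le_pow₀ hx1))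
    have h4 : |x| ^ d ≤ K ^ d * (x / K) ^ (2 * m) := by
      have h5 : 1 ≤ |x| / K := by rw [one_le_div hK0]; exact hx'.le
      have h6 : (x / K) ^ (2 * m) = (|x| / K) ^ (2 * m) := by
        rw [pow_mul, pow_mul, div_pow x K 2, div_pow |x| K 2, sq_abs]
      rw [h6]
      calc |x| ^ d = K ^ d * (|x| / K) ^ d := by rw [← mul_pow, mul_div_cancel₀ _ hK0.ne']
        _ ≤ _ := by gcongr
    calc |f x - q.eval x| ≤ |f x| + |q.eval x| := abs_sub _ _
      _ ≤ (B + C) * |x| ^ d := by linarith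
      _ ≤ (B + C) * (K ^ d * (x / K) ^ (2 * m)) := by gcongr
      _ ≤ ε + (B + C) * K ^ d * (x / K) ^ (2 * m) := by rw [← mul_assoc]; linarith

/-- Replacing f by q costs the integral of a polynomial majorant, which converges by hypothesis. The
limit lives on [-R, R] and K = R + 1, so the tail part of the majorant integrates to at most A m₀
(R/K)^(2m), small for large m. No separate tightness argument is needed. -/
theorem convergesWeakly_of_moments {ν : ℕ → Measure ℝ} {ν' : Measure ℝ} [IsFiniteMeasure ν']
    (hν : ∀ᶠ N in atTop, ∀ r : ℕ, Integrable (fun x : ℝ => x ^ r) (ν N)) {R : ℝ} (hR : 0 ≤ R)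
    (hν' : ν' (Set.Icc (-R) R)ᶜ = 0)
    (hmom : ∀ r : ℕ, Tendsto (fun N => ∫ x, x ^ r ∂(ν N)) atTop (𝓝 (∫ x, x ^ r ∂ν'))) :
    ConvergesWeakly ν ν' := by
  intro f
  have hi' : ∀ r : ℕ, Integrable (fun x : ℝ => x ^ r) ν' := fun r =>
    integrable_of_compl_eq_zero hν' (by fun_prop)
  have hpoly : ∀ q : Polynomial ℝ,
      Tendsto (fun N => ∫ x, q.eval x ∂(ν N)) atTop (𝓝 (∫ x, q.eval x ∂ν')) := by
    intro q
    rw [integral_polynomial_eval hi']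
    refine (tendsto_finsetSum _ fun i _ => (hmom i).const_mul (q.coeff i)).congr' ?_
    filter_upwards [hν] with N hN
    rw [integral_polynomial_eval hN]
  set m₀ := ν'.real Set.univ with hm₀
  have hm₀0 : 0 ≤ m₀ := measureReal_nonneg
  set K := R + 1 with hK
  have hK0 : 0 < K := by linarith
  rw [Metric.tendsto_atTop']
  intro η hη
  -- Two majorants cost (m₀ + 1) ε each, the convergence of the majorant ε and that of the integral
  -- of q another ε; the last ε is slack.
  set ε := η / (2 * (m₀ + 1) + 3) with hε
  have hε0 : 0 < ε := by positivity
  obtain ⟨q, A, hA, hq⟩ := exists_polynomial_bound f.continuous (B := ‖f‖)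
    (fun x => f.norm_coe_le_norm x) (by linarith : 1 ≤ K) hε0
  have hRK : Tendsto (fun m : ℕ => A * m₀ * ((R / K) ^ 2) ^ m) atTop (𝓝 0) := by
    have h1 : (R / K) ^ 2 < 1 := by
      have : R / K < 1 := by rw [div_lt_one hK0]; linarith
      have : 0 ≤ R / K := by positivity
      nlinarith
    simpa using (tendsto_pow_atTop_nhds_zero_of_lt_one (sq_nonneg _) h1).const_mul (A * m₀)
  obtain ⟨m, hmε, hmd⟩ := ((hRK.eventually_lt_const hε0).and
    (eventually_ge_atTop q.natDegree)).exists
  let E : Measure ℝ → ℝ := fun ρ => ∫ x, (Polynomial.C ε + Polynomial.C (A / K ^ (2 * m)) *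
    Polynomial.X ^ (2 * m)).eval x ∂ρ
  have hE : ∀ ρ : Measure ℝ, (∀ r : ℕ, Integrable (fun x : ℝ => x ^ r) ρ) →
      |∫ x, f x ∂ρ - ∫ x, q.eval x ∂ρ| ≤ E ρ := by
    intro ρ hρ
    have : IsFiniteMeasure ρ := by
      have := hρ 0
      simp only [pow_zero] at this
      rcases (integrable_const_iff).1 this with h | h
      · norm_num at h
      · exact h
    rw [← integral_sub (f.integrable ρ) (integrable_polynomial_eval hρ q)]
    refine (abs_integral_le_integral_abs).trans (integral_mono
      ((f.integrable ρ).sub (integrable_polynomial_eval hρ q)).abs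
      (integrable_polynomial_eval hρ _) fun x => ?_)
    refine (hq m (by omega) x).trans (le_of_eq ?_)
    simp [div_pow]
    ring
  have hE' : E ν' ≤ (m₀ + 1) * ε := by
    have h1 : E ν' = m₀ * ε + A / K ^ (2 * m) * ∫ x, x ^ (2 * m) ∂ν' := by
      simp only [E, Polynomial.eval_add, Polynomial.eval_mul, Polynomial.eval_C,
        Polynomial.eval_pow, Polynomial.eval_X]
      rw [integral_add (integrable_const _) ((hi' _).const_mul _), integral_const_mul]
      simp [hm₀]
    have h2 : ∫ x, x ^ (2 * m) ∂ν' ≤ m₀ * R ^ (2 * m) := by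
      have h3 : ∀ᵐ x ∂ν', x ^ (2 * m) ≤ R ^ (2 * m) := by
        filter_upwards [show ∀ᵐ x ∂ν', x ∈ Set.Icc (-R) R from hν'] with x hx
        rw [← (even_two_mul m).pow_abs]
        exact pow_le_pow_left₀ (abs_nonneg _) (abs_le.2 hx) _
      refine (integral_mono_ae (hi' _) (integrable_const _) h3).trans (le_of_eq ?_)
      simp [hm₀]
    have h4 : A / K ^ (2 * m) * (m₀ * R ^ (2 * m)) = A * m₀ * ((R / K) ^ 2) ^ m := by
      rw [← pow_mul, div_pow]; ring
    have h5 := mul_le_mul_of_nonneg_left h2 (by positivity : 0 ≤ A / K ^ (2 * m))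
    rw [h1]
    linarith
  have hlim := hpoly (Polynomial.C ε + Polynomial.C (A / K ^ (2 * m)) * Polynomial.X ^ (2 * m))
  have hq' := (hpoly q).eventually (Metric.ball_mem_nhds _ hε0)
  have hfin : ∀ᶠ N in atTop, dist (∫ x, f x ∂(ν N)) (∫ x, f x ∂ν') < η := by
    filter_upwards [hν, hlim.eventually_lt_const (lt_add_of_pos_right _ hε0), hq'] with N h1 h2 h3
    have h4 := hE _ h1
    have h5 := hE _ hi'
    rw [Real.dist_eq] at h3
    rw [Real.dist_eq]
    have h6 : η = (2 * (m₀ + 1) + 3) * ε := by rw [hε]; field_simp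
    have h7 : E (ν N) < E ν' + ε := h2
    rw [abs_le] at h4 h5
    rw [abs_lt] at h3 ⊢
    constructor <;> nlinarith [h4.1, h4.2, h5.1, h5.2, h3.1, h3.2]
  obtain ⟨N₀, hN₀⟩ := eventually_atTop.1 hfin
  exact ⟨N₀, fun n hn => hN₀ n hn.le⟩

end MethodOfMoments

/-! ### Averaged empirical eigenvalue distributions -/

section ESD

variable {n : Type*} [Fintype n] [DecidableEq n]

theorem trace_pow_eq_sum_eigenvalues {A : Matrix n n ℂ} (hA : A.IsHermitian) (r : ℕ) :
    (A ^ r).trace = ∑ i, ((hA.eigenvalues i ^ r : ℝ) : ℂ) := by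
  conv_lhs => rw [hA.spectral_theorem, ← map_pow, Unitary.conjStarAlgAut_apply,
    Matrix.trace_mul_comm, ← Matrix.mul_assoc]
  simp [Matrix.diagonal_pow, Matrix.trace_diagonal]

theorem integral_esd {A : Matrix n n ℂ} (hA : A.IsHermitian) (f : ℝ → ℝ) :
    ∫ x, f x ∂(esd A hA) = (Fintype.card n : ℝ)⁻¹ * ∑ i, f (hA.eigenvalues i) := by
  rw [esd, integral_smul_measure, integral_finsetSum_measure fun i _ => integrable_dirac (by simp)]
  simp

theorem integrable_esd [Nonempty n] {A : Matrix n n ℂ} (hA : A.IsHermitian) (f : ℝ → ℝ) :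
    Integrable f (esd A hA) := by
  rw [esd]
  refine Integrable.smul_measure ?_ (by simp)
  exact integrable_finsetSum_measure.2 fun i _ => integrable_dirac (by simp)

instance isProbabilityMeasure_esd [Nonempty n] {A : Matrix n n ℂ} (hA : A.IsHermitian) :
    IsProbabilityMeasure (esd A hA) := by
  refine isProbabilityMeasure_of_integral_one ?_
  rw [integral_esd]
  simp

theorem integral_pow_esd {A : Matrix n n ℂ} (hA : A.IsHermitian) (r : ℕ) :
    ∫ x, x ^ r ∂(esd A hA) = ((Fintype.card n : ℂ)⁻¹ * (A ^ r).trace).re := by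
  rw [integral_esd, trace_pow_eq_sum_eigenvalues hA, ← Complex.ofReal_sum, ← Complex.ofReal_natCast,
    ← Complex.ofReal_inv, ← Complex.ofReal_mul, Complex.ofReal_re]

variable {Ω : Type*} [MeasurableSpace Ω] {P : Measure Ω} [IsProbabilityMeasure P]
  {A : Ω → Matrix n n ℂ}

theorem allMoments_pow_apply (h : ∀ i j, AllMoments P fun ω => A ω i j) (r : ℕ) (i j : n) :
    AllMoments P fun ω => (A ω ^ r) i j := by
  induction r generalizing i j with
  | zero => simpa using AllMoments.const _
  | succ r ih =>
    simp only [pow_succ, Matrix.mul_apply]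
    exact AllMoments.sum _ fun l _ => (ih i l).mul (h l j)

theorem allMoments_trace_pow (h : ∀ i j, AllMoments P fun ω => A ω i j) (r : ℕ) :
    AllMoments P fun ω => (Fintype.card n : ℂ)⁻¹ * (A ω ^ r).trace :=
  (AllMoments.sum _ fun i _ => allMoments_pow_apply h r i i).const_mul _

/-- Polynomial integrals are combinations of traces of powers. For each ω the eigenvalues are
finitely many, so approximations on [-m, m] eventually control them all. -/
theorem measurable_integral_esd [Nonempty n] (h : ∀ i j, AllMoments P fun ω => A ω i j)
    (hA : ∀ ω, (A ω).IsHermitian) {f : ℝ → ℝ} (hf : Continuous f) :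
    Measurable fun ω => ∫ x, f x ∂(esd (A ω) (hA ω)) := by
  have hp : ∀ q : Polynomial ℝ, Measurable fun ω => ∫ x, q.eval x ∂(esd (A ω) (hA ω)) := by
    intro q
    simp only [fun ω => integral_polynomial_eval (ν := esd (A ω) (hA ω))
      (fun r => integrable_esd _ _) q, integral_pow_esd]
    exact Finset.measurable_fun_sum _ fun i _ => Measurable.const_mul
      (Complex.measurable_re.comp (allMoments_trace_pow h i).measurable) _
  choose q hq using fun m : ℕ => exists_polynomial_near_of_continuousOn (-m) m f hf.continuousOn
    (1 / (m + 1 : ℝ)) (by positivity)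
  refine measurable_of_tendsto_metrizable (fun m => hp (q m)) (tendsto_pi_nhds.2 fun ω => ?_)
  simp only [integral_esd]
  refine Tendsto.const_mul _ (tendsto_finsetSum _ fun i _ => ?_)
  refine tendsto_iff_norm_sub_tendsto_zero.2 (squeeze_zero' (Eventually.of_forall fun _ =>
    norm_nonneg _) ?_ tendsto_one_div_add_atTop_nhds_zero_nat)
  obtain ⟨m₀, hm₀⟩ := exists_nat_ge |(hA ω).eigenvalues i|
  filter_upwards [eventually_ge_atTop m₀] with m hm
  have h1 : |(hA ω).eigenvalues i| ≤ m := hm₀.trans (by exact_mod_cast hm)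
  exact (hq m _ (abs_le.1 h1)).le

/-- Needed for `P.bind` to be the genuine average. Closed sets form a generating π-system, and their
measures are limits of integrals of continuous functions. -/
theorem measurable_esd [Nonempty n] (h : ∀ i j, AllMoments P fun ω => A ω i j)
    (hA : ∀ ω, (A ω).IsHermitian) : Measurable fun ω => esd (A ω) (hA ω) := by
  refine Measurable.measure_of_isPiSystem_of_isProbabilityMeasure
    ((BorelSpace.measurable_eq (α := ℝ)).trans borel_eq_generateFrom_isClosed)
    isPiSystem_isClosed fun F hF => ?_
  have hF' : IsClosed F := hF
  have hδ : ∀ m : ℕ, (0 : ℝ) < 1 / (m + 1) := fun m => by positivity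
  refine measurable_of_tendsto_metrizable (fun m => ?_) (tendsto_pi_nhds.2 fun ω =>
    tendsto_lintegral_thickenedIndicator_of_isClosed (esd (A ω) (hA ω)) hF' hδ
      tendsto_one_div_add_atTop_nhds_zero_nat)
  have h1 := (measurable_integral_esd h hA (f := fun x => (thickenedIndicator (hδ m) F x : ℝ))
    (NNReal.continuous_coe.comp (thickenedIndicator (hδ m) F).continuous)).ennreal_ofReal
  convert h1 using 2 with ω
  rw [ofReal_integral_eq_lintegral_ofReal (integrable_esd _ _)
    (Eventually.of_forall fun x => NNReal.coe_nonneg _)]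
  simp

/-- The empirical eigenvalue distribution as a kernel. -/
def esdKernel [Nonempty n] (h : ∀ i j, AllMoments P fun ω => A ω i j)
    (hA : ∀ ω, (A ω).IsHermitian) : Kernel Ω ℝ :=
  ⟨fun ω => esd (A ω) (hA ω), measurable_esd h hA⟩

theorem integrable_pow_averagedESD [Nonempty n] (h : ∀ i j, AllMoments P fun ω => A ω i j)
    (hA : ∀ ω, (A ω).IsHermitian) (r : ℕ) :
    Integrable (fun x : ℝ => x ^ r) (averagedESD P A hA) := by
  change Integrable _ (P.bind (esdKernel h hA))
  rw [Measure.integrable_comp_iff (by fun_prop)]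
  refine ⟨Eventually.of_forall fun ω => integrable_esd _ _, ?_⟩
  refine Integrable.mono' (g := fun ω => 1 + ‖(Fintype.card n : ℂ)⁻¹ * (A ω ^ (2 * r)).trace‖)
    ((integrable_const _).add (allMoments_trace_pow h _).integrable.norm)
    (measurable_integral_esd h hA (f := fun x => ‖x ^ r‖) (by fun_prop)).aestronglyMeasurable
    (Eventually.of_forall fun ω => ?_)
  rw [Real.norm_of_nonneg (integral_nonneg fun _ => norm_nonneg _)]
  have h1 : ∫ x, ‖x ^ r‖ ∂(esdKernel h hA ω) ≤ ∫ x, (1 + x ^ (2 * r)) ∂(esd (A ω) (hA ω)) := by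
    refine integral_mono (integrable_esd (hA ω) _) (integrable_esd _ _) fun x => ?_
    simp only [norm_pow, Real.norm_eq_abs]
    rw [pow_mul', ← sq_abs (x ^ r), abs_pow]
    nlinarith [sq_nonneg (|x| ^ r - 1), sq_nonneg (|x| ^ r)]
  refine h1.trans ?_
  rw [integral_add (integrable_const _) (integrable_esd _ _), integral_pow_esd]
  simp only [integral_const, probReal_univ, smul_eq_mul, one_mul]
  gcongr
  exact Complex.re_le_norm _

theorem integral_pow_averagedESD [Nonempty n] (h : ∀ i j, AllMoments P fun ω => A ω i j)
    (hA : ∀ ω, (A ω).IsHermitian) (r : ℕ) :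
    ∫ x, x ^ r ∂(averagedESD P A hA)
      = (∫ ω, (Fintype.card n : ℂ)⁻¹ * (A ω ^ r).trace ∂P).re := by
  have h0 := integrable_pow_averagedESD h hA r
  change ∫ x, x ^ r ∂(P.bind (esdKernel h hA)) = _
  change Integrable _ (P.bind (esdKernel h hA)) at h0
  rw [Measure.comp_eq_comp_const_apply] at h0 ⊢
  rw [Kernel.integral_comp h0, Kernel.const_apply]
  rw [← RCLike.re_eq_complex_re, ← integral_re (allMoments_trace_pow h r).integrable]
  exact integral_congr_ae (Eventually.of_forall fun ω => integral_pow_esd (hA ω) r)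

end ESD

/-! ### The model -/

namespace IsTensorModel

variable {k : ℕ} {Ω : ℕ → Type*} [∀ N, MeasurableSpace (Ω N)] {P : ∀ N, Measure (Ω N)}
  [∀ N, IsProbabilityMeasure (P N)] {M : ∀ N, Ω N → Tensor k N} {μ : ℕ → Measure ℂ} {c : ℝ}
  {c' : ℂ}

theorem integral_entry (h : IsTensorModel k P M μ c c') {E : Type*} [NormedAddCommGroup E]
    [NormedSpace ℝ E] [SecondCountableTopology E] [MeasurableSpace E] [BorelSpace E] (N : ℕ)
    (x : Fin (k + k) → Fin N) {f : ℂ → E} (hf : Continuous f) :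
    ∫ ω, f (M N ω x) ∂(P N) = ∫ z, f z ∂(μ N) := by
  rw [← h.law N x, integral_map (h.measurable_entry N x).aemeasurable
    hf.measurable.aestronglyMeasurable]

theorem allMoments_entry (h : IsTensorModel k P M μ c c') (N : ℕ) (x : Fin (k + k) → Fin N) :
    AllMoments (P N) fun ω => M N ω x := by
  refine ⟨h.measurable_entry N x, fun n => ?_⟩
  have h1 := h.finite_moments N n
  rw [← h.law N x] at h1
  exact h1.comp_measurable (h.measurable_entry N x)

theorem centeredTensor (h : IsTensorModel k P M μ c c') (N : ℕ) :
    CenteredTensor (P N) (M N) fun n => ∫ z, ‖z‖ ^ n ∂(μ N) where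
  moments := h.allMoments_entry N
  indep := h.indep N
  centered x := (h.integral_entry N x continuous_id).trans (h.centered N)
  absMoment x n := h.integral_entry N x (f := fun z => ‖z‖ ^ n) (by fun_prop)

/-- The tensor with entries twice the real parts of the entries of `T`. -/
def _root_.Flattenings.twoRe {N : ℕ} (T : Tensor k N) : Tensor k N :=
  fun x => T x + starRingEnd ℂ (T x)

theorem centeredTensor_twoRe (h : IsTensorModel k P M μ c c') (N : ℕ) :
    CenteredTensor (P N) (fun ω => twoRe (M N ω)) fun n => ∫ z, ‖z + starRingEnd ℂ z‖ ^ n ∂(μ N)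
    where
  moments x := (h.allMoments_entry N x).add (h.allMoments_entry N x).conj
  indep := (h.indep N).comp (fun _ z => z + starRingEnd ℂ z) fun _ => by fun_prop
  centered x := by
    simp only [twoRe]
    rw [integral_add (h.allMoments_entry N x).integrable (h.allMoments_entry N x).conj.integrable,
      integral_conj, (h.centeredTensor N).centered x]
    simp
  absMoment x n := h.integral_entry N x (f := fun z => ‖z + starRingEnd ℂ z‖ ^ n) (by fun_prop)

theorem tendsto_even_absMoment (h : IsTensorModel k P M μ c c') {n : ℕ} (hn : 2 ≤ n) :
    Tendsto (fun N : ℕ => (N : ℝ) ^ k * ∫ z, ‖z‖ ^ (2 * n) ∂(μ N)) atTop (𝓝 0) := by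
  have h1 := (Complex.continuous_re.tendsto _).comp (h.tendsto_zero n n (by omega))
  refine h1.congr fun N => ?_
  have h2 : ∫ z, z ^ n * starRingEnd ℂ z ^ n ∂(μ N) = ((∫ z, ‖z‖ ^ (2 * n) ∂(μ N) : ℝ) : ℂ) := by
    rw [← integral_complex_ofReal]
    congr 1; ext z
    rw [← mul_pow, Complex.mul_conj', pow_mul]
    push_cast; rfl
  simp only [Function.comp_apply]
  rw [h2]
  norm_cast

/-- The assumptions control only even absolute moments directly. Odd ones follow from Cauchy-Schwarz
between orders 2 and 2(n - 1) ≥ 4, proved by the discriminant of a nonnegative quadratic in t. -/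
theorem tendsto_absMoment (h : IsTensorModel k P M μ c c') {n : ℕ} (hn : 3 ≤ n) :
    Tendsto (fun N : ℕ => (N : ℝ) ^ k * ∫ z, ‖z‖ ^ n ∂(μ N)) atTop (𝓝 0) := by
  have hle : ∀ N : ℕ, (∫ z, ‖z‖ ^ n ∂(μ N)) ^ 2
      ≤ (∫ z, ‖z‖ ^ 2 ∂(μ N)) * ∫ z, ‖z‖ ^ (2 * (n - 1)) ∂(μ N) := by
    intro N
    have h1 : ∀ t : ℝ, 0 ≤ (∫ z, ‖z‖ ^ 2 ∂(μ N)) * (t * t) + (-2 * ∫ z, ‖z‖ ^ n ∂(μ N)) * t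
        + ∫ z, ‖z‖ ^ (2 * (n - 1)) ∂(μ N) := by
      intro t
      have h2 : 0 ≤ ∫ z, (‖z‖ * t - ‖z‖ ^ (n - 1)) ^ 2 ∂(μ N) :=
        integral_nonneg fun _ => sq_nonneg _
      have h3 : ∀ z : ℂ, (‖z‖ * t - ‖z‖ ^ (n - 1)) ^ 2
          = ‖z‖ ^ 2 * (t * t) + ‖z‖ ^ n * (-2 * t) + ‖z‖ ^ (2 * (n - 1)) := by
        intro z
        obtain ⟨n, rfl⟩ : ∃ l, n = l + 1 := ⟨n - 1, by omega⟩
        simp only [Nat.add_sub_cancel]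
        ring
      simp only [h3] at h2
      have h4 : Integrable (fun z : ℂ => ‖z‖ ^ 2 * (t * t)) (μ N) :=
        (h.finite_moments N 2).mul_const _
      have h5 : Integrable (fun z : ℂ => ‖z‖ ^ n * (-2 * t)) (μ N) :=
        (h.finite_moments N n).mul_const _
      rw [integral_add (by exact h4.add h5) (h.finite_moments N _), integral_add h4 h5,
        integral_mul_const, integral_mul_const] at h2
      linarith
    have h4 := discrim_le_zero h1
    rw [discrim] at h4
    linarith
  have hlim := h.tendsto_c.mul (h.tendsto_even_absMoment (n := n - 1) (by omega))
  have hsq : Tendsto (fun N : ℕ => ((N : ℝ) ^ k * ∫ z, ‖z‖ ^ n ∂(μ N)) ^ 2) atTop (𝓝 0) := by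
    refine squeeze_zero (fun N => sq_nonneg _) (fun N => ?_) (by simpa using hlim)
    have := mul_le_mul_of_nonneg_left (hle N) (sq_nonneg ((N : ℝ) ^ k))
    linarith
  have h5 := (Real.continuous_sqrt.tendsto _).comp hsq
  rw [Real.sqrt_zero] at h5
  refine h5.congr fun N => ?_
  exact Real.sqrt_sq (mul_nonneg (by positivity) (integral_nonneg fun _ => by positivity))

theorem tendsto_twoRe_two (h : IsTensorModel k P M μ c c') :
    Tendsto (fun N : ℕ => (N : ℝ) ^ k * ∫ z, ‖z + starRingEnd ℂ z‖ ^ 2 ∂(μ N)) atTop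
      (𝓝 (2 * (c + c'.re))) := by
  have h1 := (h.tendsto_c.add ((Complex.continuous_re.tendsto _).comp h.tendsto_c')).const_mul 2
  refine h1.congr fun N => ?_
  have hi : Integrable (fun z : ℂ => z ^ 2) (μ N) :=
    (integrable_norm_iff (by fun_prop)).1 (by simpa using h.finite_moments N 2)
  have h2 : ∀ z : ℂ, ‖z + starRingEnd ℂ z‖ ^ 2 = 2 * (‖z‖ ^ 2 + (z ^ 2).re) := by
    intro z
    rw [Complex.add_conj, Complex.norm_real, Real.norm_eq_abs, sq_abs, Complex.sq_norm,
      Complex.normSq_apply, sq z, Complex.mul_re]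
    ring
  simp only [h2, Function.comp_apply]
  have hi' : Integrable (fun z : ℂ => (z ^ 2).re) (μ N) := hi.re
  rw [integral_const_mul, integral_add (h.finite_moments N 2) hi']
  have h3 : ((N : ℂ) ^ k * ∫ z, z ^ 2 ∂(μ N)).re = (N : ℝ) ^ k * ∫ z, (z ^ 2).re ∂(μ N) := by
    rw [← Complex.ofReal_natCast, ← Complex.ofReal_pow, Complex.re_ofReal_mul]
    congr 1
    exact (integral_re hi).symm
  rw [h3]
  ring

theorem tendsto_twoRe (h : IsTensorModel k P M μ c c') {n : ℕ} (hn : 3 ≤ n) :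
    Tendsto (fun N : ℕ => (N : ℝ) ^ k * ∫ z, ‖z + starRingEnd ℂ z‖ ^ n ∂(μ N)) atTop (𝓝 0) := by
  have h1 := (h.tendsto_absMoment hn).const_mul (2 ^ n)
  rw [mul_zero] at h1
  refine squeeze_zero (fun N => mul_nonneg (by positivity)
    (integral_nonneg fun _ => pow_nonneg (norm_nonneg _) n)) (fun N => ?_) h1
  have h2 : ∫ z, ‖z + starRingEnd ℂ z‖ ^ n ∂(μ N) ≤ ∫ z, 2 ^ n * ‖z‖ ^ n ∂(μ N) := by
    refine integral_mono_of_nonneg (Eventually.of_forall fun z => pow_nonneg (norm_nonneg _) n)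
      ((h.finite_moments N n).const_mul _) (Eventually.of_forall fun z => ?_)
    simp only [← mul_pow]
    refine pow_le_pow_left₀ (norm_nonneg _) ((norm_add_le _ _).trans ?_) n
    rw [RCLike.norm_conj]
    linarith
  rw [integral_const_mul] at h2
  calc _ ≤ (N : ℝ) ^ k * (2 ^ n * ∫ z, ‖z‖ ^ n ∂(μ N)) :=
        mul_le_mul_of_nonneg_left h2 (by positivity)
    _ = _ := by ring

end IsTensorModel

/-! ### Symmetrised flattenings -/

theorem flattening_apply_eq {k N : ℕ} (T : Tensor k N) (σ : Equiv.Perm (Fin (k + k)))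
    (i j : Fin k → Fin N) : flattening T σ i j = T (Fin.append i j ∘ ⇑σ⁻¹) := rfl

theorem S₁_eq {k N : ℕ} (c : ℝ) (T : Tensor k N) :
    S₁ c T = (1 / √((2 * k).factorial * k.factorial * c) : ℝ) • symMat 1 T := by
  rw [S₁]
  congr 1
  ext i j
  simp [symMat, symT, Matrix.sum_apply, flattening_apply_eq]

theorem S₂_eq {k N : ℕ} (c : ℝ) (T : Tensor k N) :
    S₂ c T = (1 / √((2 * k).factorial * k.factorial * c) : ℝ) • symMat Equiv.Perm.sign T := by
  rw [S₂]
  congr 1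
  ext i j
  simp [symMat, symT, Matrix.sum_apply, flattening_apply_eq]

/-- The adjoint exchanges row and column legs, an exchange absorbed by the sum over all
permutations; only the conjugation of the entries remains. -/
theorem S₃_eq {k N : ℕ} (c : ℝ) (c' : ℂ) (T : Tensor k N) :
    S₃ c c' T = (1 / √((2 * k).factorial * k.factorial * (2 * (c + c'.re))) : ℝ) •
      symMat 1 (twoRe T) := by
  rw [S₃]
  congr 1
  ext i j
  have h1 := symT_comp 1 T (Fin.append i j) (finAddFlip : Equiv.Perm (Fin (k + k)))
  rw [← append_swap] at h1
  simp only [symT, MonoidHom.one_apply, Units.val_one, Int.cast_one, one_mul] at h1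
  simp only [symMat, symT, Matrix.of_apply, Matrix.sum_apply, Matrix.add_apply,
    Matrix.conjTranspose_apply, flattening_apply_eq, twoRe, MonoidHom.one_apply, Units.val_one,
    Int.cast_one, one_mul, RCLike.star_def, Finset.sum_add_distrib, ← map_sum, h1]

theorem sq_one_div_sqrt_mul {x y : ℝ} (hx : 0 < x) (hxy : x = y) : (1 / √x) ^ 2 * y = 1 := by
  subst hxy
  rw [div_pow, Real.sq_sqrt hx.le, one_pow, one_div, inv_mul_cancel₀ hx.ne']

theorem integral_pow_marchenkoPastur (r : ℕ) :
    ∫ x, x ^ r ∂marchenkoPastur = chebMoment 0 (2 * r) := by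
  rw [integral_marchenkoPastur (f := fun x => x ^ r) (by fun_prop), chebMoment_zero_left]
  simp only [pow_mul]

section Limits

variable {k : ℕ} {Ω : ℕ → Type*} [∀ N, MeasurableSpace (Ω N)] {P : ∀ N, Measure (Ω N)}
  [∀ N, IsProbabilityMeasure (P N)] {M : ∀ N, Ω N → Tensor k N} {m : ℕ → ℕ → ℝ}

/-- Convergence of averaged eigenvalue distributions from convergence of traces of powers. -/
theorem convergesWeakly_dilution {A : ∀ N, Ω N → Mat k N} (hA : ∀ N ω, (A N ω).IsHermitian)
    (hmom : ∀ N i j, AllMoments (P N) fun ω => A N ω i j) {ν : Measure ℝ}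
    [IsProbabilityMeasure ν] (hν : ν (Set.Icc (-4) 4)ᶜ = 0)
    (h : ∀ r, Tendsto (fun N : ℕ => ((N : ℂ) ^ k)⁻¹ * ∫ ω, (A N ω ^ (r + 1)).trace ∂(P N)) atTop
      (𝓝 ((1 / k.factorial * ∫ x, x ^ (r + 1) ∂ν : ℝ) : ℂ))) :
    ConvergesWeakly (fun N => averagedESD (P N) (A N) (hA N)) (dilution (1 / k.factorial) ν) := by
  -- The matrices can be empty at N = 0.
  have hne : ∀ᶠ N : ℕ in atTop, Nonempty (Fin k → Fin N) := by
    filter_upwards [eventually_gt_atTop 0] with N hN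
    exact ⟨fun _ => ⟨0, hN⟩⟩
  have hp1 : (1 : ℝ) / k.factorial ≤ 1 := by
    rw [div_le_one (by positivity)]
    exact_mod_cast k.factorial_pos
  refine convergesWeakly_of_moments (R := 4) ?_ (by norm_num) (dilution_compl (p := 1 / k.factorial) (by norm_num) hν)
    fun r => ?_
  · filter_upwards [hne] with N hN r
    exact integrable_pow_averagedESD (hmom N) (hA N) r
  rw [integral_pow_dilution hν (by positivity) hp1]
  have hcard : ∀ N : ℕ, (Fintype.card (Fin k → Fin N) : ℂ) = (N : ℂ) ^ k := by simp
  -- The total mass is 1, whereas all higher moments carry the factor 1/k!.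
  cases r with
  | zero =>
    refine tendsto_const_nhds.congr' ?_
    filter_upwards [hne] with N hN
    rw [integral_pow_averagedESD (hmom N) (hA N)]
    simp only [if_true, pow_zero, Matrix.trace_one]
    rw [inv_mul_cancel₀ (Nat.cast_ne_zero.2 Fintype.card_ne_zero)]
    simp
  | succ r =>
    simp only [Nat.add_eq_zero_iff, one_ne_zero, and_false, if_false]
    refine ((Complex.continuous_re.tendsto _).comp (h r)).congr' ?_
    filter_upwards [hne] with N hN
    rw [integral_pow_averagedESD (hmom N) (hA N), integral_const_mul, hcard]
    rfl

theorem CenteredTensor.allMoments_smul_symMat {N : ℕ} {P : Measure (Ω N)} [IsProbabilityMeasure P]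
    {M : Ω N → Tensor k N} {m : ℕ → ℝ} (h : CenteredTensor P M m)
    (χ : Equiv.Perm (Fin (k + k)) →* ℤˣ) (s : ℝ) (i j : Fin k → Fin N) :
    AllMoments P fun ω => (s • symMat χ (M ω)) i j := by
  simpa [symMat] using (h.allMoments_symT (χ := χ) (Fin.append i j)).const_mul (s : ℂ)

theorem convergesWeakly_mul_conjTranspose (h : ∀ N, CenteredTensor (P N) (M N) (m N)) (hk : 1 ≤ k)
    (χ : Equiv.Perm (Fin (k + k)) →* ℤˣ) {s c : ℝ} (hc : 0 < c)
    (hs : s ^ 2 * ((k + k).factorial * k.factorial * c) = 1)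
    (h2 : Tendsto (fun N : ℕ => (N : ℝ) ^ k * m N 2) atTop (𝓝 c))
    (h3 : ∀ n, 3 ≤ n → Tendsto (fun N : ℕ => (N : ℝ) ^ k * m N n) atTop (𝓝 0))
    {S : ∀ N, Ω N → Mat k N} (hS : ∀ N ω, S N ω = s • symMat χ (M N ω)) :
    ConvergesWeakly (fun N => averagedESD (P N) (fun ω => S N ω * (S N ω).conjTranspose)
      (fun ω => Matrix.isHermitian_mul_conjTranspose_self (S N ω)))
      (dilution (1 / k.factorial) marchenkoPastur) := by
  have hS' : ∀ N i j, AllMoments (P N) fun ω => S N ω i j := fun N i j => by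
    simpa only [hS] using (h N).allMoments_smul_symMat χ s i j
  refine convergesWeakly_dilution _ (fun N i j => ?_) marchenkoPastur_compl fun r => ?_
  · simp only [Matrix.mul_apply, Matrix.conjTranspose_apply, RCLike.star_def]
    exact AllMoments.sum _ fun l _ => (hS' N i l).mul (hS' N j l).conj
  · have h4 := CenteredTensor.tendsto_trace_altWord h hk χ hc hs h2 h3
      (d := chebMoment) (by simp [chebMoment_zero_right]) (by simp [chebMoment_zero_right])
      chebMoment_zero_succ chebMoment_succ_succ (2 * r + 1)
    simp only [← hS] at h4
    rw [integral_pow_marchenkoPastur]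
    simpa only [show 2 * r + 1 + 1 = 2 * (r + 1) by ring, altWord_true_two_mul] using h4

theorem convergesWeakly_semicircle (h : ∀ N, CenteredTensor (P N) (M N) (m N)) (hk : 1 ≤ k)
    (χ : Equiv.Perm (Fin (k + k)) →* ℤˣ) {s c : ℝ} (hc : 0 < c)
    (hs : s ^ 2 * ((k + k).factorial * k.factorial * c) = 1)
    (h2 : Tendsto (fun N : ℕ => (N : ℝ) ^ k * m N 2) atTop (𝓝 c))
    (h3 : ∀ n, 3 ≤ n → Tendsto (fun N : ℕ => (N : ℝ) ^ k * m N n) atTop (𝓝 0))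
    {S : ∀ N, Ω N → Mat k N} (hS : ∀ N ω, S N ω = s • symMat χ (M N ω))
    (hherm : ∀ N ω, (S N ω).IsHermitian) :
    ConvergesWeakly (fun N => averagedESD (P N) (S N) (hherm N))
      (dilution (1 / k.factorial) semicircle) := by
  refine convergesWeakly_dilution _ (fun N i j => ?_) semicircle_compl fun r => ?_
  · simpa only [hS] using (h N).allMoments_smul_symMat χ s i j
  · have h4 := CenteredTensor.tendsto_trace_altWord h hk χ hc hs h2 h3
      (d := chebMoment) (by simp [chebMoment_zero_right]) (by simp [chebMoment_zero_right])
      chebMoment_zero_succ chebMoment_succ_succ r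
    simp only [← hS, altWord_of_isHermitian (hherm _ _)] at h4
    rw [← chebMoment_zero_left]
    exact h4

end Limits

/-! ### Failure of asymptotic freeness -/

/-- Permuting the column legs permutes the columns, over which M M^* sums. -/
theorem flattening_blockPerm_mul_conjTranspose {k N : ℕ} (T : Tensor k N)
    (τ : Equiv.Perm (Fin k)) :
    flattening T (blockPerm 1 τ)⁻¹ * (flattening T (blockPerm 1 τ)⁻¹).conjTranspose
      = flattening T 1 * (flattening T 1).conjTranspose := by
  ext i l
  have h1 : ∀ i j, flattening T (blockPerm 1 τ)⁻¹ i j = flattening T 1 i (j ∘ τ) := fun i j => by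
    rw [flattening_apply_eq, flattening_apply_eq, inv_inv, append_comp_blockPerm]
    simp
  simp only [Matrix.mul_apply, Matrix.conjTranspose_apply, h1]
  exact Equiv.sum_comp (τ.arrowCongr (Equiv.refl (Fin N))).symm
    fun j => flattening T 1 i j * star (flattening T 1 l j)

theorem starEval_mul_star_sub {n : Type*} [Fintype n] [DecidableEq n] (A : Matrix n n ℂ) (c : ℂ) :
    starEval A (FreeAlgebra.ι ℂ false * FreeAlgebra.ι ℂ true - algebraMap ℂ _ c)
      = A * A.conjTranspose - c • 1 := by
  simp [starEval, Algebra.algebraMap_eq_smul_one]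

theorem trace_sq_re_of_isHermitian {n : Type*} [Fintype n] {H : Matrix n n ℂ}
    (hH : H.IsHermitian) : (H * H).trace = ((∑ i, ∑ l, ‖H i l‖ ^ 2 : ℝ) : ℂ) := by
  simp only [Matrix.trace, Matrix.diag, Matrix.mul_apply]
  push_cast
  refine Finset.sum_congr rfl fun i _ => Finset.sum_congr rfl fun l _ => ?_
  rw [← Complex.mul_conj', ← hH.apply l i]
  rfl

/-! ### Second moments of the Gram matrix M M^* -/

namespace CenteredTensor

variable {k N : ℕ} {Ω : Type*} [MeasurableSpace Ω] {P : Measure Ω} [IsProbabilityMeasure P]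
  {M : Ω → Tensor k N} {m : ℕ → ℝ}

theorem allMoments_gram (h : CenteredTensor P M m) (i l : Fin k → Fin N) :
    AllMoments P fun ω => (flattening (M ω) 1 * (flattening (M ω) 1).conjTranspose) i l := by
  simp only [Matrix.mul_apply, Matrix.conjTranspose_apply, RCLike.star_def, flattening_apply_eq]
  exact AllMoments.sum _ fun j _ => (h.moments _).mul (h.moments _).conj

theorem integral_gram_diag (h : CenteredTensor P M m) (i : Fin k → Fin N) :
    ∫ ω, (flattening (M ω) 1 * (flattening (M ω) 1).conjTranspose) i i ∂P
      = (N : ℂ) ^ k * m 2 := by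
  simp only [Matrix.mul_apply, Matrix.conjTranspose_apply, RCLike.star_def, flattening_apply_eq]
  rw [integral_finsetSum _ fun j _ => ((h.moments _).mul (h.moments _).conj).integrable]
  simp [h.integral_mul_conj]

/-- Distinct rows are independent, so each term of the double sum over columns factorizes, and only
j = j' contributes. -/
theorem integral_norm_gram_sq (h : CenteredTensor P M m) {i l : Fin k → Fin N} (hil : i ≠ l) :
    ∫ ω, ‖(flattening (M ω) 1 * (flattening (M ω) 1).conjTranspose) i l‖ ^ 2 ∂P
      = (N : ℝ) ^ k * m 2 ^ 2 := by
  set x := fun (i j : Fin k → Fin N) => Fin.append i j ∘ ⇑(1 : Equiv.Perm (Fin (k + k)))⁻¹ with hx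
  have hx1 : ∀ j j', x i j ≠ x l j' := fun j j' hj => hil <| by
    ext p
    have := congrFun hj (Fin.castAdd k p)
    simpa [hx] using congrArg Fin.val this
  have hx2 : ∀ i j j', x i j = x i j' ↔ j = j' := fun i j j' => by
    refine ⟨fun hj => ?_, fun hj => by rw [hj]⟩
    ext p
    have := congrFun hj (Fin.natAdd k p)
    simpa [hx, -Fin.natAdd_eq_addNat] using congrArg Fin.val this
  have h1 : ((∫ ω, ‖(flattening (M ω) 1 * (flattening (M ω) 1).conjTranspose) i l‖ ^ 2 ∂P : ℝ) : ℂ)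
      = ((N : ℝ) ^ k * m 2 ^ 2 : ℝ) := by
    rw [← integral_complex_ofReal]
    have h2 : ∀ ω, ((‖(flattening (M ω) 1 * (flattening (M ω) 1).conjTranspose) i l‖ ^ 2 : ℝ) : ℂ)
        = ∑ j, ∑ j', (M ω (x i j) * starRingEnd ℂ (M ω (x i j'))) *
          (M ω (x l j') * starRingEnd ℂ (M ω (x l j))) := by
      intro ω
      simp only [Matrix.mul_apply, Matrix.conjTranspose_apply, RCLike.star_def,
        flattening_apply_eq]
      rw [Complex.ofReal_pow, ← Complex.mul_conj', map_sum, Finset.sum_mul_sum]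
      refine Finset.sum_congr rfl fun j _ => Finset.sum_congr rfl fun j' _ => ?_
      simp only [map_mul, Complex.conj_conj, hx]
      ring
    have hi : ∀ j j', AllMoments P fun ω => (M ω (x i j) * starRingEnd ℂ (M ω (x i j'))) *
          (M ω (x l j') * starRingEnd ℂ (M ω (x l j))) := fun j j' =>
      ((h.moments _).mul (h.moments _).conj).mul ((h.moments _).mul (h.moments _).conj)
    simp only [h2]
    rw [integral_finsetSum _ fun j _ => (AllMoments.sum _ fun j' _ => hi j j').integrable]
    have h3 : ∀ j j', ∫ ω, (M ω (x i j) * starRingEnd ℂ (M ω (x i j'))) *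
          (M ω (x l j') * starRingEnd ℂ (M ω (x l j))) ∂P
        = if j = j' then (m 2 : ℂ) ^ 2 else 0 := by
      intro j j'
      have hind := (h.indep.indepFun_prodMk_prodMk (fun x => (h.moments x).measurable)
        (x i j) (x i j') (x l j') (x l j) (hx1 _ _) (hx1 _ _) (hx1 _ _) (hx1 _ _)).comp
        (φ := fun z : ℂ × ℂ => z.1 * starRingEnd ℂ z.2)
        (ψ := fun z : ℂ × ℂ => z.1 * starRingEnd ℂ z.2) (by fun_prop) (by fun_prop)
      have h4 := hind.integral_fun_mul_eq_mul_integral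
        ((h.moments _).mul (h.moments _).conj).measurable.aestronglyMeasurable
        ((h.moments _).mul (h.moments _).conj).measurable.aestronglyMeasurable
      simp only [Function.comp_apply] at h4
      rw [h4]
      have h5 := h.integral_mul_conj (x i j) (x i j')
      have h6 := h.integral_mul_conj (x l j') (x l j)
      change (∫ ω, M ω (x i j) * starRingEnd ℂ (M ω (x i j')) ∂P)
        * (∫ ω, M ω (x l j') * starRingEnd ℂ (M ω (x l j)) ∂P) = _
      rw [h5, h6]
      by_cases hj : j = j'
      · simp [hj, sq]
      · simp [hx2, hj, Ne.symm hj]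
    have h7 : ∀ j, ∫ ω, ∑ j', (M ω (x i j) * starRingEnd ℂ (M ω (x i j'))) *
          (M ω (x l j') * starRingEnd ℂ (M ω (x l j))) ∂P = (m 2 : ℂ) ^ 2 := by
      intro j
      rw [integral_finsetSum _ fun j' _ => (hi j j').integrable]
      simp [h3]
    simp [h7]
  exact_mod_cast h1

theorem meanTrace_gram_sub (h : CenteredTensor P M m) (hN : 0 < N) (c : ℂ) :
    meanTrace P (fun ω => flattening (M ω) 1 * (flattening (M ω) 1).conjTranspose - c • 1)
      = (N : ℂ) ^ k * m 2 - c := by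
  have hN' : (N : ℂ) ^ k ≠ 0 := pow_ne_zero _ (by exact_mod_cast hN.ne')
  rw [meanTrace, integral_const_mul]
  simp only [Matrix.trace_sub, Matrix.trace_smul, Matrix.trace_one]
  have hi : Integrable (fun ω =>
      (flattening (M ω) 1 * (flattening (M ω) 1).conjTranspose).trace) P :=
    (AllMoments.sum _ fun i _ => h.allMoments_gram i i).integrable
  rw [integral_sub hi (integrable_const _)]
  simp only [Matrix.trace, Matrix.diag]
  rw [integral_finsetSum _ fun i _ => (h.allMoments_gram i i).integrable]
  simp [h.integral_gram_diag]
  field_simp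

/-- The trace is a sum of squared moduli of entries. Keeping only the off-diagonal ones, which do
not see c, avoids any fourth moment: each row has N^k - 1 of them. -/
theorem le_meanTrace_gram_sub_sq (h : CenteredTensor P M m) (hN : 0 < N) (c : ℝ) :
    ((N : ℝ) ^ k * m 2) ^ 2 * (1 - ((N : ℝ) ^ k)⁻¹) ≤
      (meanTrace P fun ω =>
        (flattening (M ω) 1 * (flattening (M ω) 1).conjTranspose - (c : ℂ) • 1) *
        (flattening (M ω) 1 * (flattening (M ω) 1).conjTranspose - (c : ℂ) • 1)).re := by
  set G : Ω → Mat k N := fun ω => flattening (M ω) 1 * (flattening (M ω) 1).conjTranspose with hG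
  have hN' : (0 : ℝ) < (N : ℝ) ^ k := by positivity
  have hherm : ∀ ω, (G ω - (c : ℂ) • 1).IsHermitian := fun ω => by
    refine (Matrix.isHermitian_mul_conjTranspose_self _).sub ?_
    simp [Matrix.IsHermitian, Matrix.conjTranspose_smul]
  have hm : ∀ i l, AllMoments P fun ω => (G ω - (c : ℂ) • 1) i l := fun i l => by
    simpa [sub_eq_add_neg] using (h.allMoments_gram i l).add (.const (-((c : ℂ) • 1 : Mat k N) i l))
  have hi : ∀ i l, Integrable (fun ω => ‖(G ω - (c : ℂ) • 1) i l‖ ^ 2) P := fun i l =>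
    (hm i l).integrable_pow 2
  have h1 : (meanTrace P fun ω => (G ω - (c : ℂ) • 1) * (G ω - (c : ℂ) • 1)).re
      = ((N : ℝ) ^ k)⁻¹ * ∑ i, ∑ l, ∫ ω, ‖(G ω - (c : ℂ) • 1) i l‖ ^ 2 ∂P := by
    rw [meanTrace, integral_const_mul]
    simp only [trace_sq_re_of_isHermitian (hherm _)]
    rw [integral_complex_ofReal, integral_finsetSum _ fun i _ => integrable_finsetSum _ fun l _ =>
      hi i l]
    simp only [integral_finsetSum _ fun l _ => hi _ l]
    have hcard : (Fintype.card (Fin k → Fin N) : ℂ) = ((N : ℝ) ^ k : ℝ) := by simp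
    rw [hcard, ← Complex.ofReal_inv, ← Complex.ofReal_mul, Complex.ofReal_re]
  rw [h1]
  have h2 : ∀ i, ((N : ℝ) ^ k - 1) * ((N : ℝ) ^ k * m 2 ^ 2)
      ≤ ∑ l, ∫ ω, ‖(G ω - (c : ℂ) • 1) i l‖ ^ 2 ∂P := by
    intro i
    have h3 : ∑ l ∈ Finset.univ.erase i, ∫ ω, ‖(G ω - (c : ℂ) • 1) i l‖ ^ 2 ∂P
        = ((N : ℝ) ^ k - 1) * ((N : ℝ) ^ k * m 2 ^ 2) := by
      rw [Finset.sum_congr rfl (g := fun _ => (N : ℝ) ^ k * m 2 ^ 2) fun l hl => ?_]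
      · rw [Finset.sum_const, Finset.card_erase_of_mem (Finset.mem_univ _), nsmul_eq_mul,
          Nat.cast_sub (Finset.card_pos.2 ⟨i, Finset.mem_univ _⟩)]
        simp
      · have hil : i ≠ l := (Finset.ne_of_mem_erase hl).symm
        rw [← h.integral_norm_gram_sq hil]
        simp [hG, Matrix.one_apply_ne hil]
    rw [← h3]
    exact Finset.sum_le_sum_of_subset_of_nonneg (Finset.erase_subset _ _) fun l _ _ =>
      integral_nonneg fun _ => by positivity
  calc ((N : ℝ) ^ k * m 2) ^ 2 * (1 - ((N : ℝ) ^ k)⁻¹)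
      = ((N : ℝ) ^ k)⁻¹ * ∑ _i : Fin k → Fin N, ((N : ℝ) ^ k - 1) * ((N : ℝ) ^ k * m 2 ^ 2) := by
        simp
        field_simp
    _ ≤ _ := by
        gcongr
        exact h2 _

end CenteredTensor

theorem not_asymptoticallyFree_flattening {k : ℕ} (hk : 2 ≤ k) {Ω : ℕ → Type*}
    [∀ N, MeasurableSpace (Ω N)] {P : ∀ N, Measure (Ω N)} [∀ N, IsProbabilityMeasure (P N)]
    {M : ∀ N, Ω N → Tensor k N} {m : ℕ → ℕ → ℝ} (h : ∀ N, CenteredTensor (P N) (M N) (m N))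
    {c : ℝ} (hc : 0 < c) (h2 : Tendsto (fun N : ℕ => (N : ℝ) ^ k * m N 2) atTop (𝓝 c)) :
    ¬ AsymptoticallyFree P
      (fun N (σ : Equiv.Perm (Fin (k + k))) ω => flattening (M N ω) σ) := by
  rintro ⟨-, hfree⟩
  -- Two column legs to exchange exist because k ≥ 2.
  set τ : Equiv.Perm (Fin k) := Equiv.swap ⟨0, by omega⟩ ⟨1, by omega⟩ with hτ
  set σ : Equiv.Perm (Fin (k + k)) := (blockPerm 1 τ)⁻¹ with hσ
  have hne : (1 : Equiv.Perm (Fin (k + k))) ≠ σ := by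
    intro h1
    have h2 : blockPerm 1 τ = 1 := by rw [← inv_inv (blockPerm 1 τ), ← hσ, ← h1, inv_one]
    have h3 := DFunLike.congr_fun h2 (Fin.natAdd k ⟨0, by omega⟩)
    simp only [blockPerm, Equiv.permCongr_apply, finSumFinEquiv_symm_apply_natAdd,
      Equiv.sumCongr_apply, Sum.map_inr, finSumFinEquiv_apply_right, hτ, Equiv.swap_apply_left,
      Equiv.Perm.one_apply, Fin.ext_iff, Fin.val_natAdd] at h3
    omega
  set p : FreeAlgebra ℂ Bool :=
    FreeAlgebra.ι ℂ false * FreeAlgebra.ι ℂ true - algebraMap ℂ _ (c : ℂ) with hp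
  have hev : ∀ N ω, starEval (flattening (M N ω) 1) p
      = flattening (M N ω) 1 * (flattening (M N ω) 1).conjTranspose - (c : ℂ) • 1 := fun N ω =>
    starEval_mul_star_sub _ _
  have hev' : ∀ N ω, starEval (flattening (M N ω) σ) p
      = flattening (M N ω) 1 * (flattening (M N ω) 1).conjTranspose - (c : ℂ) • 1 := fun N ω => by
    rw [hp, starEval_mul_star_sub, hσ, flattening_blockPerm_mul_conjTranspose]
  have hlim : Tendsto (fun N => meanTrace (P N) fun ω =>
      flattening (M N ω) 1 * (flattening (M N ω) 1).conjTranspose - (c : ℂ) • 1) atTop (𝓝 0) := by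
    have h3 := ((Complex.continuous_ofReal.tendsto _).comp h2).sub_const (c : ℂ)
    rw [sub_self] at h3
    refine h3.congr' ?_
    filter_upwards [eventually_gt_atTop 0] with N hN
    rw [(h N).meanTrace_gram_sub hN]
    simp
  have h4 := hfree [(1, p), (σ, p)] (by simp) (by simpa using hne) (by
    simp only [List.mem_cons, List.not_mem_nil, or_false]
    rintro q (rfl | rfl)
    · simpa only [hev] using hlim
    · simpa only [hev'] using hlim)
  simp only [List.map_cons, List.map_nil, List.prod_cons, List.prod_nil, mul_one, hev, hev'] at h4
  have h5 := (Complex.continuous_re.tendsto _).comp h4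
  have hinv : Tendsto (fun N : ℕ => ((N : ℝ) ^ k)⁻¹) atTop (𝓝 0) :=
    ((tendsto_pow_atTop (by omega)).comp tendsto_natCast_atTop_atTop).inv_tendsto_atTop
  -- The lower bound tends to c², so freeness would give c² ≤ 0.
  have h6 := (h2.pow 2).mul (hinv.const_sub 1)
  have h7 := le_of_tendsto_of_tendsto h6 h5 (by
    filter_upwards [eventually_gt_atTop 0] with N hN
    exact (h N).le_meanTrace_gram_sub_sq hN c)
  simp at h7
  nlinarith

end Flattenings

end

theorem corollary1p4 (k : ℕ) (hk : 1 ≤ k)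
    {Ω : ℕ → Type*} [∀ N, MeasurableSpace (Ω N)]
    (P : ∀ N, Measure (Ω N)) [∀ N, IsProbabilityMeasure (P N)]
    (M : ∀ N, Ω N → Flattenings.Tensor k N) (μ : ℕ → Measure ℂ) (c : ℝ) (c' : ℂ)
    (hM : Flattenings.IsTensorModel k P M μ c c') :
    Flattenings.ConvergesWeakly
        (fun N => Flattenings.averagedESD (P N)
          (fun ω => Flattenings.S₁ c (M N ω) * (Flattenings.S₁ c (M N ω)).conjTranspose)
          (fun ω => Matrix.isHermitian_mul_conjTranspose_self (Flattenings.S₁ c (M N ω))))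
        (Flattenings.dilution (1 / k.factorial) Flattenings.marchenkoPastur) ∧
      Flattenings.ConvergesWeakly
        (fun N => Flattenings.averagedESD (P N)
          (fun ω => Flattenings.S₂ c (M N ω) * (Flattenings.S₂ c (M N ω)).conjTranspose)
          (fun ω => Matrix.isHermitian_mul_conjTranspose_self (Flattenings.S₂ c (M N ω))))
        (Flattenings.dilution (1 / k.factorial) Flattenings.marchenkoPastur) ∧
      (0 < c + c'.re →
        Flattenings.ConvergesWeakly
          (fun N => Flattenings.averagedESD (P N)
            (fun ω => Flattenings.S₃ c c' (M N ω))
            (fun ω => Flattenings.isHermitian_S₃ c c' (M N ω)))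
          (Flattenings.dilution (1 / k.factorial) Flattenings.semicircle)) ∧
      (2 ≤ k →
        ¬ Flattenings.AsymptoticallyFree P
          (fun N (σ : Equiv.Perm (Fin (k + k))) ω => Flattenings.flattening (M N ω) σ)) := by
  have hc := hM.c_pos
  have hs : ∀ c : ℝ, 0 < c → (1 / √((2 * k).factorial * k.factorial * c)) ^ 2 *
      ((k + k).factorial * k.factorial * c) = 1 := fun c hc =>
    Flattenings.sq_one_div_sqrt_mul (by positivity) (by rw [two_mul])
  exact ⟨Flattenings.convergesWeakly_mul_conjTranspose hM.centeredTensor hk 1 hc (hs c hc)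
      hM.tendsto_c (fun _ => hM.tendsto_absMoment) fun N ω => Flattenings.S₁_eq c (M N ω),
    Flattenings.convergesWeakly_mul_conjTranspose hM.centeredTensor hk Equiv.Perm.sign hc (hs c hc)
      hM.tendsto_c (fun _ => hM.tendsto_absMoment) fun N ω => Flattenings.S₂_eq c (M N ω),
    -- For the tensor 2 Re M the role of c is played by 2 (c + Re c').
    fun h => Flattenings.convergesWeakly_semicircle hM.centeredTensor_twoRe hk 1
      (by linarith) (hs _ (by linarith)) hM.tendsto_twoRe_two (fun _ => hM.tendsto_twoRe)
      (fun N ω => Flattenings.S₃_eq c c' (M N ω)) _,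
    fun hk2 => Flattenings.not_asymptoticallyFree_flattening hk2 hM.centeredTensor hc
      hM.tendsto_c⟩
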